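/- Let $k$ be a field of arbitrary characteristic. For a $k$-algebra $R$ write $R^{[1]}$ for the polynomial ring over $R$ in one variable; isomorphisms are isomorphisms of $k$-algebras. Let $n\ge 1$, $\underline{X}=(X_1,\dots,X_n)$, and for $[a]=(a_1,\dots,a_n)\in\mathbb{N}^n$ put $\underline{X}^{[a]}=X_1^{a_1}\cdots X_n^{a_n}$. Let $P\in k[\underline{X},Z]$ be monic in $Z$ with $\deg_Z P\ge 2$ and let $Q\in k[\underline{X},Y,Z]$ be monic in $Y$ with $\deg_Y Q\ge 2$. For $[d],[e]\in\mathbb{N}_{\ge 1}^n$ let \[L_{[d],[e]}=\frac{k[\underline{X},Y,Z,T]}{\left(\underline{X}^{[d]}Y-P(\underline{X},Z),\ \underline{X}^{[e]}T-Q(\underline{X},Y,Z)\right)}.\] Put $P'=\partial P/\partial Z$ and $Q'=\partial Q/\partial Y$, and suppose that for every $i\in\{1,\dots,n\}$ \[\left(P|_{X_i=0},\,P'|_{X_i=0}\right)=k[X_j\,(j\ne i),Z]\quad\text{and}\quad \left(P|_{X_i=0},\,Q|_{X_i=0},\,Q'|_{X_i=0}\right)=k[X_j\,(j\ne i),Y,Z].\]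 Then for all $[d],[e]\in\mathbb{N}_{\ge1}^n$ and every $[e']$ obtained from $[e]$ by adding $1$ to each component in some non-empty set of components (in particular for $[e']=[e]+1=(e_1+1,\dots,e_n+1)$), the $k$-algebras $L_{[d],[e]}$ and $L_{[d],[e']}$ are finitely generated integral domains of Krull dimension $n+1$, \[L_{[d],[e]}\not\cong L_{[d],[e']},\qquad\text{but}\qquad L_{[d],[e]}^{[1]}\cong L_{[d],[e']}^{[1]}.\] Consequently the Cancellation Problem has a negative answer over every field $k$ in every dimension $m\ge 2$: there are finitely generated $k$-algebras $F$ and $G$, integral domains of Krull dimension $m$, such that $F^{[1]}\cong G^{[1]}$ but $F\not\cong G$. -/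

import Mathlib

open Polynomial

universe u

noncomputable section

namespace DoubleDanielewski

/-- The polynomial ring `k[X₁, …, Xₙ]`.  A polynomial `P(X, Z)` is given as an element of
`k[X][Z] = (Base k n)[X]`, and a polynomial `Q(X, Y, Z)` as an element of
`k[X][Z][Y] = (Base k n)[X][X]`, the outermost variable being `Y`.  Thus `Monic`, `natDegree` and
`derivative` refer to the variable `Z` for `P` and to the variable `Y` for `Q`. -/
abbrev Base (k : Type u) [Field k] (n : ℕ) : Type u := MvPolynomial (Fin n) k

/-- The polynomial ring `k[X₁, …, Xₙ, Y, Z, T]`. -/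
abbrev Ambient (k : Type u) [Field k] (n : ℕ) : Type u := MvPolynomial (Fin n ⊕ Fin 3) k

section

variable (k : Type u) [Field k] (n : ℕ)

/-- The variable `Y` of `k[X, Y, Z, T]`. -/
def varY : Ambient k n := MvPolynomial.X (Sum.inr 0)

/-- The variable `Z` of `k[X, Y, Z, T]`. -/
def varZ : Ambient k n := MvPolynomial.X (Sum.inr 1)

/-- The variable `T` of `k[X, Y, Z, T]`. -/
def varT : Ambient k n := MvPolynomial.X (Sum.inr 2)

/-- The inclusion `k[X] → k[X, Y, Z, T]`. -/
def inclX : Base k n →+* Ambient k n := (MvPolynomial.rename Sum.inl).toRingHom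

/-- The inclusion `k[X, Z] → k[X, Y, Z, T]`. -/
def inclXZ : (Base k n)[X] →+* Ambient k n := eval₂RingHom (inclX k n) (varZ k n)

/-- The inclusion `k[X, Y, Z] → k[X, Y, Z, T]`. -/
def inclXYZ : (Base k n)[X][X] →+* Ambient k n := eval₂RingHom (inclXZ k n) (varY k n)

end

/-- The monomial `X^[a] = X₁^{a₁} ⋯ Xₙ^{aₙ}` in `k[X, Y, Z, T]`. -/
def mono (k : Type u) [Field k] {n : ℕ} (a : Fin n → ℕ) : Ambient k n :=
  ∏ i, MvPolynomial.X (Sum.inl i) ^ a i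

/-- The ideal `(X^[d] Y - P(X, Z), X^[e] T - Q(X, Y, Z))` of `k[X, Y, Z, T]`. -/
def relations {k : Type u} [Field k] {n : ℕ} (d e : Fin n → ℕ)
    (P : (Base k n)[X]) (Q : (Base k n)[X][X]) : Ideal (Ambient k n) :=
  Ideal.span
    {mono k d * varY k n - inclXZ k n P, mono k e * varT k n - inclXYZ k n Q}

/-- The `k`-algebra
`L_{[d],[e]} = k[X, Y, Z, T] / (X^[d] Y - P(X, Z), X^[e] T - Q(X, Y, Z))`. -/
abbrev L {k : Type u} [Field k] {n : ℕ} (d e : Fin n → ℕ)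
    (P : (Base k n)[X]) (Q : (Base k n)[X][X]) : Type u :=
  Ambient k n ⧸ relations d e P Q

/-- The substitution `X_i = 0`, from `k[X₁, …, Xₙ]` to the polynomial ring in the variables
`X_j`, `j ≠ i`. -/
def setZero (k : Type u) [Field k] {n : ℕ} (i : Fin n) :
    Base k n →ₐ[k] MvPolynomial {j : Fin n // j ≠ i} k :=
  MvPolynomial.aeval fun j => if h : j = i then 0 else MvPolynomial.X ⟨j, h⟩

/-- `X_i = 0` in a polynomial `P(X, Z)`. -/
def setZeroZ {k : Type u} [Field k] {n : ℕ} (i : Fin n) (P : (Base k n)[X]) :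
    (MvPolynomial {j : Fin n // j ≠ i} k)[X] :=
  P.map (setZero k i).toRingHom

/-- `X_i = 0` in a polynomial `Q(X, Y, Z)`. -/
def setZeroYZ {k : Type u} [Field k] {n : ℕ} (i : Fin n) (Q : (Base k n)[X][X]) :
    (MvPolynomial {j : Fin n // j ≠ i} k)[X][X] :=
  Q.map (mapRingHom (setZero k i).toRingHom)

/-- The affirmative answer to the Cancellation Problem over `k` for integral domains of Krull
dimension `m`. -/
def CancellationHolds (k : Type u) [Field k] (m : ℕ) : Prop :=
  ∀ (F G : Type u) [CommRing F] [CommRing G] [IsDomain F] [IsDomain G]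
    [Algebra k F] [Algebra k G] [Algebra.FiniteType k F] [Algebra.FiniteType k G],
    ringKrullDim F = m → ringKrullDim G = m →
    Nonempty (F[X] ≃ₐ[k] G[X]) → Nonempty (F ≃ₐ[k] G)

end DoubleDanielewski

end

-- Write q for the product of the Xᵢ with i in S, so that X^[e'] = q X^[e], and write r = deg P, s =
-- deg Q and J = Q'P'.
--
-- Stable isomorphism. Replacing Z by Z + X^[d] X^[e] w carries a solution (y, t) of the two
-- defining equations to another one and changes t by wJ modulo q (`exists_translate`). The unit
-- ideal hypotheses provide a polynomial c that inverts J modulo P, Q and q (`exists_bezout`). With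
-- w = -(cT - qV) the new t is divisible by q, and dividing by q gives a solution for e'
-- (`exists_solution_succ`). Conversely, a translation by a free variable W turns a solution for e'
-- into one for e, from which W is recovered as cT - qV (`exists_solution_pred`). These
-- substitutions are mutually inverse isomorphisms of the polynomial rings
-- (`nonempty_algEquiv_of_translate`).
--
-- Non-isomorphism, step one: every isomorphism preserves k[X]. Exponential maps take the place of
-- locally nilpotent derivations, so the characteristic is irrelevant. For each i₀, order the
-- monomials in X and Z first by the order of pole along X_{i₀}. The leading forms of L then make up
-- the monomial algebra with relations x^[d] y = z^r and x^[e] t = y^s (`frame`). The leading part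
-- of a nontrivial exponential map multiplies on monomials (`IsSlope`), its degrees on the
-- generators obey the two relations, and divisibility by the smallest positive degree shows that y,
-- z and t all move (`formDeg_Y_Z_ne_zero`, `formDeg_T_ne_zero`). So the leading monomial of an
-- invariant involves only the xⱼ, and modulo X_{i₀} an invariant is a polynomial in the remaining n
-- - 1 variables. Among n algebraically independent invariants this forces a relation modulo X_{i₀};
-- hence X_{i₀} divides a nonzero invariant and is itself invariant (`genX_invariant`). Apply this
-- to the transport of the map Z ↦ Z + X^[d] X^[e] U, whose invariants are exactly k[X].
--
-- Step two: comparison of exponents. An isomorphism induces an automorphism σ of k[X], and the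
-- preimage ζ of the second Z satisfies cζ = aZ + b with a, c coprime in k[X]. The linear
-- coefficient f of the standard map at ζ satisfies cf = a X^[d+e]. On the other side,
-- differentiating the two relations, and using that J is a unit on the fibres over Xᵢ = 0, gives
-- X^[d+e'] ∣ σf (`powProd_dvd_of_coeff_one`). No σ⁻¹(Xⱼ) divides a, because Z satisfies no linear
-- equation over Xⱼ = 0. So the product of the σ⁻¹(Xᵢ)^(dᵢ+e'ᵢ) divides X^[d+e], and total degrees
-- give Σe' ≤ Σe, which fails for nonempty S.
--
-- Dimension. L becomes k[X, Z] after monomials in X are inverted, so its transcendence degree is n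
-- + 1.

universe v w

set_option linter.unusedSectionVars false

noncomputable section

namespace DoubleDanielewski

/-! ### Evaluation, translation of solutions, and the presentation of L -/

section

section Evaluation

variable {k : Type u} [Field k] {n : ℕ}

/-- The monomial `∏ xᵢ ^ aᵢ` in the elements `xᵢ` of a commutative ring. -/
def powProd {R : Type v} [CommMonoid R] (x : Fin n → R) (a : Fin n → ℕ) : R := ∏ i, x i ^ a i

/-- The value `P(x, z)`. -/
def evalXZ {R : Type v} [CommRing R] [Algebra k R] (x : Fin n → R) (z : R) :
    (Base k n)[X] →+* R :=
  eval₂RingHom (MvPolynomial.aeval x : Base k n →ₐ[k] R).toRingHom z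

/-- The value `Q(x, y, z)`. -/
def evalXYZ {R : Type v} [CommRing R] [Algebra k R] (x : Fin n → R) (y z : R) :
    (Base k n)[X][X] →+* R :=
  eval₂RingHom (evalXZ x z) y

variable {R : Type v} [CommRing R] [Algebra k R] {R' : Type w} [CommRing R'] [Algebra k R']

@[simp] lemma evalXZ_X (x : Fin n → R) (z : R) : evalXZ (k := k) x z X = z := by simp [evalXZ]

@[simp] lemma evalXZ_C (x : Fin n → R) (z : R) (b : Base k n) :
    evalXZ x z (C b) = MvPolynomial.aeval x b := by simp [evalXZ]

@[simp] lemma evalXYZ_X (x : Fin n → R) (y z : R) : evalXYZ (k := k) x y z X = y := by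
  simp [evalXYZ]

@[simp] lemma evalXYZ_C (x : Fin n → R) (y z : R) (p : (Base k n)[X]) :
    evalXYZ x y z (C p) = evalXZ x z p := by simp [evalXYZ]

lemma powProd_add {M : Type v} [CommMonoid M] (x : Fin n → M) (a b : Fin n → ℕ) :
    powProd x (a + b) = powProd x a * powProd x b := by
  simp [powProd, pow_add, Finset.prod_mul_distrib]

lemma map_powProd {F : Type*} {M : Type v} {N : Type w} [CommMonoid M] [CommMonoid N]
    [FunLike F M N] [MonoidHomClass F M N] (f : F) (x : Fin n → M) (a : Fin n → ℕ) :
    f (powProd x a) = powProd (fun i => f (x i)) a := by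
  simp [powProd, map_prod, map_pow]

lemma dvd_powProd {M : Type v} [CommMonoid M] (x : Fin n → M) {a : Fin n → ℕ} {i : Fin n}
    (h : 1 ≤ a i) : x i ∣ powProd x a :=
  (dvd_pow_self (x i) (by omega)).trans (Finset.dvd_prod_of_mem _ (Finset.mem_univ i))

lemma map_evalXZ (f : R →ₐ[k] R') (x : Fin n → R) (z : R) (P : (Base k n)[X]) :
    f (evalXZ x z P) = evalXZ (fun i => f (x i)) (f z) P := by
  have : (f : R →+* R').comp (evalXZ (k := k) x z) = evalXZ (fun i => f (x i)) (f z) := by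
    refine Polynomial.ringHom_ext (fun b => ?_) (by simp)
    simp only [RingHom.comp_apply, evalXZ_C]
    exact (MvPolynomial.comp_aeval_apply x f b)
  exact RingHom.congr_fun this P

lemma map_evalXYZ (f : R →ₐ[k] R') (x : Fin n → R) (y z : R) (Q : (Base k n)[X][X]) :
    f (evalXYZ x y z Q) = evalXYZ (fun i => f (x i)) (f y) (f z) Q := by
  have : (f : R →+* R').comp (evalXYZ (k := k) x y z) = evalXYZ (fun i => f (x i)) (f y) (f z) := by
    refine Polynomial.ringHom_ext (fun b => ?_) (by simp)
    simp only [RingHom.comp_apply, evalXYZ_C]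
    exact map_evalXZ f x z b
  exact RingHom.congr_fun this Q

lemma exists_eval₂_add {S : Type w} [CommRing S] (f : S →+* R) (p : S[X]) (a h : R) :
    ∃ c, p.eval₂ f (a + h) = p.eval₂ f a + (derivative p).eval₂ f a * h + c * h ^ 2 := by
  obtain ⟨c, hc⟩ := (p.map f).binomExpansion a h
  exact ⟨c, by simpa [eval₂_eq_eval_map, derivative_map] using hc⟩

lemma exists_evalXZ_add (x : Fin n → R) (z h : R) (P : (Base k n)[X]) :
    ∃ c, evalXZ x (z + h) P = evalXZ x z P + evalXZ x z (derivative P) * h + c * h ^ 2 :=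
  exists_eval₂_add _ P z h

lemma exists_evalXYZ_add (x : Fin n → R) (y z h : R) (Q : (Base k n)[X][X]) :
    ∃ c, evalXYZ x (y + h) z Q =
      evalXYZ x y z Q + evalXYZ x y z (derivative Q) * h + c * h ^ 2 :=
  exists_eval₂_add _ Q y h

/-- Modulo h the two evaluations are the same homomorphism. -/
lemma dvd_eval₂_sub_eval₂ {S : Type w} [CommRing S] (f g : S →+* R) (a b h : R)
    (hfg : ∀ s, h ∣ f s - g s) (hab : h ∣ a - b) (p : S[X]) :
    h ∣ p.eval₂ f a - p.eval₂ g b := by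
  have hI : ∀ r : R, h ∣ r ↔ Ideal.Quotient.mk (Ideal.span {h}) r = 0 := fun r => by
    rw [Ideal.Quotient.eq_zero_iff_mem, Ideal.mem_span_singleton]
  simp only [hI, map_sub, sub_eq_zero] at hfg hab ⊢
  rw [hom_eval₂, hom_eval₂, hab]
  congr 1
  ext s
  exact hfg s

lemma dvd_evalXZ_sub (x : Fin n → R) {z z' h : R} (hz : h ∣ z - z') (P : (Base k n)[X]) :
    h ∣ evalXZ x z P - evalXZ x z' P :=
  dvd_eval₂_sub_eval₂ _ _ _ _ _ (fun s => by simp) hz P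

lemma dvd_evalXYZ_sub (x : Fin n → R) {y y' z z' h : R} (hy : h ∣ y - y') (hz : h ∣ z - z')
    (Q : (Base k n)[X][X]) : h ∣ evalXYZ x y z Q - evalXYZ x y' z' Q :=
  dvd_eval₂_sub_eval₂ _ _ _ _ _ (dvd_evalXZ_sub x hz) hy Q

/-- Translating `z` by `D E w` moves a solution of `D y = P(x, z)`, `E t = Q(x, y, z)` to a
solution, and the effect on `t` is known modulo every common divisor of `D` and `E`. -/
lemma exists_translate (P : (Base k n)[X]) (Q : (Base k n)[X][X]) (x : Fin n → R)
    {y z t D E q : R} (w : R) (hy : D * y = evalXZ x z P) (ht : E * t = evalXYZ x y z Q)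
    (hD : q ∣ D) (hE : q ∣ E) :
    ∃ y₁ t₁, D * y₁ = evalXZ x (z + D * E * w) P ∧
      E * t₁ = evalXYZ x y₁ (z + D * E * w) Q ∧ q ∣ y₁ - y ∧
      q ∣ t₁ - (t + w * (evalXYZ x y z (derivative Q) * evalXZ x z (derivative P))) := by
  obtain ⟨c₁, h₁⟩ := exists_evalXZ_add x z (D * E * w) P
  -- Here P(z + DEw) - P(z) = DEg, so y moves by Eg. Then Q changes by a multiple of E, and t moves
  -- by that multiple divided by E.
  set g := evalXZ x z (derivative P) * w + c₁ * D * E * w ^ 2 with hg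
  obtain ⟨c₂, h₂⟩ := exists_evalXYZ_add x y z (E * g) Q
  obtain ⟨c₃, h₃⟩ := dvd_evalXYZ_sub x (h := D * E * w) (y := y + E * g) (y' := y + E * g)
    (z := z + D * E * w) (z' := z) (by simp) (by simp) Q
  refine ⟨y + E * g, t + evalXYZ x y z (derivative Q) * g + c₂ * E * g ^ 2 + D * w * c₃,
    ?_, ?_, ?_, ?_⟩
  · rw [h₁, ← hy, hg]; ring
  · rw [sub_eq_iff_eq_add] at h₃
    rw [h₃, h₂, ← ht]; ring
  · rw [add_sub_cancel_left]; exact hE.mul_right _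
  · obtain ⟨D', rfl⟩ := hD
    obtain ⟨E', rfl⟩ := hE
    refine ⟨evalXYZ x y z (derivative Q) * (c₁ * D' * (q * E') * w ^ 2) + c₂ * E' * g ^ 2
      + D' * w * c₃, ?_⟩
    rw [hg]; ring

end Evaluation

section Presentation

variable {k : Type u} [Field k] {n : ℕ} {d e : Fin n → ℕ}
  {P : (Base k n)[X]} {Q : (Base k n)[X][X]}

lemma inclXZ_eq : inclXZ k n =
    evalXZ (fun i => (MvPolynomial.X (Sum.inl i) : Ambient k n)) (varZ k n) := by
  refine Polynomial.ringHom_ext (fun b => ?_) (by simp [inclXZ])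
  simp only [inclXZ, coe_eval₂RingHom, eval₂_C, evalXZ_C, inclX]
  exact DFunLike.congr_fun (MvPolynomial.rename_eq_aeval Sum.inl) b

lemma inclXYZ_eq : inclXYZ k n =
    evalXYZ (fun i => (MvPolynomial.X (Sum.inl i) : Ambient k n)) (varY k n) (varZ k n) := by
  refine Polynomial.ringHom_ext (fun b => ?_) (by simp [inclXYZ])
  simp [inclXYZ, inclXZ_eq]

variable (d e P Q) in
/-- The class of `Xᵢ`. -/
def genX (i : Fin n) : L d e P Q := Ideal.Quotient.mk _ (MvPolynomial.X (Sum.inl i))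
variable (d e P Q) in
/-- The class of `Y`. -/
def genY : L d e P Q := Ideal.Quotient.mk _ (varY k n)
variable (d e P Q) in
/-- The class of `Z`. -/
def genZ : L d e P Q := Ideal.Quotient.mk _ (varZ k n)
variable (d e P Q) in
/-- The class of `T`. -/
def genT : L d e P Q := Ideal.Quotient.mk _ (varT k n)

variable (d e P Q) in
lemma relation_genY :
    powProd (genX d e P Q) d * genY d e P Q = evalXZ (genX d e P Q) (genZ d e P Q) P := by
  have h : Ideal.Quotient.mkₐ k (relations d e P Q) (mono k d * varY k n - inclXZ k n P) = 0 :=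
    Ideal.Quotient.eq_zero_iff_mem.2 (Ideal.subset_span (by simp))
  rw [map_sub, sub_eq_zero, inclXZ_eq, map_evalXZ, map_mul] at h
  rw [show mono k d = powProd (fun i => MvPolynomial.X (Sum.inl i)) d from rfl,
    map_powProd] at h
  exact h

variable (d e P Q) in
lemma relation_genT : powProd (genX d e P Q) e * genT d e P Q =
    evalXYZ (genX d e P Q) (genY d e P Q) (genZ d e P Q) Q := by
  have h : Ideal.Quotient.mkₐ k (relations d e P Q) (mono k e * varT k n - inclXYZ k n Q) = 0 :=
    Ideal.Quotient.eq_zero_iff_mem.2 (Ideal.subset_span (by simp))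
  rw [map_sub, sub_eq_zero, inclXYZ_eq, map_evalXYZ, map_mul] at h
  rw [show mono k e = powProd (fun i => MvPolynomial.X (Sum.inl i)) e from rfl,
    map_powProd] at h
  exact h

variable {R : Type v} [CommRing R] [Algebra k R]

/-- The universal property of `L d e P Q`. -/
def lift (x : Fin n → R) (y z t : R) (hy : powProd x d * y = evalXZ x z P)
    (ht : powProd x e * t = evalXYZ x y z Q) : L d e P Q →ₐ[k] R :=
  Ideal.Quotient.liftₐ _ (MvPolynomial.aeval (Sum.elim x ![y, z, t])) (by
    have H : relations d e P Q ≤ RingHom.ker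
        (MvPolynomial.aeval (Sum.elim x ![y, z, t]) : Ambient k n →ₐ[k] R) := by
      rw [relations, Ideal.span_le]
      rintro a (rfl | rfl)
      · rw [SetLike.mem_coe, RingHom.mem_ker, map_sub, sub_eq_zero, inclXZ_eq, map_evalXZ, map_mul,
          show mono k d = powProd (fun i => MvPolynomial.X (Sum.inl i)) d from rfl, map_powProd]
        simpa [varY, varZ] using hy
      · rw [SetLike.mem_coe, RingHom.mem_ker, map_sub, sub_eq_zero, inclXYZ_eq, map_evalXYZ,
          map_mul, show mono k e = powProd (fun i => MvPolynomial.X (Sum.inl i)) e from rfl,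
          map_powProd]
        simpa [varY, varZ, varT] using ht
    exact fun a ha => H ha)

section
variable (x : Fin n → R) (y z t : R) (hy : powProd x d * y = evalXZ x z P)
    (ht : powProd x e * t = evalXYZ x y z Q)

@[simp] lemma lift_genX (i : Fin n) : lift x y z t hy ht (genX d e P Q i) = x i := by
  change MvPolynomial.aeval (Sum.elim x ![y, z, t]) (MvPolynomial.X (Sum.inl i)) = _
  simp
@[simp] lemma lift_genY : lift x y z t hy ht (genY d e P Q) = y := by
  change MvPolynomial.aeval (Sum.elim x ![y, z, t]) (MvPolynomial.X (Sum.inr 0)) = _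
  simp
@[simp] lemma lift_genZ : lift x y z t hy ht (genZ d e P Q) = z := by
  change MvPolynomial.aeval (Sum.elim x ![y, z, t]) (MvPolynomial.X (Sum.inr 1)) = _
  simp
@[simp] lemma lift_genT : lift x y z t hy ht (genT d e P Q) = t := by
  change MvPolynomial.aeval (Sum.elim x ![y, z, t]) (MvPolynomial.X (Sum.inr 2)) = _
  simp
end

lemma algHom_ext' {f g : L d e P Q →ₐ[k] R} (hX : ∀ i, f (genX d e P Q i) = g (genX d e P Q i))
    (hY : f (genY d e P Q) = g (genY d e P Q)) (hZ : f (genZ d e P Q) = g (genZ d e P Q))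
    (hT : f (genT d e P Q) = g (genT d e P Q)) : f = g := by
  refine Ideal.Quotient.algHom_ext _ (MvPolynomial.algHom_ext (fun s => ?_))
  rcases s with i | s
  · exact hX i
  · fin_cases s
    · exact hY
    · exact hZ
    · exact hT

/-- Homomorphisms to a ring in which the `Xᵢ` act injectively are determined by the images of the
`Xᵢ` and of `Z`. -/
lemma algHom_ext_of_isLeftRegular {f g : L d e P Q →ₐ[k] R}
    (hreg : ∀ i, IsLeftRegular (f (genX d e P Q i)))
    (hX : ∀ i, f (genX d e P Q i) = g (genX d e P Q i))
    (hZ : f (genZ d e P Q) = g (genZ d e P Q)) : f = g := by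
  have hr : ∀ a : Fin n → ℕ, IsLeftRegular (powProd (fun i => f (genX d e P Q i)) a) := fun a =>
    Finset.prod_induction _ _ (fun _ _ ha hb => ha.mul hb) isRegular_one.left
      (fun i _ => (hreg i).pow _)
  have hX' : (fun i => g (genX d e P Q i)) = fun i => f (genX d e P Q i) := by
    funext i; rw [hX]
  have hY : f (genY d e P Q) = g (genY d e P Q) := by
    apply hr d
    have h₁ := congrArg f (relation_genY d e P Q)
    have h₂ := congrArg g (relation_genY d e P Q)
    rw [map_mul, map_powProd, map_evalXZ] at h₁ h₂
    rw [hX', ← hZ] at h₂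
    simp only [h₁, h₂]
  refine algHom_ext' hX hY hZ ?_
  apply hr e
  have h₁ := congrArg f (relation_genT d e P Q)
  have h₂ := congrArg g (relation_genT d e P Q)
  rw [map_mul, map_powProd, map_evalXYZ] at h₁ h₂
  rw [hX', ← hZ, ← hY] at h₂
  simp only [h₁, h₂]

variable (d e P Q) in
/-- An induction principle: `L d e P Q` is generated by its standard generators. -/
lemma adjoin_generators : Algebra.adjoin k
    (Set.range (genX d e P Q) ∪ {genY d e P Q, genZ d e P Q, genT d e P Q}) = ⊤ := by
  rw [eq_top_iff]
  rintro a -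
  obtain ⟨p, rfl⟩ := Ideal.Quotient.mk_surjective a
  induction p using MvPolynomial.induction_on with
  | C c => exact Subalgebra.algebraMap_mem _ c
  | add p q hp hq => rw [map_add]; exact add_mem hp hq
  | mul_X p s hp =>
    rw [map_mul]
    refine mul_mem hp (Algebra.subset_adjoin ?_)
    rcases s with i | s
    · exact Or.inl ⟨i, rfl⟩
    · refine Or.inr ?_
      fin_cases s
      · exact Or.inl rfl
      · exact Or.inr (Or.inl rfl)
      · exact Or.inr (Or.inr rfl)

end Presentation

end

/-! ### Exponential maps and their leading forms -/

section

section Binomial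

/-- If `p` is the exponential characteristic of `k` and `M > 0`, then some power `p ^ l` dividing
`M` has a binomial coefficient `M.choose (p ^ l)` that does not vanish in `k`. -/
lemma exists_pow_dvd_choose_ne_zero (k : Type u) [Field k] (p : ℕ) [hp : ExpChar k p] {M : ℕ}
    (hM : 0 < M) : ∃ l, p ^ l ∣ M ∧ ((M.choose (p ^ l) : ℕ) : k) ≠ 0 := by
  obtain ⟨l, u, hu, rfl⟩ : ∃ l u : ℕ, (u : k) ≠ 0 ∧ M = p ^ l * u := by
    cases hp with
    | zero => exact ⟨0, M, by exact_mod_cast hM.ne', by simp⟩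
    | prime hq =>
      obtain ⟨l, u, hu, h⟩ := Nat.exists_eq_pow_mul_and_not_dvd hM.ne' p hq.ne_one
      exact ⟨l, u, fun h0 => hu ((CharP.cast_eq_zero_iff k p u).1 h0), h⟩
  refine ⟨l, Dvd.intro u rfl, ?_⟩
  -- By Frobenius, (X + 1)^(p^l u) = (X^(p^l) + 1)^u, whose coefficient at p^l is u.
  have h : (X + 1 : k[X]) ^ (p ^ l * u) = expand k (p ^ l) ((X + 1) ^ u) := by
    rw [pow_mul, add_pow_expChar_pow]; simp
  have hp' : 0 < p ^ l := pow_pos (expChar_pos k p) l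
  rw [← coeff_X_add_one_pow, h]
  have h2 := coeff_expand_mul hp' ((X + 1 : k[X]) ^ u) 1
  rw [one_mul] at h2
  rw [h2, coeff_X_add_one_pow, Nat.choose_one_right]
  exact hu

end Binomial

section Below

variable {k : Type u} [CommRing k] {Γ : Type v} [AddCommGroup Γ] [LinearOrder Γ]

/-- Elements of a group algebra all of whose exponents are at most `γ`. -/
def below (k : Type u) [CommRing k] (γ : Γ) : Submodule k (AddMonoidAlgebra k Γ) where
  carrier := {f | ∀ γ', γ < γ' → f.coeff γ' = 0}
  add_mem' {f g} hf hg γ' h := by simp [hf γ' h, hg γ' h]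
  zero_mem' γ' _ := by simp
  smul_mem' c f hf γ' h := by simp [hf γ' h]

lemma le_of_mem_below {γ γ' : Γ} {f : AddMonoidAlgebra k Γ} (hf : f ∈ below k γ)
    (h : f.coeff γ' ≠ 0) : γ' ≤ γ := not_lt.1 fun h' => h (hf γ' h')

lemma below_mono {γ γ' : Γ} (h : γ ≤ γ') : below k γ ≤ below k γ' :=
  fun _ hf _ h' => hf _ (h.trans_lt h')

variable [IsOrderedAddMonoid Γ]

lemma mul_mem_below {γ γ' : Γ} {f g : AddMonoidAlgebra k Γ} (hf : f ∈ below k γ)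
    (hg : g ∈ below k γ') : f * g ∈ below k (γ + γ') := by
  classical
  intro δ hδ
  rw [AddMonoidAlgebra.coeff_mul]
  refine Finset.sum_eq_zero fun a ha => Finset.sum_eq_zero fun b hb => if_neg ?_
  rw [Finsupp.mem_support_iff] at ha hb
  exact ((add_le_add (le_of_mem_below hf ha) (le_of_mem_below hg hb)).trans_lt hδ).ne

/-- In an ordered group the sum γ + γ' of two upper bounds is attained only by γ and γ' themselves,
so top coefficients multiply. -/
lemma coeff_mul_of_mem_below {γ γ' : Γ} {f g : AddMonoidAlgebra k Γ} (hf : f ∈ below k γ)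
    (hg : g ∈ below k γ') : (f * g).coeff (γ + γ') = f.coeff γ * g.coeff γ' := by
  apply AddMonoidAlgebra.coeff_mul_add_of_uniqueAdd
  intro a b ha hb hab
  rw [Finsupp.mem_support_iff] at ha hb
  have h1 := le_of_mem_below hf ha
  have h2 := le_of_mem_below hg hb
  constructor
  · refine h1.antisymm (le_of_not_gt fun h => ?_)
    exact (add_lt_add_of_lt_of_le h h2).ne hab
  · refine h2.antisymm (le_of_not_gt fun h => ?_)
    exact (add_lt_add_of_le_of_lt h1 h).ne hab

lemma single_mem_below (γ : Γ) (r : k) : AddMonoidAlgebra.single γ r ∈ below k γ := by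
  intro γ' h
  rw [AddMonoidAlgebra.coeff_single, Finsupp.single_eq_of_ne h.ne']

end Below

/-- An exponential map on the `k`-algebra `A`, that is, a coaction of the additive group. -/
structure ExpMap (k : Type u) (A : Type v) [CommRing k] [CommRing A] [Algebra k A] where
  /-- The underlying homomorphism. -/
  hom : A →ₐ[k] A[X]
  coeff_zero : ∀ a, (hom a).coeff 0 = a
  -- Coassociativity, read off on coefficients: the coefficient maps compose like Hasse derivatives.
  coeff_coeff : ∀ a i j,
    (hom ((hom a).coeff j)).coeff i = ((i + j).choose j : A) * (hom a).coeff (i + j)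

/-- An embedding of a `k`-algebra `A` in a group algebra `k[Γ]`, `Γ` totally ordered, together with
generators of `A` whose leading monomials generate the algebra of leading forms of `A`. -/
structure LeadingFrame (k : Type u) (A : Type v) (Γ : Type w) (σ : Type*) [Field k] [CommRing A]
    [Algebra k A] [AddCommGroup Γ] [LinearOrder Γ] where
  /-- The embedding. -/
  emb : A →ₐ[k] AddMonoidAlgebra k Γ
  /-- The generators. -/
  gen : σ → A
  /-- The leading exponents of the generators. -/
  exp : σ → Γ
  emb_gen_mem : ∀ s, emb (gen s) ∈ below k (exp s)
  coeff_emb_gen : ∀ s, (emb (gen s)).coeff (exp s) = 1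
  -- Distinct weights on the support exclude cancellation of leading terms, so the leading exponent
  -- of an element is that of one monomial in the generators.
  exists_rep : ∀ a, ∃ p : MvPolynomial σ k, MvPolynomial.aeval gen p = a ∧
    Set.InjOn (Finsupp.weight exp : (σ →₀ ℕ) → Γ) p.support

namespace LeadingFrame

variable {k : Type u} {A : Type v} {Γ : Type w} {σ : Type*} [Field k] [CommRing A]
    [Algebra k A] [AddCommGroup Γ] [LinearOrder Γ] [IsOrderedAddMonoid Γ]
    (F : LeadingFrame k A Γ σ)

/-- The monomial with exponent `m` in the generators. -/
def mon (m : σ →₀ ℕ) : A := MvPolynomial.aeval F.gen (MvPolynomial.monomial m (1 : k))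

/-- The leading exponent of `F.mon m`. -/
def wt : (σ →₀ ℕ) →+ Γ := Finsupp.weight F.exp

lemma mon_eq (m : σ →₀ ℕ) : F.mon m = m.prod fun s i => F.gen s ^ i := by
  simp [mon, MvPolynomial.aeval_monomial]

lemma wt_eq (m : σ →₀ ℕ) : F.wt m = m.sum fun s i => i • F.exp s := rfl

lemma mon_zero : F.mon 0 = 1 := by simp [mon_eq]

lemma mon_add (m m' : σ →₀ ℕ) : F.mon (m + m') = F.mon m * F.mon m' := by
  rw [mon, mon, mon, ← map_mul, MvPolynomial.monomial_mul, one_mul]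

lemma mon_single (s : σ) : F.mon (Finsupp.single s 1) = F.gen s := by simp [mon_eq]

lemma wt_single (s : σ) : F.wt (Finsupp.single s 1) = F.exp s := by simp [wt_eq]

lemma aeval_gen (p : MvPolynomial σ k) :
    MvPolynomial.aeval F.gen p = ∑ m ∈ p.support, p.coeff m • F.mon m := by
  conv_lhs => rw [p.as_sum]
  rw [map_sum]
  refine Finset.sum_congr rfl fun m _ => ?_
  rw [mon, ← map_smul, MvPolynomial.smul_monomial, smul_eq_mul, mul_one]

lemma mon_induction {p : (σ →₀ ℕ) → Prop} (h0 : p 0)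
    (h1 : ∀ s m, p m → p (Finsupp.single s 1 + m)) (m : σ →₀ ℕ) : p m := by
  induction m using Finsupp.induction with
  | zero => exact h0
  | single_add s n m _ _ ih =>
    induction n with
    | zero => simpa using ih
    | succ n hn =>
      by_cases hn0 : n = 0
      · subst hn0; simpa using h1 s _ ih
      · rw [add_comm n 1, Finsupp.single_add, add_assoc]
        exact h1 s _ (hn hn0)

lemma emb_mon_mem_and (m : σ →₀ ℕ) :
    F.emb (F.mon m) ∈ below k (F.wt m) ∧ (F.emb (F.mon m)).coeff (F.wt m) = 1 := by
  induction m using mon_induction with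
  | h0 =>
    rw [mon_zero, map_zero, map_one, AddMonoidAlgebra.one_def]
    exact ⟨single_mem_below _ _, by simp⟩
  | h1 s m ih =>
    rw [mon_add, map_add, map_mul, mon_single, wt_single]
    exact ⟨mul_mem_below (F.emb_gen_mem s) ih.1, by
      rw [coeff_mul_of_mem_below (F.emb_gen_mem s) ih.1, F.coeff_emb_gen, ih.2, one_mul]⟩

/-- `m` is the leading monomial of the element represented by `p`. -/
structure IsLead (a : A) (p : MvPolynomial σ k) (m : σ →₀ ℕ) : Prop where
  rep : MvPolynomial.aeval F.gen p = a
  coeff_ne_zero : p.coeff m ≠ 0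
  lt : ∀ m' ∈ p.support, m' ≠ m → F.wt m' < F.wt m

variable {F}

lemma exists_isLead {a : A} (ha : a ≠ 0) : ∃ p m, F.IsLead a p m := by
  obtain ⟨p, hp, hinj⟩ := F.exists_rep a
  have hne : p.support.Nonempty := by
    rw [Finset.nonempty_iff_ne_empty, Ne, MvPolynomial.support_eq_empty]
    rintro rfl
    exact ha (by rw [← hp, map_zero])
  obtain ⟨m, hm, hmax⟩ := p.support.exists_max_image F.wt hne
  refine ⟨p, m, hp, MvPolynomial.mem_support_iff.1 hm, fun m' hm' hne => ?_⟩
  exact (hmax m' hm').lt_of_ne fun h => hne (hinj hm' hm h)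

lemma IsLead.le {a : A} {p : MvPolynomial σ k} {m : σ →₀ ℕ} (h : F.IsLead a p m) {m' : σ →₀ ℕ}
    (hm' : m' ∈ p.support) : F.wt m' ≤ F.wt m := by
  by_cases hmm : m' = m
  · rw [hmm]
  · exact (h.lt m' hm' hmm).le

lemma IsLead.emb_mem {a : A} {p : MvPolynomial σ k} {m : σ →₀ ℕ} (h : F.IsLead a p m) :
    F.emb a ∈ below k (F.wt m) := by
  rw [← h.rep, F.aeval_gen, map_sum]
  refine Submodule.sum_mem _ fun m' hm' => ?_
  rw [map_smul]
  exact Submodule.smul_mem _ _ (below_mono (h.le hm') (F.emb_mon_mem_and m').1)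

lemma IsLead.coeff_emb {a : A} {p : MvPolynomial σ k} {m : σ →₀ ℕ} (h : F.IsLead a p m) :
    (F.emb a).coeff (F.wt m) = p.coeff m := by
  classical
  rw [← h.rep, F.aeval_gen, map_sum, AddMonoidAlgebra.coeff_sum, Finsupp.finsetSum_apply,
    Finset.sum_eq_single m]
  · rw [map_smul, AddMonoidAlgebra.coeff_smul_apply, (F.emb_mon_mem_and m).2, smul_eq_mul, mul_one]
  · intro m' hm' hne
    rw [map_smul, AddMonoidAlgebra.coeff_smul_apply, (F.emb_mon_mem_and m').1 _ (h.lt m' hm' hne),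
      smul_zero]
  · intro hm
    exact (h.coeff_ne_zero (by simpa using hm)).elim

variable (F) in
lemma emb_injective : Function.Injective F.emb := by
  rw [injective_iff_map_eq_zero]
  intro a ha
  by_contra hne
  obtain ⟨p, m, h⟩ := exists_isLead (F := F) hne
  apply h.coeff_ne_zero
  rw [← h.coeff_emb, ha]
  simp

/-- The bound that the slope `lam` imposes on the coefficients of an exponential map. -/
def Bounded (F : LeadingFrame k A Γ σ) (lam : Γ) (γ : Γ) (q : A[X]) : Prop :=
  ∀ i, F.emb (q.coeff i) ∈ below k (γ + i • lam)

variable {lam : Γ}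

lemma Bounded.mul {γ γ' : Γ} {q q' : A[X]} (h : F.Bounded lam γ q) (h' : F.Bounded lam γ' q') :
    F.Bounded lam (γ + γ') (q * q') := by
  intro i
  rw [coeff_mul, map_sum]
  refine Submodule.sum_mem _ fun x hx => ?_
  rw [map_mul, ← Finset.HasAntidiagonal.mem_antidiagonal.1 hx, add_smul, add_add_add_comm]
  exact mul_mem_below (h _) (h' _)

variable (F) in
/-- The leading form of `q` with respect to the slope `lam`, at the exponent `γ`. -/
def leadForm (lam γ : Γ) (q : A[X]) : k[X] :=
  ∑ i ∈ Finset.range (q.natDegree + 1), monomial i ((F.emb (q.coeff i)).coeff (γ + i • lam))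

lemma coeff_leadForm (lam γ : Γ) (q : A[X]) (i : ℕ) :
    (F.leadForm lam γ q).coeff i = (F.emb (q.coeff i)).coeff (γ + i • lam) := by
  rw [leadForm, finsetSum_coeff]
  simp only [coeff_monomial]
  rw [Finset.sum_ite_eq']
  split_ifs with h
  · rfl
  · rw [coeff_eq_zero_of_natDegree_lt (by simpa using h)]; simp

/-- Give the polynomial variable the weight -lam. Then `Bounded` says that all weights are at most
γ, and `leadForm` is the part of weight γ; the power of the variable determines the exponent in Γ,
so only a coefficient in k is recorded. Top parts multiply. -/
lemma leadForm_mul {γ γ' : Γ} {q q' : A[X]} (h : F.Bounded lam γ q) (h' : F.Bounded lam γ' q') :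
    F.leadForm lam (γ + γ') (q * q') = F.leadForm lam γ q * F.leadForm lam γ' q' := by
  ext i
  rw [coeff_leadForm, coeff_mul, coeff_mul, map_sum, AddMonoidAlgebra.coeff_sum,
    Finsupp.finsetSum_apply]
  refine Finset.sum_congr rfl fun x hx => ?_
  rw [map_mul, ← Finset.HasAntidiagonal.mem_antidiagonal.1 hx, add_smul, add_add_add_comm,
    coeff_mul_of_mem_below (h _) (h' _), coeff_leadForm, coeff_leadForm]

lemma leadForm_sub (γ : Γ) (q q' : A[X]) :
    F.leadForm lam γ (q - q') = F.leadForm lam γ q - F.leadForm lam γ q' := by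
  ext i; simp [coeff_leadForm]

lemma leadForm_C (γ : Γ) (a : A) : F.leadForm lam γ (C a) = C ((F.emb a).coeff γ) := by
  ext i
  rw [coeff_leadForm, coeff_C, coeff_C]
  split_ifs with h
  · simp [h]
  · simp

/-- `lam` is the slope of the exponential map `δ`. -/
structure IsSlope (F : LeadingFrame k A Γ σ) (δ : ExpMap k A) (lam : Γ) : Prop where
  bounded : ∀ s, F.Bounded lam (F.exp s) (δ.hom (F.gen s))
  sharp : ∃ s, F.leadForm lam (F.exp s) (δ.hom (F.gen s)) ≠ 1

/-- The slope is the largest quotient (γ - exp s) / i over all exponents γ that occur in the i-th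
coefficient of the image of a generator s, for i > 0. Division requires a ℚ-vector space, and the
maximum exists because there are finitely many generators. -/
lemma exists_isSlope [Finite σ] [Module ℚ Γ] (δ : ExpMap k A)
    (hδ : ∃ a, δ.hom a ≠ C a) :
    ∃ lam, F.IsSlope δ lam := by
  classical
  cases nonempty_fintype σ
  -- A map that fixes all generators is trivial, so some generator moves and the maximum below is
  -- over a nonempty set.
  obtain ⟨s₀, i₀, hi₀, h₀⟩ : ∃ s i, 0 < i ∧ (δ.hom (F.gen s)).coeff i ≠ 0 := by
    by_contra! hcon
    obtain ⟨a, ha⟩ := hδ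
    apply ha
    obtain ⟨p, rfl, -⟩ := F.exists_rep a
    have : δ.hom.comp (MvPolynomial.aeval F.gen) =
        (CAlgHom (R := k) (A := A)).comp (MvPolynomial.aeval F.gen) := by
      refine MvPolynomial.algHom_ext fun s => ?_
      simp only [AlgHom.comp_apply, MvPolynomial.aeval_X]
      ext i
      rcases Nat.eq_zero_or_pos i with rfl | hi
      · simp [δ.coeff_zero, coeff_C]
      · simp [hcon s i hi, coeff_C, hi.ne']
    exact DFunLike.congr_fun this p
  set N : ℕ := ∑ s, (δ.hom (F.gen s)).natDegree with hN
  set I : Finset (σ × ℕ × Γ) := Finset.univ.biUnion fun s => (Finset.Icc 1 N).biUnion fun i =>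
    (F.emb ((δ.hom (F.gen s)).coeff i)).coeff.support.image fun γ => (s, i, γ) with hI
  have hmem : ∀ s i γ, (s, i, γ) ∈ I ↔
      0 < i ∧ (F.emb ((δ.hom (F.gen s)).coeff i)).coeff γ ≠ 0 := by
    intro s i γ
    simp only [hI, Finset.mem_biUnion, Finset.mem_univ, true_and, Finset.mem_image, Prod.mk.injEq,
      Finset.mem_Icc, Finsupp.mem_support_iff]
    constructor
    · rintro ⟨s, i, hi, γ, h, rfl, rfl, rfl⟩
      exact ⟨hi.1, h⟩
    · rintro ⟨hi, h⟩
      refine ⟨s, i, ⟨hi, ?_⟩, γ, h, rfl, rfl, rfl⟩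
      have : (δ.hom (F.gen s)).coeff i ≠ 0 := by
        intro h'; apply h; rw [h']; simp
      exact (le_natDegree_of_ne_zero this).trans
        (Finset.single_le_sum (f := fun s => (δ.hom (F.gen s)).natDegree)
          (fun _ _ => Nat.zero_le _) (Finset.mem_univ s))
  have hne : I.Nonempty := by
    have : (F.emb ((δ.hom (F.gen s₀)).coeff i₀)).coeff ≠ 0 := by
      rw [Ne, AddMonoidAlgebra.coeff_eq_zero, map_eq_zero_iff _ F.emb_injective]
      exact h₀
    obtain ⟨γ, hγ⟩ := Finsupp.ne_iff.1 this
    exact ⟨(s₀, i₀, γ), (hmem _ _ _).2 ⟨hi₀, hγ⟩⟩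
  obtain ⟨⟨s₁, i₁, γ₁⟩, h₁, hmax⟩ := I.exists_max_image
    (fun x => ((x.2.1 : ℚ)⁻¹) • (x.2.2 - F.exp x.1)) hne
  have key : ∀ i : ℕ, 0 < i → ∀ v : Γ, i • ((i : ℚ)⁻¹ • v) = v := by
    intro i hi v
    rw [← Nat.cast_smul_eq_nsmul ℚ i, smul_smul, mul_inv_cancel₀ (by positivity), one_smul]
  refine ⟨(i₁ : ℚ)⁻¹ • (γ₁ - F.exp s₁), fun s i γ hγ => ?_, s₁, fun hone => ?_⟩
  · by_contra hne
    rcases Nat.eq_zero_or_pos i with rfl | hi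
    · rw [δ.coeff_zero, zero_smul, add_zero] at *
      exact hne (F.emb_gen_mem s γ hγ)
    · have h2 := hmax (s, i, γ) ((hmem _ _ _).2 ⟨hi, hne⟩)
      have h3 := nsmul_le_nsmul_right h2 i
      rw [key i hi] at h3
      rw [sub_le_iff_le_add'] at h3
      exact absurd hγ h3.not_gt
  -- At the maximizing triple the bound is attained, which gives a nonzero coefficient of positive
  -- degree i₁.
  · obtain ⟨hi₁, h₂⟩ := (hmem _ _ _).1 h₁
    have h4 := congrArg (fun q => q.coeff i₁) hone
    simp only [coeff_leadForm, coeff_one, hi₁.ne', if_false] at h4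
    rw [key _ hi₁, add_sub_cancel] at h4
    exact h₂ h4

variable {δ : ExpMap k A}

namespace IsSlope

variable (hδ : F.IsSlope δ lam)
include hδ

lemma bounded_mon (m : σ →₀ ℕ) : F.Bounded lam (F.wt m) (δ.hom (F.mon m)) := by
  induction m using mon_induction with
  | h0 =>
    rw [mon_zero, map_zero, map_one]
    intro i
    rw [coeff_one]
    split_ifs with h
    · subst h
      rw [map_one, zero_smul, add_zero, AddMonoidAlgebra.one_def]
      exact single_mem_below _ _
    · rw [map_zero]; exact zero_mem _
  | h1 s m ih =>
    rw [mon_add, map_add, map_mul, mon_single, wt_single]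
    exact (hδ.bounded s).mul ih

lemma bounded_of_isLead {a : A} {p : MvPolynomial σ k} {m : σ →₀ ℕ} (h : F.IsLead a p m) :
    F.Bounded lam (F.wt m) (δ.hom a) := by
  intro i
  rw [← h.rep, F.aeval_gen, map_sum, finsetSum_coeff, map_sum]
  refine Submodule.sum_mem _ fun m' hm' => ?_
  rw [map_smul, coeff_smul, map_smul]
  exact Submodule.smul_mem _ _ (below_mono (by gcongr; exact h.le hm') (hδ.bounded_mon m' i))

lemma leadForm_eq_zero {a : A} {γ : Γ} (h : F.emb a ∈ below k γ) (h0 : (F.emb a).coeff γ = 0) :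
    F.leadForm lam γ (δ.hom a) = 0 := by
  by_cases ha : a = 0
  · ext i; simp [ha, coeff_leadForm]
  obtain ⟨p, m, hl⟩ := exists_isLead (F := F) ha
  have hne : (F.emb a).coeff (F.wt m) ≠ 0 := hl.coeff_emb ▸ hl.coeff_ne_zero
  have hlt : F.wt m < γ := (le_of_mem_below h hne).lt_of_ne (by rintro rfl; exact hne h0)
  ext i
  rw [coeff_leadForm, coeff_zero]
  exact hδ.bounded_of_isLead hl i _ (by gcongr)

/-- The leading form at γ sees only the coefficient at γ: an element with smaller leading exponent
has an image strictly below the bound. This is why the exponential map induces a map on leading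
forms. -/
lemma leadForm_congr {a b : A} {γ : Γ} (ha : F.emb a ∈ below k γ) (hb : F.emb b ∈ below k γ)
    (h : (F.emb a).coeff γ = (F.emb b).coeff γ) :
    F.leadForm lam γ (δ.hom a) = F.leadForm lam γ (δ.hom b) := by
  rw [← sub_eq_zero, ← leadForm_sub, ← map_sub]
  apply hδ.leadForm_eq_zero
  · rw [map_sub]; exact sub_mem ha hb
  · rw [map_sub, AddMonoidAlgebra.coeff_sub, Finsupp.sub_apply, h, sub_self]

end IsSlope

variable (F δ lam) in
/-- The leading form of the image of a generator under an exponential map. -/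
def genForm (s : σ) : k[X] := F.leadForm lam (F.exp s) (δ.hom (F.gen s))

variable (F δ lam) in
/-- The leading form of the image of a monomial under an exponential map. -/
def monForm (m : σ →₀ ℕ) : k[X] := F.leadForm lam (F.wt m) (δ.hom (F.mon m))

lemma monForm_single (s : σ) : F.monForm lam δ (Finsupp.single s 1) = F.genForm lam δ s := by
  rw [monForm, genForm, wt_single, mon_single]

lemma coeff_zero_monForm (m : σ →₀ ℕ) : (F.monForm lam δ m).coeff 0 = 1 := by
  rw [monForm, coeff_leadForm, δ.coeff_zero, zero_smul, add_zero, (F.emb_mon_mem_and m).2]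

lemma monForm_ne_zero (m : σ →₀ ℕ) : F.monForm lam δ m ≠ 0 := by
  intro h
  have := coeff_zero_monForm (F := F) (lam := lam) (δ := δ) m
  rw [h] at this
  simp at this

lemma monForm_eq_one_iff (m : σ →₀ ℕ) :
    F.monForm lam δ m = 1 ↔ (F.monForm lam δ m).natDegree = 0 := by
  refine ⟨fun h => by simp [h], fun h => ?_⟩
  rw [eq_C_of_natDegree_eq_zero h, coeff_zero_monForm, map_one]

namespace IsSlope

variable (hδ : F.IsSlope δ lam)
include hδ

lemma monForm_add (m m' : σ →₀ ℕ) :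
    F.monForm lam δ (m + m') = F.monForm lam δ m * F.monForm lam δ m' := by
  rw [monForm, map_add, mon_add, map_mul, leadForm_mul (hδ.bounded_mon m) (hδ.bounded_mon m')]
  rfl

lemma natDegree_monForm_add (m m' : σ →₀ ℕ) :
    (F.monForm lam δ (m + m')).natDegree =
      (F.monForm lam δ m).natDegree + (F.monForm lam δ m').natDegree := by
  rw [hδ.monForm_add, natDegree_mul (monForm_ne_zero m) (monForm_ne_zero m')]

/-- Degrees in k[X] add up over products, so every factor of a constant leading form is constant,
and its constant term is 1. -/
lemma genForm_eq_one {m : σ →₀ ℕ} (h : (F.monForm lam δ m).natDegree = 0) {s : σ}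
    (hs : s ∈ m.support) : F.genForm lam δ s = 1 := by
  have hm : m = Finsupp.single s 1 + (m - Finsupp.single s 1) := by
    rw [add_tsub_cancel_of_le]
    rw [Finsupp.single_le_iff]
    exact Nat.one_le_iff_ne_zero.2 (Finsupp.mem_support_iff.1 hs)
  rw [hm, hδ.natDegree_monForm_add] at h
  rw [← monForm_single, monForm_eq_one_iff]
  omega

lemma leadForm_of_isLead {a : A} {p : MvPolynomial σ k} {m : σ →₀ ℕ} (h : F.IsLead a p m) :
    F.leadForm lam (F.wt m) (δ.hom a) = C (p.coeff m) * F.monForm lam δ m := by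
  have : C (p.coeff m) * F.monForm lam δ m =
      F.leadForm lam (F.wt m) (δ.hom (p.coeff m • F.mon m)) := by
    ext i; simp [monForm, coeff_leadForm]
  rw [this]
  refine hδ.leadForm_congr h.emb_mem ?_ ?_
  · rw [map_smul]; exact Submodule.smul_mem _ _ (F.emb_mon_mem_and m).1
  · rw [map_smul, h.coeff_emb, AddMonoidAlgebra.coeff_smul_apply, (F.emb_mon_mem_and m).2,
      smul_eq_mul, mul_one]

/-- The generators occurring in the leading monomial of an invariant have trivial leading form. -/
lemma genForm_eq_one_of_invariant {a : A} {p : MvPolynomial σ k} {m : σ →₀ ℕ}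
    (h : F.IsLead a p m) (ha : δ.hom a = C a) {s : σ} (hs : s ∈ m.support) :
    F.genForm lam δ s = 1 := by
  refine hδ.genForm_eq_one (m := m) ?_ hs
  have h1 := hδ.leadForm_of_isLead h
  rw [ha, leadForm_C] at h1
  have h2 := congrArg natDegree h1
  rwa [natDegree_C, natDegree_C_mul h.coeff_ne_zero, eq_comm] at h2

/-- The binomial coefficients of coassociativity are those of the Hasse derivative. Thus Hasse
derivatives of leading forms are again leading forms of elements of A. -/
lemma leadForm_coeff (a : A) (γ : Γ) (j : ℕ) :
    F.leadForm lam (γ + j • lam) (δ.hom ((δ.hom a).coeff j)) =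
      hasseDeriv j (F.leadForm lam γ (δ.hom a)) := by
  ext i
  rw [coeff_leadForm, δ.coeff_coeff, hasseDeriv_coeff, coeff_leadForm, ← nsmul_eq_mul, map_nsmul,
    AddMonoidAlgebra.coeff_smul_apply, nsmul_eq_mul, add_smul, add_assoc,
    add_comm (i • lam) (j • lam)]

/-- The coefficients of a leading form lead to further monomials. -/
lemma exists_monForm_hasseDeriv (m : σ →₀ ℕ) {j : ℕ} (hj : (F.monForm lam δ m).coeff j ≠ 0) :
    ∃ m' c, c ≠ 0 ∧ F.wt m' = F.wt m + j • lam ∧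
      hasseDeriv j (F.monForm lam δ m) = C c * F.monForm lam δ m' := by
  set a := (δ.hom (F.mon m)).coeff j with ha
  have hmem : F.emb a ∈ below k (F.wt m + j • lam) := hδ.bounded_mon m j
  have hc : (F.emb a).coeff (F.wt m + j • lam) ≠ 0 := by
    rwa [monForm, coeff_leadForm] at hj
  have hne : a ≠ 0 := by intro h; apply hc; rw [h]; simp
  obtain ⟨p, m', hl⟩ := exists_isLead (F := F) hne
  have hwt : F.wt m' = F.wt m + j • lam :=
    (le_of_mem_below hmem (hl.coeff_emb ▸ hl.coeff_ne_zero)).antisymm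
      (le_of_mem_below hl.emb_mem hc)
  refine ⟨m', p.coeff m', hl.coeff_ne_zero, hwt, ?_⟩
  rw [← hδ.leadForm_of_isLead hl, hwt, monForm, ← hδ.leadForm_coeff]

lemma hasseDeriv_monForm_eq_zero (m : σ →₀ ℕ) {j : ℕ} (hj : (F.monForm lam δ m).coeff j = 0) :
    hasseDeriv j (F.monForm lam δ m) = 0 := by
  rw [monForm, ← hδ.leadForm_coeff]
  refine hδ.leadForm_eq_zero (hδ.bounded_mon m j) ?_
  rwa [monForm, coeff_leadForm] at hj

/-- Moving a monomial along the slope by its degree leads to an invariant monomial. -/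
lemma exists_invariant_monomial (m : σ →₀ ℕ) :
    ∃ m', F.wt m' = F.wt m + (F.monForm lam δ m).natDegree • lam ∧
      ∀ s ∈ m'.support, F.genForm lam δ s = 1 := by
  obtain ⟨m', c, hc, hwt, h⟩ := hδ.exists_monForm_hasseDeriv m
    (j := (F.monForm lam δ m).natDegree)
    (by rw [coeff_natDegree, leadingCoeff_ne_zero]; exact monForm_ne_zero m)
  refine ⟨m', hwt, fun s hs => hδ.genForm_eq_one (m := m') ?_ hs⟩
  have h2 := congrArg natDegree h
  rw [natDegree_C_mul hc] at h2
  have h3 := natDegree_hasseDeriv_le (F.monForm lam δ m) (F.monForm lam δ m).natDegree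
  omega

/-- Take the Hasse derivative of order M - p^l of a form of degree M. Its coefficient at p^l is the
leading coefficient times `M.choose (p ^ l)`, which does not vanish for a suitable l, so its degree
is exactly p^l. -/
lemma exists_monForm_natDegree_pow (p : ℕ) [ExpChar k p] (m : σ →₀ ℕ)
    (hm : 0 < (F.monForm lam δ m).natDegree) :
    ∃ m' l, p ^ l ∣ (F.monForm lam δ m).natDegree ∧ (F.monForm lam δ m').natDegree = p ^ l := by
  set M := (F.monForm lam δ m).natDegree with hM
  obtain ⟨l, hl, hch⟩ := exists_pow_dvd_choose_ne_zero k p hm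
  have hle : p ^ l ≤ M := Nat.le_of_dvd hm hl
  have hco : (hasseDeriv (M - p ^ l) (F.monForm lam δ m)).coeff (p ^ l) ≠ 0 := by
    rw [hasseDeriv_coeff, Nat.add_sub_cancel' hle, Nat.choose_symm hle]
    refine mul_ne_zero hch ?_
    rw [hM, coeff_natDegree, leadingCoeff_ne_zero]
    exact monForm_ne_zero m
  have hj : (F.monForm lam δ m).coeff (M - p ^ l) ≠ 0 := by
    intro h
    rw [hδ.hasseDeriv_monForm_eq_zero m h] at hco
    simp at hco
  obtain ⟨m', c, hc, -, h⟩ := hδ.exists_monForm_hasseDeriv m hj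
  refine ⟨m', l, hl, ?_⟩
  have h2 := congrArg natDegree h
  rw [natDegree_C_mul hc] at h2
  have h3 := natDegree_hasseDeriv_le (F.monForm lam δ m) (M - p ^ l)
  have h4 := le_natDegree_of_ne_zero hco
  omega

/-- The smallest positive degree of a leading form is attained at a generator and divides the
degrees of all leading forms. -/
lemma exists_minimal_degree : ∃ s₀, 0 < (F.genForm lam δ s₀).natDegree ∧
    ∀ s, (F.genForm lam δ s₀).natDegree ∣ (F.genForm lam δ s).natDegree := by
  classical
  obtain ⟨p, hp⟩ := ExpChar.exists k
  obtain ⟨s₁, hs₁⟩ := hδ.sharp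
  have hex : ∃ N, 0 < N ∧ ∃ m, (F.monForm lam δ m).natDegree = N := by
    refine ⟨_, Nat.pos_of_ne_zero fun h => hs₁ ?_, Finsupp.single s₁ 1, rfl⟩
    rw [← monForm_eq_one_iff, monForm_single] at h
    exact h
  obtain ⟨N, ⟨hN, m₀, hm₀⟩, hmin⟩ : ∃ N, (0 < N ∧ ∃ m, (F.monForm lam δ m).natDegree = N) ∧
      ∀ m, 0 < (F.monForm lam δ m).natDegree → N ≤ (F.monForm lam δ m).natDegree :=
    ⟨Nat.find hex, Nat.find_spec hex, fun m hm => Nat.find_min' hex ⟨hm, m, rfl⟩⟩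
  -- From a monomial of minimal degree N one reaches degree p^l with p^l ∣ N; minimality forces
  -- equality.
  have hpow : ∃ l, N = p ^ l := by
    obtain ⟨m', l, hl, h⟩ := hδ.exists_monForm_natDegree_pow p m₀ (hm₀ ▸ hN)
    rw [hm₀] at hl
    refine ⟨l, le_antisymm ?_ (Nat.le_of_dvd hN hl)⟩
    rw [← h]
    exact hmin m' (by rw [h]; exact pow_pos (expChar_pos k p) l)
  obtain ⟨l₀, hl₀⟩ := hpow
  have hdvd : ∀ m, N ∣ (F.monForm lam δ m).natDegree := by
    intro m
    rcases Nat.eq_zero_or_pos (F.monForm lam δ m).natDegree with h0 | h0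
    · rw [h0]; exact dvd_zero _
    obtain ⟨m', l, hl, h⟩ := hδ.exists_monForm_natDegree_pow p m h0
    refine dvd_trans ?_ hl
    -- Both N and p^l are powers of p, so the inequality is a divisibility; in exponential
    -- characteristic 1 both equal 1.
    have h1 : N ≤ p ^ l := h ▸ hmin m' (by rw [h]; exact pow_pos (expChar_pos k p) l)
    rw [hl₀] at h1 ⊢
    rcases (Nat.one_le_iff_ne_zero.2 (expChar_pos k p).ne').eq_or_lt with h2 | h2
    · simp [← h2]
    · exact pow_dvd_pow _ ((Nat.pow_le_pow_iff_right h2).1 h1)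
  have hgen : ∃ s, (F.genForm lam δ s).natDegree = N := by
    have : ∀ m, 0 < (F.monForm lam δ m).natDegree → ∃ s, 0 < (F.genForm lam δ s).natDegree ∧
        (F.genForm lam δ s).natDegree ≤ (F.monForm lam δ m).natDegree := by
      intro m
      induction m using mon_induction with
      | h0 =>
        intro h
        have h1 := hδ.natDegree_monForm_add 0 0
        rw [add_zero] at h1
        omega
      | h1 s m ih =>
        intro h
        rw [hδ.natDegree_monForm_add, monForm_single] at h ⊢
        by_cases hs : 0 < (F.genForm lam δ s).natDegree
        · exact ⟨s, hs, by omega⟩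
        · obtain ⟨s', h1, h2⟩ := ih (by omega)
          exact ⟨s', h1, by omega⟩
    obtain ⟨s, h1, h2⟩ := this m₀ (hm₀ ▸ hN)
    rw [hm₀] at h2
    refine ⟨s, h2.antisymm ?_⟩
    rw [← monForm_single] at h1 ⊢
    exact hmin _ h1
  obtain ⟨s₀, h₀⟩ := hgen
  refine ⟨s₀, h₀ ▸ hN, fun s => ?_⟩
  rw [h₀, ← monForm_single]
  exact hdvd _

end IsSlope

end LeadingFrame

end

/-! ### The algebra of leading forms of L and the standard monomials -/

section

/-- The standing numerical hypotheses on the data `d, e, P, Q`. -/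
structure Admissible {k : Type u} [Field k] {n : ℕ} (d e : Fin n → ℕ)
    (P : (Base k n)[X]) (Q : (Base k n)[X][X]) : Prop where
  one_le_d : ∀ i, 1 ≤ d i
  one_le_e : ∀ i, 1 ≤ e i
  monic_P : P.Monic
  two_le_P : 2 ≤ P.natDegree
  monic_Q : Q.Monic
  two_le_Q : 2 ≤ Q.natDegree

/-- The totally ordered group of exponents. -/
abbrev Expo (n : ℕ) : Type := ℚ ×ₗ (ℚ ×ₗ Lex (Fin n → ℚ))

section Expo

variable {n : ℕ}

/-- The exponent of `X^a Z^b`, in the lexicographic order which compares first the negative of the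
degree in `X_{i₀}`, then the degree in `Z`, then the degrees in the `Xⱼ`. -/
def expo (i₀ : Fin n) : (Fin n → ℚ) × ℚ →+ Expo n where
  toFun v := toLex (-v.1 i₀, toLex (v.2, toLex v.1))
  map_zero' := by simp
  map_add' v w := by
    simp only [Prod.fst_add, Pi.add_apply, neg_add, Prod.snd_add]; rfl

/-- The last component repeats all X-degrees. It serves as a tie-break that makes the order total on
exponent vectors without losing information. -/
lemma expo_injective (i₀ : Fin n) : Function.Injective (expo i₀) := by
  rintro ⟨a, b⟩ ⟨a', b'⟩ h
  have h' : (-a i₀, toLex (b, toLex a)) = (-a' i₀, toLex (b', toLex a')) := toLex.injective h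
  have h2 : (b, toLex a) = (b', toLex a') := toLex.injective (Prod.ext_iff.1 h').2
  rw [Prod.ext_iff] at h2
  exact Prod.ext (toLex.injective h2.2) h2.1

lemma expo_lt_expo (i₀ : Fin n) {v w : (Fin n → ℚ) × ℚ} (h : w.1 i₀ ≤ v.1 i₀)
    (h' : w.1 i₀ = v.1 i₀ → v.2 < w.2) : expo i₀ v < expo i₀ w := by
  refine Prod.Lex.toLex_lt_toLex.2 ?_
  rcases h.lt_or_eq with h | h
  · exact Or.inl (neg_lt_neg h)
  · exact Or.inr ⟨by simp [h], Prod.Lex.toLex_lt_toLex.2 (Or.inl (h' h))⟩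

lemma le_of_expo_le (i₀ : Fin n) {v w : (Fin n → ℚ) × ℚ} (h : expo i₀ v ≤ expo i₀ w) :
    w.1 i₀ ≤ v.1 i₀ ∧ (w.1 i₀ = v.1 i₀ → v.2 ≤ w.2) := by
  constructor
  · by_contra! hc
    exact (expo_lt_expo i₀ hc.le (fun h => absurd h hc.ne)).not_ge h
  · intro he
    by_contra! hc
    exact (expo_lt_expo i₀ he.ge (fun _ => hc)).not_ge h

end Expo

section Below

variable {k : Type u} [CommRing k] {Γ : Type v} [LinearOrder Γ]

/-- Elements of a group algebra all of whose exponents are smaller than `γ`. -/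
def strictBelow (k : Type u) [CommRing k] (γ : Γ) : Submodule k (AddMonoidAlgebra k Γ) where
  carrier := {f | ∀ γ', γ ≤ γ' → f.coeff γ' = 0}
  add_mem' {f g} hf hg γ' h := by simp [hf γ' h, hg γ' h]
  zero_mem' γ' _ := by simp
  smul_mem' c f hf γ' h := by simp [hf γ' h]

lemma below_le_strictBelow {γ γ' : Γ} (h : γ < γ') : below k γ ≤ strictBelow k γ' :=
  fun _ hf _ h' => hf _ (h.trans_le h')

lemma strictBelow_le_below (γ : Γ) : strictBelow k γ ≤ below k γ :=
  fun _ hf _ h' => hf _ h'.le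

lemma mem_below_and_coeff_of_sub_mem {γ : Γ} {f g : AddMonoidAlgebra k Γ}
    (h : f - g ∈ strictBelow k γ) (hg : g ∈ below k γ) :
    f ∈ below k γ ∧ f.coeff γ = g.coeff γ := by
  constructor
  · rw [← sub_add_cancel f g]
    exact add_mem (strictBelow_le_below γ h) hg
  · have := h γ le_rfl
    rwa [AddMonoidAlgebra.coeff_sub, Finsupp.sub_apply, sub_eq_zero] at this

/-- A monic polynomial agrees with its top power up to lower terms. This serves both to find leading
exponents and to rewrite powers of Z by means of P. -/
lemma eval₂_sub_pow_mem {S : Type w} [CommRing S] {R : Type v} [CommRing R] [Algebra k R]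
    (f : S →+* R) (a : R) {W : S[X]} (hW : W.Monic) (M : Submodule k R)
    (h : ∀ s, ∀ j < W.natDegree, f s * a ^ j ∈ M) : W.eval₂ f a - a ^ W.natDegree ∈ M := by
  rw [eval₂_eq_sum_range, Finset.sum_range_succ, hW.coeff_natDegree, map_one, one_mul,
    add_sub_cancel_right]
  exact Submodule.sum_mem _ fun j hj => h _ j (Finset.mem_range.1 hj)

end Below

section Spanning

variable {k : Type u} [Field k] {n : ℕ} {R : Type v} [CommRing R] [Algebra k R]

/-- Reduces membership of polynomial multiples of u to monomial multiples; M is only a k-subspace.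
-/
lemma aeval_mul_mem (x : Fin n → R) (u : R) (M : Submodule k R)
    (h : ∀ a, powProd x a * u ∈ M) (b : Base k n) : MvPolynomial.aeval x b * u ∈ M := by
  rw [b.as_sum, map_sum, Finset.sum_mul]
  refine Submodule.sum_mem _ fun m _ => ?_
  rw [MvPolynomial.aeval_monomial, mul_assoc, ← Algebra.smul_def, Finsupp.prod_fintype _ _ (by simp)]
  exact Submodule.smul_mem _ _ (h m)

lemma evalXZ_mul_mem (x : Fin n → R) (z u : R) (M : Submodule k R)
    (h : ∀ a i, powProd x a * z ^ i * u ∈ M) (p : (Base k n)[X]) : evalXZ x z p * u ∈ M := by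
  rw [evalXZ, coe_eval₂RingHom, eval₂_eq_sum_range, Finset.sum_mul]
  refine Submodule.sum_mem _ fun i _ => ?_
  rw [mul_assoc]
  exact aeval_mul_mem x _ M (fun a => by rw [← mul_assoc]; exact h a i) _

lemma evalXYZ_mul_mem (x : Fin n → R) (y z u : R) (M : Submodule k R)
    (h : ∀ a j i, powProd x a * y ^ j * z ^ i * u ∈ M) (q : (Base k n)[X][X]) :
    evalXYZ x y z q * u ∈ M := by
  rw [evalXYZ, coe_eval₂RingHom, eval₂_eq_sum_range, Finset.sum_mul]
  refine Submodule.sum_mem _ fun j _ => ?_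
  rw [mul_assoc]
  refine evalXZ_mul_mem x z _ M (fun a i => ?_) _
  convert h a j i using 1; ring

end Spanning

section Frame

variable {k : Type u} [Field k] {n : ℕ} {d e : Fin n → ℕ}
  {P : (Base k n)[X]} {Q : (Base k n)[X][X]}

variable (k) in
/-- The monomial `X^a Z^b` in the group algebra. -/
def laurent (i₀ : Fin n) (v : (Fin n → ℚ) × ℚ) : AddMonoidAlgebra k (Expo n) :=
  AddMonoidAlgebra.single (expo i₀ v) 1

lemma laurent_mul (i₀ : Fin n) (v w : (Fin n → ℚ) × ℚ) :
    laurent k i₀ v * laurent k i₀ w = laurent k i₀ (v + w) := by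
  simp [laurent, AddMonoidAlgebra.single_mul_single]

lemma laurent_zero (i₀ : Fin n) : laurent k i₀ 0 = 1 := by
  simp [laurent, AddMonoidAlgebra.one_def]

lemma laurent_pow (i₀ : Fin n) (v : (Fin n → ℚ) × ℚ) (m : ℕ) :
    laurent k i₀ v ^ m = laurent k i₀ (m • v) := by
  induction m with
  | zero => simp [laurent_zero]
  | succ m ih => rw [pow_succ, ih, laurent_mul, succ_nsmul]

lemma laurent_mem_below (i₀ : Fin n) (v : (Fin n → ℚ) × ℚ) :
    laurent k i₀ v ∈ below k (expo i₀ v) := single_mem_below _ _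

lemma coeff_laurent (i₀ : Fin n) (v : (Fin n → ℚ) × ℚ) :
    (laurent k i₀ v).coeff (expo i₀ v) = 1 := by simp [laurent]

/-- The exponent vector of `X^a`. -/
def xvec (a : Fin n → ℕ) : (Fin n → ℚ) × ℚ := (fun i => a i, 0)

variable (k) in
/-- The images of the `Xᵢ`. -/
def laurentX (i₀ i : Fin n) : AddMonoidAlgebra k (Expo n) := laurent k i₀ (Pi.single i 1, 0)

variable (k) in
/-- The image of `Z`. -/
def laurentZ (i₀ : Fin n) : AddMonoidAlgebra k (Expo n) := laurent k i₀ (0, 1)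

lemma powProd_laurentX (i₀ : Fin n) (a : Fin n → ℕ) :
    powProd (laurentX k i₀) a = laurent k i₀ (xvec a) := by
  have : ∀ s : Finset (Fin n), ∏ i ∈ s, laurentX k i₀ i ^ a i =
      laurent k i₀ (∑ i ∈ s, a i • ((Pi.single i 1, 0) : (Fin n → ℚ) × ℚ)) := by
    classical
    intro s
    induction s using Finset.induction_on with
    | empty => simp [laurent_zero]
    | insert i s hi ih =>
      rw [Finset.prod_insert hi, Finset.sum_insert hi, ih, laurentX, laurent_pow, laurent_mul]
  rw [powProd, this]
  congr 1
  refine Prod.ext (funext fun j => ?_) ?_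
  · simp [xvec, Prod.fst_sum, Finset.sum_apply, Pi.single_apply]
  · simp [xvec, Prod.snd_sum]

lemma laurentZ_pow (i₀ : Fin n) (m : ℕ) : laurentZ k i₀ ^ m = laurent k i₀ (0, (m : ℚ)) := by
  rw [laurentZ, laurent_pow]; simp

/-- A lower term X^a Z^j of P either contains X_{i₀}, which makes it smaller, or loses to Z^r in the
Z-degree. -/
lemma evalXZ_laurent (i₀ : Fin n) (hP : P.Monic) :
    evalXZ (laurentX k i₀) (laurentZ k i₀) P ∈ below k (expo i₀ (0, (P.natDegree : ℚ))) ∧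
    (evalXZ (laurentX k i₀) (laurentZ k i₀) P).coeff (expo i₀ (0, (P.natDegree : ℚ))) = 1 := by
  rw [← coeff_laurent (k := k) i₀ (0, (P.natDegree : ℚ))]
  refine mem_below_and_coeff_of_sub_mem ?_ (laurent_mem_below _ _)
  rw [← laurentZ_pow]
  refine eval₂_sub_pow_mem (k := k) _ _ hP _ fun b j hj => aeval_mul_mem _ _ _ (fun a => ?_) b
  rw [powProd_laurentX, laurentZ_pow, laurent_mul]
  exact below_le_strictBelow (expo_lt_expo i₀ (by simp [xvec]) (fun _ => by simpa [xvec] using hj))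
    (laurent_mem_below i₀ _)

variable (d P) in
/-- The leading exponent vector of `Y`. -/
def yvec : (Fin n → ℚ) × ℚ := -xvec d + (0, (P.natDegree : ℚ))

variable (d e P Q) in
/-- The leading exponent vector of `T`. -/
def tvec : (Fin n → ℚ) × ℚ := -xvec e + Q.natDegree • yvec d P

variable (d P) in
/-- The image of `Y`. -/
def laurentY (i₀ : Fin n) : AddMonoidAlgebra k (Expo n) :=
  laurent k i₀ (-xvec d) * evalXZ (laurentX k i₀) (laurentZ k i₀) P

variable (d e P Q) in
/-- The image of `T`. -/
def laurentT (i₀ : Fin n) : AddMonoidAlgebra k (Expo n) :=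
  laurent k i₀ (-xvec e) * evalXYZ (laurentX k i₀) (laurentY d P i₀) (laurentZ k i₀) Q

lemma powProd_mul_laurentY (i₀ : Fin n) : powProd (laurentX k i₀) d * laurentY d P i₀ =
    evalXZ (laurentX k i₀) (laurentZ k i₀) P := by
  rw [laurentY, powProd_laurentX, ← mul_assoc, laurent_mul, add_neg_cancel, laurent_zero, one_mul]

lemma powProd_mul_laurentT (i₀ : Fin n) : powProd (laurentX k i₀) e * laurentT d e P Q i₀ =
    evalXYZ (laurentX k i₀) (laurentY d P i₀) (laurentZ k i₀) Q := by
  rw [laurentT, powProd_laurentX, ← mul_assoc, laurent_mul, add_neg_cancel, laurent_zero, one_mul]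

lemma laurentY_mem (i₀ : Fin n) (hP : P.Monic) :
    laurentY d P i₀ ∈ below k (expo i₀ (yvec d P)) ∧
      (laurentY d P i₀).coeff (expo i₀ (yvec d P)) = 1 := by
  obtain ⟨h1, h2⟩ := evalXZ_laurent i₀ hP
  rw [yvec, map_add, laurentY]
  refine ⟨mul_mem_below (laurent_mem_below _ _) h1, ?_⟩
  rw [coeff_mul_of_mem_below (laurent_mem_below _ _) h1, coeff_laurent, h2, one_mul]

lemma laurentY_pow_mem (i₀ : Fin n) (hP : P.Monic) (j : ℕ) :
    laurentY d P i₀ ^ j ∈ below k (expo i₀ (j • yvec d P)) ∧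
      (laurentY d P i₀ ^ j).coeff (expo i₀ (j • yvec d P)) = 1 := by
  obtain ⟨h1, h2⟩ := laurentY_mem (d := d) i₀ hP
  induction j with
  | zero =>
    rw [pow_zero, zero_smul, ← laurent_zero i₀]
    exact ⟨laurent_mem_below _ _, coeff_laurent _ _⟩
  | succ j ih =>
    rw [pow_succ, succ_nsmul, map_add]
    refine ⟨mul_mem_below ih.1 h1, ?_⟩
    rw [coeff_mul_of_mem_below ih.1 h1, ih.2, h2, one_mul]

/-- Y has a pole of order d i₀ ≥ 1 along X_{i₀}, so Y^s beats all lower powers of Y, whatever their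
coefficients in k[X, Z]. -/
lemma evalXYZ_laurent (i₀ : Fin n) (hd : 1 ≤ d i₀) (hP : P.Monic) (hQ : Q.Monic) :
    evalXYZ (laurentX k i₀) (laurentY d P i₀) (laurentZ k i₀) Q ∈
      below k (expo i₀ (Q.natDegree • yvec d P)) ∧
    (evalXYZ (laurentX k i₀) (laurentY d P i₀) (laurentZ k i₀) Q).coeff
      (expo i₀ (Q.natDegree • yvec d P)) = 1 := by
  rw [← (laurentY_pow_mem i₀ hP Q.natDegree).2]
  refine mem_below_and_coeff_of_sub_mem ?_ (laurentY_pow_mem i₀ hP _).1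
  refine eval₂_sub_pow_mem (k := k) _ _ hQ _ fun b j hj =>
    evalXZ_mul_mem _ _ _ _ (fun a i => ?_) b
  rw [powProd_laurentX, laurentZ_pow, laurent_mul]
  refine below_le_strictBelow ?_
    (mul_mem_below (laurent_mem_below i₀ _) (laurentY_pow_mem i₀ hP j).1)
  rw [← map_add]
  have hj' : (j : ℚ) * d i₀ < Q.natDegree * d i₀ := by
    have : (0 : ℚ) < d i₀ := by exact_mod_cast hd
    have : (j : ℚ) < Q.natDegree := by exact_mod_cast hj
    gcongr
  have ha : (0 : ℚ) ≤ a i₀ := by positivity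
  refine expo_lt_expo i₀ ?_ (fun h => ?_)
  · simp [xvec, yvec]; linarith
  · exfalso
    simp [xvec, yvec] at h
    linarith

lemma laurentT_mem (i₀ : Fin n) (hd : 1 ≤ d i₀) (hP : P.Monic) (hQ : Q.Monic) :
    laurentT d e P Q i₀ ∈ below k (expo i₀ (tvec d e P Q)) ∧
      (laurentT d e P Q i₀).coeff (expo i₀ (tvec d e P Q)) = 1 := by
  obtain ⟨h1, h2⟩ := evalXYZ_laurent i₀ hd hP hQ
  rw [tvec, map_add, laurentT]
  refine ⟨mul_mem_below (laurent_mem_below _ _) h1, ?_⟩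
  rw [coeff_mul_of_mem_below (laurent_mem_below _ _) h1, coeff_laurent, h2, one_mul]

variable (d e P Q) in
/-- The embedding of `L d e P Q` in the group algebra of `Expo n`. -/
def embLaurent (i₀ : Fin n) : L d e P Q →ₐ[k] AddMonoidAlgebra k (Expo n) :=
  lift (laurentX k i₀) (laurentY d P i₀) (laurentZ k i₀) (laurentT d e P Q i₀)
    (powProd_mul_laurentY i₀) (powProd_mul_laurentT i₀)

variable (d e P Q) in
/-- The standard generators of `L d e P Q`, as a family. -/
def gens : Fin n ⊕ Fin 3 → L d e P Q :=
  Sum.elim (genX d e P Q) ![genY d e P Q, genZ d e P Q, genT d e P Q]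

variable (d e P Q) in
/-- The exponent vectors of the standard generators. -/
def vecs : Fin n ⊕ Fin 3 → (Fin n → ℚ) × ℚ :=
  Sum.elim (fun i => (Pi.single i 1, 0)) ![yvec d P, (0, 1), tvec d e P Q]

variable (e P) in
/-- The standard monomials, which form a basis of `L d e P Q`. -/
def standard : Set (Fin n ⊕ Fin 3 →₀ ℕ) :=
  {m | m (.inr 1) < P.natDegree ∧ (m (.inr 2) = 0 ∨ ∃ i, m (.inl i) < e i)}

lemma aeval_gens_surjective :
    Function.Surjective (MvPolynomial.aeval (gens d e P Q) : Ambient k n →ₐ[k] L d e P Q) := by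
  have : MvPolynomial.aeval (gens d e P Q) = Ideal.Quotient.mkₐ k (relations d e P Q) := by
    refine MvPolynomial.algHom_ext fun s => ?_
    rw [MvPolynomial.aeval_X]
    rcases s with i | s
    · rfl
    · fin_cases s <;> rfl
  rw [this]
  exact Ideal.Quotient.mkₐ_surjective k _

lemma prod_gens (m : Fin n ⊕ Fin 3 →₀ ℕ) : (m.prod fun s i => gens d e P Q s ^ i) =
    powProd (genX d e P Q) (fun i => m (.inl i)) * genY d e P Q ^ m (.inr 0) *
      genZ d e P Q ^ m (.inr 1) * genT d e P Q ^ m (.inr 2) := by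
  rw [Finsupp.prod_fintype _ _ (by simp), Fintype.prod_sum_type, Fin.prod_univ_three, powProd]
  simp only [gens, Sum.elim_inl, Sum.elim_inr, Matrix.cons_val_zero, Matrix.cons_val_one,
    Matrix.cons_val]
  ring

/-- The span of the standard monomials. -/
def standardSpan : Submodule k (L d e P Q) :=
  (MvPolynomial.restrictSupport k (standard e P)).map
    (MvPolynomial.aeval (gens d e P Q) : Ambient k n →ₐ[k] L d e P Q).toLinearMap

lemma mem_standardSpan {a : Fin n → ℕ} {j i l : ℕ} (hi : i < P.natDegree)
    (h : l = 0 ∨ ∃ i, a i < e i) :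
    powProd (genX d e P Q) a * genY d e P Q ^ j * genZ d e P Q ^ i * genT d e P Q ^ l ∈
      standardSpan (d := d) (e := e) (P := P) (Q := Q) := by
  classical
  set m : Fin n ⊕ Fin 3 →₀ ℕ := Finsupp.equivFunOnFinite.symm (Sum.elim a ![j, i, l]) with hm
  refine ⟨MvPolynomial.monomial m 1, ?_, ?_⟩
  · rw [SetLike.mem_coe, MvPolynomial.mem_restrictSupport_iff]
    intro m' hm'
    rw [MvPolynomial.support_monomial, if_neg one_ne_zero, Finset.coe_singleton,
      Set.mem_singleton_iff] at hm'
    subst hm'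
    exact ⟨by simpa [hm] using hi, by simpa [hm] using h⟩
  · rw [AlgHom.toLinearMap_apply, MvPolynomial.aeval_monomial, map_one, one_mul, prod_gens]
    simp [hm]

/-- The rewriting rules X^[e] T → Q and Z^r → X^[d] Y - (P - Z^r) terminate: the first lowers the
exponent l of T, with no control over the others, and the second lowers the exponent i of Z while
keeping l. Hence the induction on l and then on i. -/
lemma monomial_mem_standardSpan (hP : P.Monic) (hr : 2 ≤ P.natDegree) (l : ℕ) :
    ∀ i (a : Fin n → ℕ) (j : ℕ),
    powProd (genX d e P Q) a * genY d e P Q ^ j * genZ d e P Q ^ i * genT d e P Q ^ l ∈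
      standardSpan (d := d) (e := e) (P := P) (Q := Q) := by
  induction l using Nat.strong_induction_on with
  | _ l ihl =>
  intro i
  induction i using Nat.strong_induction_on with
  | _ i ihi =>
  intro a j
  rcases lt_or_ge i P.natDegree with hi | hi
  · by_cases hstd : l = 0 ∨ ∃ i, a i < e i
    · exact mem_standardSpan hi hstd
    push Not at hstd
    obtain ⟨l, rfl⟩ := Nat.exists_eq_succ_of_ne_zero hstd.1
    have ha : a = e + (a - e) := by
      funext i; have := hstd.2 i; simp only [Pi.add_apply, Pi.sub_apply]; omega
    have heq : powProd (genX d e P Q) a * genY d e P Q ^ j * genZ d e P Q ^ i *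
        genT d e P Q ^ (l + 1) =
        evalXYZ (genX d e P Q) (genY d e P Q) (genZ d e P Q) Q *
        (powProd (genX d e P Q) (a - e) * genY d e P Q ^ j * genZ d e P Q ^ i *
          genT d e P Q ^ l) := by
      rw [← relation_genT]
      conv_lhs => rw [ha, powProd_add]
      ring
    rw [Nat.succ_eq_add_one, heq]
    refine evalXYZ_mul_mem _ _ _ _ _ (fun a' j' i' => ?_) _
    convert ihl l (Nat.lt_succ_self l) (i' + i) (a' + (a - e)) (j' + j) using 1
    rw [powProd_add]; ring
  · set u := powProd (genX d e P Q) a * genY d e P Q ^ j * genZ d e P Q ^ (i - P.natDegree) *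
      genT d e P Q ^ l with hu
    have h1 : evalXZ (genX d e P Q) (genZ d e P Q) P * u ∈
        standardSpan (d := d) (e := e) (P := P) (Q := Q) := by
      convert ihi (i - P.natDegree) (by omega) (d + a) (j + 1) using 1
      rw [← relation_genY, powProd_add, hu]; ring
    have h2 : evalXZ (genX d e P Q) (genZ d e P Q) P - genZ d e P Q ^ P.natDegree ∈
        (standardSpan (d := d) (e := e) (P := P) (Q := Q)).comap
          (LinearMap.mulRight k u) := by
      refine eval₂_sub_pow_mem (k := k) _ _ hP _ fun b i' hi' => ?_
      rw [Submodule.mem_comap, LinearMap.mulRight_apply, mul_assoc]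
      refine aeval_mul_mem _ _ _ (fun a' => ?_) b
      convert ihi (i' + (i - P.natDegree)) (by omega) (a' + a) j using 1
      rw [powProd_add, hu]; ring
    rw [Submodule.mem_comap, LinearMap.mulRight_apply] at h2
    convert sub_mem h1 h2 using 1
    rw [hu, sub_mul, sub_sub_cancel]
    conv_lhs => rw [show i = P.natDegree + (i - P.natDegree) by omega]
    ring

lemma exists_standard_rep (hP : P.Monic) (hr : 2 ≤ P.natDegree) (a : L d e P Q) :
    ∃ p : Ambient k n, MvPolynomial.aeval (gens d e P Q) p = a ∧
      ∀ m ∈ p.support, m ∈ standard e P := by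
  have : a ∈ standardSpan (d := d) (e := e) (P := P) (Q := Q) := by
    obtain ⟨p, rfl⟩ := aeval_gens_surjective a
    rw [p.as_sum, map_sum]
    refine Submodule.sum_mem _ fun m _ => ?_
    rw [MvPolynomial.aeval_monomial, prod_gens, ← Algebra.smul_def]
    exact Submodule.smul_mem _ _ (monomial_mem_standardSpan hP hr _ _ _ _)
  obtain ⟨p, hp, rfl⟩ := this
  exact ⟨p, rfl, fun m hm => (MvPolynomial.mem_restrictSupport_iff k).1 hp hm⟩

lemma weight_vecs (m : Fin n ⊕ Fin 3 →₀ ℕ) : Finsupp.weight (vecs d e P Q) m =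
    (fun i => (m (.inl i) : ℚ) - m (.inr 0) * d i
        - m (.inr 2) * (e i + Q.natDegree * d i),
      m (.inr 1) + P.natDegree * (m (.inr 0) + Q.natDegree * m (.inr 2) : ℚ)) := by
  rw [Finsupp.weight_apply, Finsupp.sum_fintype _ _ (by simp), Fintype.sum_sum_type,
    Fin.sum_univ_three]
  refine Prod.ext (funext fun i => ?_) ?_
  · simp [vecs, yvec, tvec, xvec, Prod.fst_sum, Finset.sum_apply, Pi.single_apply]
    ring
  · simp [vecs, yvec, tvec, xvec, Prod.snd_sum]
    ring

/-- The Z-degree modulo r gives the exponent of Z, and its quotient gives that of Y up to multiples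
of s. The X-degrees then determine a monomial up to trading X^[e] T for Y^s, and standardness leaves
one representative. -/
lemma weight_vecs_injOn : Set.InjOn (Finsupp.weight (vecs d e P Q) : (Fin n ⊕ Fin 3 →₀ ℕ) → _)
    (standard e P) := by
  intro m hm m' hm' h
  rw [weight_vecs, weight_vecs, Prod.ext_iff] at h
  obtain ⟨hx, hz⟩ := h
  simp only at hx hz
  have hz' : m (.inr 1) + P.natDegree * (m (.inr 0) + Q.natDegree * m (.inr 2)) =
      m' (.inr 1) + P.natDegree * (m' (.inr 0) + Q.natDegree * m' (.inr 2)) := by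
    exact_mod_cast hz
  have h1 : m (.inr 1) = m' (.inr 1) := by
    have := congrArg (· % P.natDegree) hz'
    simpa [Nat.add_mul_mod_self_left, Nat.mod_eq_of_lt hm.1, Nat.mod_eq_of_lt hm'.1] using this
  have h2 : m (.inr 0) + Q.natDegree * m (.inr 2) = m' (.inr 0) + Q.natDegree * m' (.inr 2) := by
    rw [h1] at hz'
    exact Nat.eq_of_mul_eq_mul_left (by have := hm.1; omega) (Nat.add_left_cancel hz')
  have h2' : (m (.inr 0) : ℚ) + Q.natDegree * m (.inr 2) =
      m' (.inr 0) + Q.natDegree * m' (.inr 2) := by exact_mod_cast h2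
  have h3 : ∀ i, m (.inl i) + m' (.inr 2) * e i = m' (.inl i) + m (.inr 2) * e i := by
    intro i
    have h := congrFun hx i
    have : (m (.inl i) : ℚ) + m' (.inr 2) * e i = m' (.inl i) + m (.inr 2) * e i := by
      linear_combination h + (d i : ℚ) * h2'
    exact_mod_cast this
  -- A larger exponent of T in m' would make its exponent of each Xᵢ at least e i, contrary to
  -- standardness.
  have key : ∀ m m' : Fin n ⊕ Fin 3 →₀ ℕ, m' ∈ standard e P →
      (∀ i, m (.inl i) + m' (.inr 2) * e i = m' (.inl i) + m (.inr 2) * e i) →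
      m' (.inr 2) ≤ m (.inr 2) := by
    intro m m' hm' h3
    by_contra! hlt
    obtain ⟨-, h0 | ⟨i, hi⟩⟩ := hm'
    · omega
    · have h4 := h3 i
      have h5 : (m (.inr 2) + 1) * e i ≤ m' (.inr 2) * e i := Nat.mul_le_mul_right _ hlt
      rw [add_mul] at h5
      omega
  have h4 : m (.inr 2) = m' (.inr 2) :=
    (key m' m hm fun i => (h3 i).symm).antisymm (key m m' hm' h3)
  ext s
  rcases s with i | s
  · have := h3 i; rw [h4] at this; omega
  · fin_cases s
    · simpa [h4] using h2
    · exact h1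
    · exact h4

lemma weight_expo (i₀ : Fin n) (m : Fin n ⊕ Fin 3 →₀ ℕ) :
    Finsupp.weight (fun s => expo i₀ (vecs d e P Q s)) m =
      expo i₀ (Finsupp.weight (vecs d e P Q) m) := by
  rw [Finsupp.weight_apply, Finsupp.weight_apply, map_finsuppSum]
  simp only [map_nsmul]

/-- The leading frame of `L d e P Q` adapted to the variable `X_{i₀}`. -/
def frame (h : Admissible d e P Q) (i₀ : Fin n) :
    LeadingFrame k (L d e P Q) (Expo n) (Fin n ⊕ Fin 3) where
  emb := embLaurent d e P Q i₀
  gen := gens d e P Q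
  exp s := expo i₀ (vecs d e P Q s)
  emb_gen_mem s := by
    rcases s with i | s
    · simpa [gens, vecs, embLaurent, laurentX] using laurent_mem_below i₀ _
    · fin_cases s
      · simpa [gens, vecs, embLaurent] using (laurentY_mem i₀ h.monic_P).1
      · simpa [gens, vecs, embLaurent, laurentZ] using laurent_mem_below i₀ _
      · simpa [gens, vecs, embLaurent] using
          (laurentT_mem i₀ (h.one_le_d i₀) h.monic_P h.monic_Q).1
  coeff_emb_gen s := by
    rcases s with i | s
    · simpa [gens, vecs, embLaurent, laurentX] using coeff_laurent i₀ _
    · fin_cases s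
      · simpa [gens, vecs, embLaurent] using (laurentY_mem i₀ h.monic_P).2
      · simpa [gens, vecs, embLaurent, laurentZ] using coeff_laurent i₀ _
      · simpa [gens, vecs, embLaurent] using
          (laurentT_mem i₀ (h.one_le_d i₀) h.monic_P h.monic_Q).2
  exists_rep a := by
    obtain ⟨p, hp, hs⟩ := exists_standard_rep h.monic_P h.two_le_P a
    refine ⟨p, hp, fun m hm m' hm' heq => ?_⟩
    rw [weight_expo, weight_expo] at heq
    exact weight_vecs_injOn (hs m hm) (hs m' hm') (expo_injective i₀ heq)

lemma wt_frame (h : Admissible d e P Q) (i₀ : Fin n) (m : Fin n ⊕ Fin 3 →₀ ℕ) :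
    (frame h i₀).wt m = expo i₀ (Finsupp.weight (vecs d e P Q) m) := weight_expo i₀ m

lemma isDomain_of_admissible (h : Admissible d e P Q) (i₀ : Fin n) : IsDomain (L d e P Q) :=
  Function.Injective.isDomain (frame h i₀).emb (frame h i₀).emb_injective

lemma genX_ne_zero (h : Admissible d e P Q) (i : Fin n) : genX d e P Q i ≠ 0 := by
  intro h0
  have h1 := (frame h i).coeff_emb_gen (.inl i)
  rw [show (frame h i).gen (.inl i) = genX d e P Q i from rfl, h0, map_zero] at h1
  simp at h1

end Frame

end

/-! ### Invariants of exponential maps of L -/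

section

namespace LeadingFrame.IsSlope

variable {k : Type u} {A : Type v} {Γ : Type w} {σ : Type*} [Field k] [CommRing A]
    [Algebra k A] [AddCommGroup Γ] [LinearOrder Γ] [IsOrderedAddMonoid Γ]
    {F : LeadingFrame k A Γ σ} {δ : ExpMap k A} {lam : Γ} (hδ : F.IsSlope δ lam)
include hδ

/-- Monomials of equal weight have the same leading term, so every relation among the exponents of
generators becomes a relation among their forms. -/
lemma monForm_congr {m m' : σ →₀ ℕ} (h : F.wt m = F.wt m') :
    F.monForm lam δ m = F.monForm lam δ m' := by
  rw [monForm, monForm, ← h]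
  refine hδ.leadForm_congr (F.emb_mon_mem_and m).1 (h ▸ (F.emb_mon_mem_and m').1) ?_
  rw [(F.emb_mon_mem_and m).2, h, (F.emb_mon_mem_and m').2]

lemma natDegree_monForm (m : σ →₀ ℕ) : (F.monForm lam δ m).natDegree =
    m.sum fun s i => i * (F.genForm lam δ s).natDegree := by
  classical
  induction m using mon_induction with
  | h0 =>
    have := hδ.natDegree_monForm_add 0 0
    rw [add_zero] at this
    rw [Finsupp.sum_zero_index]; omega
  | h1 s m ih =>
    rw [hδ.natDegree_monForm_add, ih, monForm_single,
      Finsupp.sum_add_index' (by simp) (by intros; ring)]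
    simp

lemma genForm_eq_one_iff (s : σ) :
    F.genForm lam δ s = 1 ↔ (F.genForm lam δ s).natDegree = 0 := by
  rw [← monForm_single, monForm_eq_one_iff]

/-- Modulo exponents of invariant monomials, all exponents are multiples of a single one. -/
lemma exists_exp_eq : ∃ s₀, 0 < (F.genForm lam δ s₀).natDegree ∧ ∀ s, ∃ (q : ℕ) (m m' : σ →₀ ℕ),
    F.exp s + q • F.wt m' = q • F.exp s₀ + F.wt m ∧
    (∀ s ∈ m.support, (F.genForm lam δ s).natDegree = 0) ∧
    ∀ s ∈ m'.support, (F.genForm lam δ s).natDegree = 0 := by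
  obtain ⟨s₀, h₀, hdvd⟩ := hδ.exists_minimal_degree
  refine ⟨s₀, h₀, fun s => ?_⟩
  obtain ⟨q, hq⟩ := hdvd s
  obtain ⟨m, hm, hm1⟩ := hδ.exists_invariant_monomial (Finsupp.single s 1)
  obtain ⟨m', hm', hm1'⟩ := hδ.exists_invariant_monomial (Finsupp.single s₀ 1)
  rw [monForm_single, wt_single] at hm hm'
  refine ⟨q, m, m', ?_, fun s hs => (hδ.genForm_eq_one_iff s).1 (hm1 s hs),
    fun s hs => (hδ.genForm_eq_one_iff s).1 (hm1' s hs)⟩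
  -- The degree of the form of s is q times that of s₀, so the multiples of the slope cancel.
  rw [hm, hm', hq, mul_comm, mul_smul, smul_add]
  abel

end LeadingFrame.IsSlope

section Invariants

variable {k : Type u} [Field k] {n : ℕ} {d e : Fin n → ℕ}
  {P : (Base k n)[X]} {Q : (Base k n)[X][X]}

/-- The degrees of the leading forms of the generators. -/
def formDeg (h : Admissible d e P Q) (i₀ : Fin n) (lam : Expo n) (δ : ExpMap k (L d e P Q))
    (s : Fin n ⊕ Fin 3) : ℕ := ((frame h i₀).genForm lam δ s).natDegree

variable {h : Admissible d e P Q} {i₀ : Fin n} {lam : Expo n} {δ : ExpMap k (L d e P Q)}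

lemma formDeg_relation (hδ : (frame h i₀).IsSlope δ lam) {f g : Fin n ⊕ Fin 3 → ℕ}
    (hfg : Finsupp.weight (vecs d e P Q) (Finsupp.equivFunOnFinite.symm f) =
      Finsupp.weight (vecs d e P Q) (Finsupp.equivFunOnFinite.symm g)) :
    ∑ s, f s * formDeg h i₀ lam δ s = ∑ s, g s * formDeg h i₀ lam δ s := by
  have h1 := congrArg natDegree (hδ.monForm_congr (m := Finsupp.equivFunOnFinite.symm f)
    (m' := Finsupp.equivFunOnFinite.symm g) (by rw [wt_frame, wt_frame, hfg]))
  rw [hδ.natDegree_monForm, hδ.natDegree_monForm, Finsupp.sum_fintype _ _ (by simp),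
    Finsupp.sum_fintype _ _ (by simp)] at h1
  simpa [formDeg] using h1

lemma formDeg_relation_Y (hδ : (frame h i₀).IsSlope δ lam) :
    ∑ i, d i * formDeg h i₀ lam δ (.inl i) + formDeg h i₀ lam δ (.inr 0) =
      P.natDegree * formDeg h i₀ lam δ (.inr 1) := by
  have := formDeg_relation hδ (f := Sum.elim d ![1, 0, 0]) (g := Sum.elim 0 ![0, P.natDegree, 0])
    (by
      rw [weight_vecs, weight_vecs]
      refine Prod.ext (funext fun i => ?_) ?_ <;> simp)
  simpa [Fintype.sum_sum_type, Fin.sum_univ_three] using this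

lemma formDeg_relation_T (hδ : (frame h i₀).IsSlope δ lam) :
    ∑ i, e i * formDeg h i₀ lam δ (.inl i) + formDeg h i₀ lam δ (.inr 2) =
      Q.natDegree * formDeg h i₀ lam δ (.inr 0) := by
  have := formDeg_relation hδ (f := Sum.elim e ![0, 0, 1]) (g := Sum.elim 0 ![Q.natDegree, 0, 0])
    (by
      rw [weight_vecs, weight_vecs]
      refine Prod.ext (funext fun i => ?_) ?_
      · simp
      · simp)
  simpa [Fintype.sum_sum_type, Fin.sum_univ_three] using this

lemma formDeg_eq_zero_of_sum {f : Fin n → ℕ} (hf : ∀ i, 1 ≤ f i)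
    (h0 : ∑ i, f i * formDeg h i₀ lam δ (.inl i) = 0) (i : Fin n) :
    formDeg h i₀ lam δ (.inl i) = 0 := by
  have := (Finset.sum_eq_zero_iff.1 h0) i (Finset.mem_univ i)
  have hi := hf i
  rcases Nat.mul_eq_zero.1 this with h | h
  · omega
  · exact h

/-- If t and all xᵢ had trivial forms, the relations x^[e] t = y^s and x^[d] y = z^r would make y
and z trivial too, contrary to the sharpness of the slope. -/
lemma exists_formDeg_X_ne_zero (hδ : (frame h i₀).IsSlope δ lam)
    (ht : formDeg h i₀ lam δ (.inr 2) = 0) : ∃ i, formDeg h i₀ lam δ (.inl i) ≠ 0 := by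
  by_contra! hx
  have hT := formDeg_relation_T hδ
  have hY := formDeg_relation_Y hδ
  simp only [hx, mul_zero, Finset.sum_const_zero, zero_add, ht] at hT hY
  have h1 : formDeg h i₀ lam δ (.inr 0) = 0 := by
    rcases Nat.mul_eq_zero.1 hT.symm with h' | h'
    · have := h.two_le_Q; omega
    · exact h'
  have h2 : formDeg h i₀ lam δ (.inr 1) = 0 := by
    rw [h1] at hY
    rcases Nat.mul_eq_zero.1 hY.symm with h' | h'
    · have := h.two_le_P; omega
    · exact h'
  obtain ⟨s, hs⟩ := hδ.sharp
  apply hs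
  refine (hδ.genForm_eq_one_iff s).2 ?_
  rcases s with i | s
  · exact hx i
  · fin_cases s
    · exact h1
    · exact h2
    · exact ht

lemma formDeg_Y_Z_ne_zero (hδ : (frame h i₀).IsSlope δ lam) :
    formDeg h i₀ lam δ (.inr 0) ≠ 0 ∧ formDeg h i₀ lam δ (.inr 1) ≠ 0 := by
  have hT := formDeg_relation_T hδ
  have hY := formDeg_relation_Y hδ
  have hy : formDeg h i₀ lam δ (.inr 0) ≠ 0 := by
    intro hy
    rw [hy, mul_zero, Nat.add_eq_zero_iff] at hT
    obtain ⟨i, hi⟩ := exists_formDeg_X_ne_zero hδ hT.2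
    exact hi (formDeg_eq_zero_of_sum h.one_le_e hT.1 i)
  refine ⟨hy, fun hz => ?_⟩
  rw [hz, mul_zero, Nat.add_eq_zero_iff] at hY
  exact hy hY.2

/-- The leading form of `T` is not invariant. -/
lemma formDeg_T_ne_zero (hδ : (frame h i₀).IsSlope δ lam) : formDeg h i₀ lam δ (.inr 2) ≠ 0 := by
  intro ht
  obtain ⟨hy, hz⟩ := formDeg_Y_Z_ne_zero hδ
  obtain ⟨i, hi⟩ := exists_formDeg_X_ne_zero hδ ht
  obtain ⟨s₀, hs₀, hall⟩ := hδ.exists_exp_eq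
  -- If t is invariant, then xᵢ, y and z move, so the invariant monomials involve only t and the xⱼ
  -- with j ≠ i. Each possible s₀ of minimal degree is then excluded by writing 1 as a multiple of
  -- an integer that is at least 2.
  have key : ∀ s, ∃ (q : ℕ) (m m' : Fin n ⊕ Fin 3 →₀ ℕ),
      vecs d e P Q s + q • Finsupp.weight (vecs d e P Q) m' =
        q • vecs d e P Q s₀ + Finsupp.weight (vecs d e P Q) m ∧
      m (.inl i) = 0 ∧ m (.inr 0) = 0 ∧ m (.inr 1) = 0 ∧
      m' (.inl i) = 0 ∧ m' (.inr 0) = 0 ∧ m' (.inr 1) = 0 := by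
    intro s
    obtain ⟨q, m, m', heq, hm, hm'⟩ := hall s
    refine ⟨q, m, m', ?_, ?_⟩
    · apply expo_injective i₀
      rw [wt_frame, wt_frame] at heq
      rw [map_add, map_add, map_nsmul, map_nsmul]
      exact heq
    · have aux : ∀ m : Fin n ⊕ Fin 3 →₀ ℕ,
          (∀ s ∈ m.support, ((frame h i₀).genForm lam δ s).natDegree = 0) →
          ∀ s, formDeg h i₀ lam δ s ≠ 0 → m s = 0 := by
        intro m hm s hs
        by_contra hne
        exact hs (hm s (Finsupp.mem_support_iff.2 hne))
      exact ⟨aux m hm _ hi, aux m hm _ hy, aux m hm _ hz, aux m' hm' _ hi, aux m' hm' _ hy,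
        aux m' hm' _ hz⟩
  have hr := h.two_le_P
  have contra : ∀ (a b : ℤ), 2 ≤ a → 1 = a * b → False := by
    intro a b ha hab
    have := Int.le_of_dvd one_pos (Dvd.intro b hab.symm)
    omega
  rcases s₀ with j | s₀
  -- The Z-degree of z is 1, while those of xⱼ and t are 0 and rs.
  · obtain ⟨q, m, m', heq, -, hm2, hm3, -, hm2', hm3'⟩ := key (.inr 1)
    have h2 := congrArg Prod.snd heq
    rw [weight_vecs, weight_vecs] at h2
    simp [vecs, hm2, hm3, hm2', hm3'] at h2
    refine contra P.natDegree (Q.natDegree * (m (.inr 2) - q * m' (.inr 2)))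
      (by exact_mod_cast hr) ?_
    have : ((1 : ℤ) : ℚ) = ((P.natDegree * (Q.natDegree * (m (.inr 2) - q * m' (.inr 2))) : ℤ) : ℚ) := by
      push_cast
      linear_combination h2
    exact_mod_cast this
  · fin_cases s₀
    -- The same comparison, now with y of Z-degree r.
    · obtain ⟨q, m, m', heq, -, hm2, hm3, -, hm2', hm3'⟩ := key (.inr 1)
      have h2 := congrArg Prod.snd heq
      rw [weight_vecs, weight_vecs] at h2
      simp [vecs, yvec, xvec, hm2, hm3, hm2', hm3'] at h2
      refine contra P.natDegree (q + Q.natDegree * (m (.inr 2) - q * m' (.inr 2)))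
        (by exact_mod_cast hr) ?_
      have : ((1 : ℤ) : ℚ) =
          ((P.natDegree * (q + Q.natDegree * (m (.inr 2) - q * m' (.inr 2))) : ℤ) : ℚ) := by
        push_cast
        linear_combination h2
      exact_mod_cast this
    -- Compare the Xᵢ-degree of xᵢ instead: z has degree 0, and t has degree -(e i + s d i).
    · obtain ⟨q, m, m', heq, hm1, hm2, hm3, hm1', hm2', hm3'⟩ := key (.inl i)
      have h2 := congrFun (congrArg Prod.fst heq) i
      rw [weight_vecs, weight_vecs] at h2
      simp [vecs, hm1, hm2, hm3, hm1', hm2', hm3'] at h2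
      have he := h.one_le_e i
      have hd : Q.natDegree * 1 ≤ Q.natDegree * d i := Nat.mul_le_mul_left _ (h.one_le_d i)
      have hs := h.two_le_Q
      refine contra (e i + Q.natDegree * d i : ℕ) (q * m' (.inr 2) - m (.inr 2))
        (by exact_mod_cast (by omega : 2 ≤ e i + Q.natDegree * d i)) ?_
      have : ((1 : ℤ) : ℚ) = (((e i + Q.natDegree * d i : ℕ) *
          (q * m' (.inr 2) - m (.inr 2)) : ℤ) : ℚ) := by
        push_cast
        linear_combination h2
      exact_mod_cast this
    · exact hs₀.ne' ht

/-- Invariants are polynomials in the other variables modulo `X_{i₀}`. -/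
lemma exists_dvd_sub_aeval_of_invariant (hδ : (frame h i₀).IsSlope δ lam) {f : L d e P Q}
    (hf : δ.hom f = C f) : ∃ b : MvPolynomial {j : Fin n // j ≠ i₀} k,
      genX d e P Q i₀ ∣ f - MvPolynomial.aeval (fun j => genX d e P Q j.1) b := by
  classical
  by_cases hf0 : f = 0
  · exact ⟨0, by simp [hf0]⟩
  obtain ⟨p, m₀, hl⟩ := LeadingFrame.exists_isLead (F := frame h i₀) hf0
  have hm₀ : ∀ s, formDeg h i₀ lam δ s ≠ 0 → m₀ s = 0 := by
    intro s hs
    by_contra hne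
    refine hs ?_
    have := hδ.genForm_eq_one_of_invariant hl hf (Finsupp.mem_support_iff.2 hne)
    exact (hδ.genForm_eq_one_iff s).1 this
  obtain ⟨hy, hz⟩ := formDeg_Y_Z_ne_zero hδ
  have hy0 := hm₀ _ hy
  have hz0 := hm₀ _ hz
  have ht0 := hm₀ _ (formDeg_T_ne_zero hδ)
  have hterm : ∀ m ∈ p.support, ∃ b : MvPolynomial {j : Fin n // j ≠ i₀} k,
      genX d e P Q i₀ ∣ p.coeff m • (frame h i₀).mon m -
        MvPolynomial.aeval (fun j => genX d e P Q j.1) b := by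
    intro m hm
    have hmon : (frame h i₀).mon m =
        powProd (genX d e P Q) (fun i => m (.inl i)) * genY d e P Q ^ m (.inr 0) *
          genZ d e P Q ^ m (.inr 1) * genT d e P Q ^ m (.inr 2) := by
      rw [LeadingFrame.mon_eq]; exact prod_gens m
    by_cases hmi : m (.inl i₀) = 0
    -- The leading monomial has nonnegative X_{i₀}-degree and Z-degree 0. A term without X_{i₀}
    -- cannot exceed it, so it has no pole along X_{i₀}, hence no Y or T; then the X_{i₀}-degrees
    -- agree and Z is excluded as well.
    · have hle := hl.le hm
      rw [wt_frame, wt_frame] at hle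
      obtain ⟨h1, h2⟩ := le_of_expo_le i₀ hle
      rw [weight_vecs, weight_vecs] at h1 h2
      simp only [hy0, hz0, ht0, hmi, Nat.cast_zero, zero_mul, sub_zero, mul_zero, add_zero,
        zero_sub] at h1 h2
      have hd : (1 : ℚ) ≤ d i₀ := by exact_mod_cast h.one_le_d i₀
      have he : (1 : ℚ) ≤ e i₀ := by exact_mod_cast h.one_le_e i₀
      have hr : (2 : ℚ) ≤ P.natDegree := by exact_mod_cast h.two_le_P
      have ha : (m (.inr 0) : ℚ) ≤ m (.inr 0) * d i₀ := le_mul_of_one_le_right (by positivity) hd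
      have hb : (m (.inr 2) : ℚ) ≤ m (.inr 2) * (e i₀ + Q.natDegree * d i₀) :=
        le_mul_of_one_le_right (by positivity) (by
          have : (0 : ℚ) ≤ Q.natDegree * d i₀ := by positivity
          linarith)
      have hc : (0 : ℚ) ≤ m₀ (.inl i₀) := by positivity
      have hy1 : m (.inr 0) = 0 := by
        have h0 : (0 : ℚ) ≤ m (.inr 0) := by positivity
        have h0' : (0 : ℚ) ≤ m (.inr 2) := by positivity
        exact_mod_cast (by linarith : (m (.inr 0) : ℚ) = 0)
      have ht1 : m (.inr 2) = 0 := by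
        have h0 : (0 : ℚ) ≤ m (.inr 0) := by positivity
        have h0' : (0 : ℚ) ≤ m (.inr 2) := by positivity
        exact_mod_cast (by linarith : (m (.inr 2) : ℚ) = 0)
      have hz1 : m (.inr 1) = 0 := by
        simp only [hy1, ht1, Nat.cast_zero, zero_mul, mul_zero, sub_zero, neg_zero, add_zero] at h1 h2
        have := h2 (le_antisymm h1 hc)
        exact_mod_cast le_antisymm this (by positivity)
      refine ⟨p.coeff m • ∏ j : {j : Fin n // j ≠ i₀}, MvPolynomial.X j ^ m (.inl j.1), ?_⟩
      have : powProd (genX d e P Q) (fun i => m (.inl i)) =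
          ∏ j : {j : Fin n // j ≠ i₀}, genX d e P Q j.1 ^ m (.inl j.1) := by
        rw [powProd, Fintype.prod_eq_mul_prod_subtype_ne _ i₀, hmi, pow_zero, one_mul]
      rw [hmon, hy1, hz1, ht1, this, map_smul, map_prod]
      simp
    · refine ⟨0, ?_⟩
      rw [map_zero, sub_zero, hmon]
      refine dvd_smul_of_dvd _ (Dvd.dvd.mul_right (Dvd.dvd.mul_right (Dvd.dvd.mul_right ?_ _) _) _)
      exact dvd_powProd _ (Nat.one_le_iff_ne_zero.2 hmi)
  choose! b hb using hterm
  refine ⟨∑ m ∈ p.support, b m, ?_⟩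
  rw [map_sum, ← hl.rep, LeadingFrame.aeval_gen, ← Finset.sum_sub_distrib]
  exact Finset.dvd_sum hb

/-- The polynomial ring in n - 1 variables has transcendence degree n - 1. -/
lemma not_algebraicIndependent_of_lt (i₀ : Fin n)
    (b : Fin n → MvPolynomial {j : Fin n // j ≠ i₀} k) : ¬ AlgebraicIndependent k b := by
  intro hb
  have h1 := hb.lift_cardinalMk_le_trdeg
  rw [MvPolynomial.trdeg_of_isDomain] at h1
  simp at h1
  have := i₀.pos
  omega

/-- If an exponential map of `L d e P Q` is nontrivial and has `n` algebraically independent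
invariants, then it fixes all `Xᵢ`. -/
theorem genX_invariant (h : Admissible d e P Q) (δ : ExpMap k (L d e P Q))
    (hne : ∃ a, δ.hom a ≠ C a) {f : Fin n → L d e P Q} (hf : AlgebraicIndependent k f)
    (hinv : ∀ i, δ.hom (f i) = C (f i)) (i₀ : Fin n) :
    δ.hom (genX d e P Q i₀) = C (genX d e P Q i₀) := by
  have := isDomain_of_admissible h i₀
  obtain ⟨lam, hδ⟩ := LeadingFrame.exists_isSlope (F := frame h i₀) δ hne
  choose b hb using fun i => exists_dvd_sub_aeval_of_invariant hδ (hinv i)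
  have hnb := not_algebraicIndependent_of_lt i₀ b
  rw [algebraicIndependent_iff] at hnb
  push Not at hnb
  obtain ⟨H, hH, hH0⟩ := hnb
  -- H is a relation among the residues of the invariants modulo X_{i₀}, but not among the
  -- invariants; so g is a nonzero invariant divisible by X_{i₀}.
  set g := MvPolynomial.aeval f H with hg
  have hg0 : g ≠ 0 := fun h0 => hH0 ((algebraicIndependent_iff.1 hf) H h0)
  have hginv : δ.hom g = C g := by
    have : δ.hom.comp (MvPolynomial.aeval f) =
        (CAlgHom (R := k) (A := L d e P Q)).comp (MvPolynomial.aeval f) :=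
      MvPolynomial.algHom_ext fun i => by simp [hinv]
    exact DFunLike.congr_fun this H
  have hdvd : genX d e P Q i₀ ∣ g := by
    rw [← Ideal.mem_span_singleton, ← Ideal.Quotient.eq_zero_iff_mem]
    set π := Ideal.Quotient.mkₐ k (Ideal.span {genX d e P Q i₀})
    have h1 : ∀ i, π (f i) = π (MvPolynomial.aeval (fun j => genX d e P Q j.1) (b i)) := by
      intro i
      rw [← sub_eq_zero, ← map_sub]
      exact Ideal.Quotient.eq_zero_iff_mem.2 (Ideal.mem_span_singleton.2 (hb i))
    have h2 : π g = 0 := by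
      have : π.comp (MvPolynomial.aeval f) =
          (π.comp (MvPolynomial.aeval (fun j : {j : Fin n // j ≠ i₀} => genX d e P Q j.1))).comp
            (MvPolynomial.aeval b) :=
        MvPolynomial.algHom_ext fun i => by simpa using h1 i
      have := DFunLike.congr_fun this H
      simp only [AlgHom.comp_apply] at this
      rw [hg, this, hH]; simp
    exact h2
  obtain ⟨u, hu⟩ := hdvd
  rw [hu, map_mul] at hginv
  have hx0 : genX d e P Q i₀ ≠ 0 := genX_ne_zero h i₀
  have hu0 : u ≠ 0 := by rintro rfl; exact hg0 (by rw [hu, mul_zero])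
  have hne0 : ∀ a, a ≠ 0 → δ.hom a ≠ 0 := by
    intro a ha h0
    exact ha (by rw [← δ.coeff_zero a, h0, coeff_zero])
  -- Factors of a nonzero invariant are invariant, because degrees add up over a domain.
  have hdeg := congrArg natDegree hginv
  rw [natDegree_C, natDegree_mul (hne0 _ hx0) (hne0 _ hu0)] at hdeg
  rw [eq_C_of_natDegree_eq_zero (p := δ.hom (genX d e P Q i₀)) (by omega), δ.coeff_zero]

end Invariants

end

/-! ### The fibres over Xᵢ = 0 -/

section

lemma of_adjoinRoot_injective {R : Type u} [CommRing R] {f : R[X]} (hf : f.Monic)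
    (h : 0 < f.natDegree) : Function.Injective (AdjoinRoot.of f) := by
  rw [injective_iff_map_eq_zero]
  intro a ha
  by_contra hne
  rw [← AdjoinRoot.mk_C, AdjoinRoot.mk_eq_zero] at ha
  exact hf.not_dvd_of_natDegree_lt (C_ne_zero.2 hne) (by simpa using h) ha

lemma isUnit_mk_of_span_eq_top {R : Type u} [CommRing R] {f g : R[X]}
    (h : Ideal.span {f, g} = ⊤) : IsUnit (AdjoinRoot.mk f g) := by
  obtain ⟨a, b, hab⟩ := Ideal.mem_span_pair.1 ((Ideal.eq_top_iff_one _).1 h)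
  refine IsUnit.of_mul_eq_one (AdjoinRoot.mk f b) ?_
  have := congrArg (AdjoinRoot.mk f) hab
  simpa [mul_comm] using this

variable {k : Type u} [Field k] {n : ℕ} {d e : Fin n → ℕ}
  {P : (Base k n)[X]} {Q : (Base k n)[X][X]}

/-- The hypothesis that `P` and `Q` are étale over the divisors `Xᵢ = 0`. -/
def Transversal (P : (Base k n)[X]) (Q : (Base k n)[X][X]) : Prop :=
  ∀ i : Fin n, Ideal.span {setZeroZ i P, setZeroZ i (derivative P)} = ⊤ ∧
    Ideal.span {C (setZeroZ i P), setZeroYZ i Q, setZeroYZ i (derivative Q)} = ⊤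

section Fibre

lemma X_dvd_of_setZero_eq_zero (i : Fin n) {b : Base k n} (hb : setZero k i b = 0) :
    MvPolynomial.X i ∣ b := by
  have key : ∀ b : Base k n, MvPolynomial.X i ∣
      b - MvPolynomial.rename Subtype.val (setZero k i b) := by
    intro b
    induction b using MvPolynomial.induction_on with
    | C c => simp [setZero]
    | add p q hp hq => simpa [add_sub_add_comm] using dvd_add hp hq
    | mul_X p j hp =>
      rw [map_mul, map_mul]
      by_cases hj : j = i
      · subst hj; simp [setZero]
      · have : MvPolynomial.rename Subtype.val (setZero k i (MvPolynomial.X j : Base k n)) =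
            (MvPolynomial.X j : Base k n) := by simp [setZero, hj]
        rw [this, ← sub_mul]
        exact hp.mul_right _
  simpa [hb] using key b

variable (P Q) in
/-- The coordinate ring of the locus `P = Q = 0` in the divisor `Xᵢ = 0`. -/
abbrev Fibre (i : Fin n) : Type u :=
  AdjoinRoot ((setZeroYZ i Q).map (AdjoinRoot.mk (setZeroZ i P)))

variable (P Q) in
/-- The images of the `Xⱼ` in the fibre. -/
def fibreX (i j : Fin n) : Fibre P Q i :=
  algebraMap (MvPolynomial {j : Fin n // j ≠ i} k) (Fibre P Q i)
    (setZero k i (MvPolynomial.X j))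

variable (P Q) in
/-- The image of `Z` in the fibre. -/
def fibreZ (i : Fin n) : Fibre P Q i := AdjoinRoot.of _ (AdjoinRoot.root (setZeroZ i P))

variable (P Q) in
/-- The image of `Y` in the fibre. -/
def fibreY (i : Fin n) : Fibre P Q i := AdjoinRoot.root _

lemma algebraMap_fibre (i : Fin n) (b : MvPolynomial {j : Fin n // j ≠ i} k) :
    algebraMap (MvPolynomial {j : Fin n // j ≠ i} k) (Fibre P Q i) b =
      AdjoinRoot.of _ (AdjoinRoot.of _ b) := rfl

lemma aeval_fibreX (i : Fin n) (b : Base k n) : MvPolynomial.aeval (fibreX P Q i) b =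
    algebraMap (MvPolynomial {j : Fin n // j ≠ i} k) (Fibre P Q i) (setZero k i b) := by
  have : MvPolynomial.aeval (fibreX P Q i) =
      (IsScalarTower.toAlgHom k (MvPolynomial {j : Fin n // j ≠ i} k) (Fibre P Q i)).comp
        (setZero k i) := MvPolynomial.algHom_ext fun j => by simp [fibreX]
  exact DFunLike.congr_fun this b

lemma evalXZ_fibre (i : Fin n) (p : (Base k n)[X]) :
    evalXZ (fibreX P Q i) (fibreZ P Q i) p = AdjoinRoot.of _ (AdjoinRoot.mk _ (setZeroZ i p)) := by
  have : evalXZ (fibreX P Q i) (fibreZ P Q i) = ((AdjoinRoot.of _).comp (AdjoinRoot.mk _)).comp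
      (mapRingHom (setZero k i).toRingHom) := by
    refine Polynomial.ringHom_ext (fun b => ?_) ?_
    · simp only [evalXZ_C, aeval_fibreX, algebraMap_fibre]
      simp
    · simp [fibreZ]
  exact RingHom.congr_fun this p

lemma evalXYZ_fibre (i : Fin n) (q : (Base k n)[X][X]) :
    evalXYZ (fibreX P Q i) (fibreY P Q i) (fibreZ P Q i) q =
      AdjoinRoot.mk _ ((setZeroYZ i q).map (AdjoinRoot.mk _)) := by
  have : evalXYZ (fibreX P Q i) (fibreY P Q i) (fibreZ P Q i) =
      ((AdjoinRoot.mk _).comp (mapRingHom (AdjoinRoot.mk _))).comp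
        (mapRingHom (mapRingHom (setZero k i).toRingHom)) := by
    refine Polynomial.ringHom_ext (fun b => ?_) ?_
    · rw [evalXYZ_C, evalXZ_fibre, RingHom.comp_apply, RingHom.comp_apply, coe_mapRingHom,
        coe_mapRingHom, map_C, map_C, AdjoinRoot.mk_C]
      rfl
    · simp [fibreY]
  exact RingHom.congr_fun this q

lemma fibreX_self (i : Fin n) : fibreX P Q i i = 0 := by simp [fibreX, setZero]

lemma powProd_fibreX {a : Fin n → ℕ} {i : Fin n} (ha : 1 ≤ a i) :
    powProd (fibreX P Q i) a = 0 := by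
  have := dvd_powProd (fibreX P Q i) ha
  rwa [fibreX_self, zero_dvd_iff] at this

/-- The restriction to the fibre over `Xᵢ = 0`, followed by `T = 0`. -/
def toFibre (h : Admissible d e P Q) (i : Fin n) : L d e P Q →ₐ[k] Fibre P Q i :=
  lift (fibreX P Q i) (fibreY P Q i) (fibreZ P Q i) 0
    (by rw [powProd_fibreX (h.one_le_d i), zero_mul, evalXZ_fibre, AdjoinRoot.mk_self, map_zero])
    (by rw [powProd_fibreX (h.one_le_e i), zero_mul, evalXYZ_fibre, AdjoinRoot.mk_self])

lemma setZeroZ_monic (h : Admissible d e P Q) (i : Fin n) : (setZeroZ i P).Monic :=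
  h.monic_P.map _

lemma natDegree_setZeroZ (h : Admissible d e P Q) (i : Fin n) :
    (setZeroZ i P).natDegree = P.natDegree := h.monic_P.natDegree_map _

lemma of_fibreZ_injective (h : Admissible d e P Q) (i : Fin n) :
    Function.Injective (AdjoinRoot.of (setZeroZ i P)) :=
  of_adjoinRoot_injective (setZeroZ_monic h i)
    (by rw [natDegree_setZeroZ h]; have := h.two_le_P; omega)

lemma of_fibre_injective (h : Admissible d e P Q) (i : Fin n) : Function.Injective
    (AdjoinRoot.of ((setZeroYZ i Q).map (AdjoinRoot.mk (setZeroZ i P)))) := by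
  have := (of_fibreZ_injective h i).nontrivial
  have h1 : (setZeroYZ i Q).Monic := h.monic_Q.map _
  refine of_adjoinRoot_injective (h1.map _) ?_
  rw [h1.natDegree_map, setZeroYZ, h.monic_Q.natDegree_map]
  have := h.two_le_Q; omega

lemma toFibre_genX (h : Admissible d e P Q) (i j : Fin n) :
    toFibre h i (genX d e P Q j) = fibreX P Q i j := by simp [toFibre]

lemma toFibre_aeval (h : Admissible d e P Q) (i : Fin n) (b : Base k n) :
    toFibre h i (MvPolynomial.aeval (genX d e P Q) b) =
      AdjoinRoot.of _ (AdjoinRoot.of _ (setZero k i b)) := by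
  rw [← algebraMap_fibre, ← aeval_fibreX]
  have h1 : (fun j => toFibre h i (genX d e P Q j)) = fibreX P Q i :=
    funext fun j => toFibre_genX h i j
  rw [← h1]
  exact MvPolynomial.comp_aeval_apply _ (toFibre h i) b

lemma X_dvd_of_toFibre_eq_zero (h : Admissible d e P Q) (i : Fin n) {b : Base k n}
    (hb : toFibre h i (MvPolynomial.aeval (genX d e P Q) b) = 0) : MvPolynomial.X i ∣ b := by
  rw [toFibre_aeval, map_eq_zero_iff _ (of_fibre_injective h i),
    map_eq_zero_iff _ (of_fibreZ_injective h i)] at hb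
  exact X_dvd_of_setZero_eq_zero i hb

/-- The class of `Z` does not satisfy a linear equation over `Xᵢ = 0`. -/
lemma X_dvd_of_genX_dvd_sub (h : Admissible d e P Q) (i : Fin n) {c b : Base k n}
    (hb : genX d e P Q i ∣ MvPolynomial.aeval (genX d e P Q) c * genZ d e P Q -
      MvPolynomial.aeval (genX d e P Q) b) : MvPolynomial.X i ∣ c := by
  obtain ⟨a, ha⟩ := hb
  have h1 := congrArg (toFibre h i) ha
  rw [map_mul, toFibre_genX, fibreX_self, zero_mul, map_sub, map_mul, toFibre_aeval,
    toFibre_aeval, show toFibre h i (genZ d e P Q) = AdjoinRoot.of _ (AdjoinRoot.root _) by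
      simp [toFibre, fibreZ], ← map_mul, ← map_sub,
    map_eq_zero_iff _ (of_fibre_injective h i), ← AdjoinRoot.mk_C, ← AdjoinRoot.mk_C,
    ← AdjoinRoot.mk_X, ← map_mul, ← map_sub, AdjoinRoot.mk_eq_zero] at h1
  by_contra hc
  -- Here deg P ≥ 2 enters: a nonzero linear polynomial is not a multiple of P on Xᵢ = 0.
  have hlt : (C (setZero k i c) * X - C (setZero k i b)).natDegree < (setZeroZ i P).natDegree := by
    rw [natDegree_setZeroZ h]
    refine lt_of_le_of_lt ?_ h.two_le_P
    compute_degree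
  refine (setZeroZ_monic h i).not_dvd_of_natDegree_lt (fun h0 => ?_) hlt h1
  have := congrArg (fun q => q.coeff 1) h0
  simp [coeff_C] at this
  exact hc (X_dvd_of_setZero_eq_zero i this)

/-- On the fibre P = Q = 0, so the two unit ideal hypotheses make P' and Q' invertible there. -/
lemma isUnit_toFibre (h : Admissible d e P Q) (hT : Transversal P Q) (i : Fin n) :
    IsUnit (toFibre h i (evalXYZ (genX d e P Q) (genY d e P Q) (genZ d e P Q) (derivative Q) *
      evalXZ (genX d e P Q) (genZ d e P Q) (derivative P))) := by
  have h1 : (fun j => toFibre h i (genX d e P Q j)) = fibreX P Q i := by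
    funext j; exact toFibre_genX h i j
  rw [map_mul, map_evalXZ, map_evalXYZ, h1,
    show toFibre h i (genZ d e P Q) = fibreZ P Q i by simp [toFibre],
    show toFibre h i (genY d e P Q) = fibreY P Q i by simp [toFibre], evalXZ_fibre, evalXYZ_fibre]
  refine IsUnit.mul ?_ ((isUnit_mk_of_span_eq_top (hT i).1).map _)
  refine isUnit_mk_of_span_eq_top ?_
  have h2 := congrArg (Ideal.map (mapRingHom (AdjoinRoot.mk (setZeroZ i P)))) (hT i).2
  rw [Ideal.map_top, Ideal.map_span, Set.image_insert_eq, Set.image_insert_eq,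
    Set.image_singleton] at h2
  simpa using h2

/-- Divisibility by a monomial in the `Xᵢ` can be tested after multiplication with an element that
is invertible on all fibres. -/
lemma powProd_dvd (h : Admissible d e P Q) {u : L d e P Q} (hu : ∀ i, IsUnit (toFibre h i u))
    (v : Fin n → ℕ) : ∀ (f : Base k n) (a : L d e P Q),
    powProd (genX d e P Q) v * a = MvPolynomial.aeval (genX d e P Q) f * u →
    powProd MvPolynomial.X v ∣ f := by
  generalize hN : ∑ i, v i = N
  induction N generalizing v with
  | zero =>
    intro f a _
    have : v = 0 := funext fun i => by simpa using (Finset.sum_eq_zero_iff.1 hN) i (by simp)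
    subst this
    simp [powProd]
  | succ N ih =>
    intro f a hfa
    obtain ⟨i, -, hi⟩ : ∃ i ∈ Finset.univ, v i ≠ 0 := by
      by_contra! hcon
      rw [Finset.sum_eq_zero hcon] at hN
      omega
    have := isDomain_of_admissible h i
    set v' : Fin n → ℕ := v - Pi.single i 1 with hv'
    have hv : v = Pi.single i 1 + v' := by
      funext j
      by_cases hj : j = i
      · subst hj; simp [hv']; omega
      · simp [hv', hj]
    have hs : ∀ {M : Type u} [CommMonoid M] (x : Fin n → M), powProd x v = x i * powProd x v' := by
      intro M _ x
      conv_lhs => rw [hv, powProd_add]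
      congr 1
      rw [powProd, Finset.prod_eq_single i] <;> simp +contextual
    -- The left side vanishes on the fibre over Xᵢ = 0, where u is a unit; so f vanishes there and
    -- one factor Xᵢ can be cancelled.
    have hf : MvPolynomial.X i ∣ f := by
      apply X_dvd_of_toFibre_eq_zero h i
      have h1 := congrArg (toFibre h i) hfa
      rw [hs, mul_assoc, map_mul, toFibre_genX, fibreX_self, zero_mul, eq_comm, map_mul] at h1
      exact ((hu i).mul_left_eq_zero).1 h1
    obtain ⟨f', rfl⟩ := hf
    rw [hs]
    refine mul_dvd_mul_left _ (ih v' ?_ f' a ?_)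
    · have : ∑ j, v j = ∑ j, (Pi.single i 1 : Fin n → ℕ) j + ∑ j, v' j := by
        rw [← Finset.sum_add_distrib]; exact Finset.sum_congr rfl fun j _ => congrFun hv j
      rw [hN, Finset.sum_pi_single'] at this
      simp at this; omega
    · apply mul_left_cancel₀ (genX_ne_zero h i)
      rw [hs, map_mul, MvPolynomial.aeval_X] at hfa
      rw [← mul_assoc, hfa, mul_assoc]

end Fibre

end

/-! ### L as a subring of k(X)[Z], and the standard exponential map -/

section

variable {k : Type u} [Field k] {n : ℕ} {d e : Fin n → ℕ}
  {P : (Base k n)[X]} {Q : (Base k n)[X][X]}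

section Denominators

variable (d e P Q) in
/-- The elements of `L d e P Q` which become polynomials in the `Xᵢ` and `Z` after multiplication
with a monomial in the `Xᵢ`. -/
def denomSubalgebra : Subalgebra k (L d e P Q) where
  carrier := {a | ∃ (v : Fin n → ℕ) (p : (Base k n)[X]), powProd (genX d e P Q) v * a =
    evalXZ (genX d e P Q) (genZ d e P Q) p}
  mul_mem' := by
    rintro a b ⟨v, p, h⟩ ⟨v', p', h'⟩
    exact ⟨v + v', p * p', by rw [map_mul, ← h, ← h', powProd_add]; ring⟩
  add_mem' := by
    rintro a b ⟨v, p, h⟩ ⟨v', p', h'⟩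
    refine ⟨v + v', C (powProd MvPolynomial.X v') * p + C (powProd MvPolynomial.X v) * p', ?_⟩
    rw [map_add, map_mul, map_mul, ← h, ← h', powProd_add, evalXZ_C, evalXZ_C, map_powProd,
      map_powProd]
    simp only [MvPolynomial.aeval_X]
    ring
  algebraMap_mem' c := ⟨0, C (algebraMap k _ c), by
    rw [evalXZ_C, AlgHom.commutes]; simp [powProd]⟩

lemma denomSubalgebra_eq_top : denomSubalgebra d e P Q = ⊤ := by
  have hX : ∀ i, genX d e P Q i ∈ denomSubalgebra d e P Q := fun i =>
    ⟨0, C (MvPolynomial.X i), by simp [powProd]⟩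
  have hZ : genZ d e P Q ∈ denomSubalgebra d e P Q := ⟨0, X, by simp [powProd]⟩
  have hY : genY d e P Q ∈ denomSubalgebra d e P Q := ⟨d, P, relation_genY d e P Q⟩
  have hT : genT d e P Q ∈ denomSubalgebra d e P Q := by
    have : evalXYZ (genX d e P Q) (genY d e P Q) (genZ d e P Q) Q * 1 ∈
        Subalgebra.toSubmodule (denomSubalgebra d e P Q) := by
      refine evalXYZ_mul_mem _ _ _ _ _ (fun a j i => ?_) Q
      rw [mul_one, Subalgebra.mem_toSubmodule]
      exact mul_mem (mul_mem (prod_mem fun i _ => pow_mem (hX i) _) (pow_mem hY _)) (pow_mem hZ _)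
    obtain ⟨v, p, h⟩ := this
    exact ⟨v + e, p, by rw [powProd_add, mul_assoc, relation_genT, ← h, mul_one]⟩
  rw [eq_top_iff, ← adjoin_generators d e P Q, Algebra.adjoin_le_iff]
  rintro a (⟨i, rfl⟩ | rfl | rfl | rfl)
  exacts [hX i, hY, hZ, hT]

variable (d e P Q) in
lemma exists_powProd_mul_eq (a : L d e P Q) :
    ∃ (v : Fin n → ℕ) (p : (Base k n)[X]),
    powProd (genX d e P Q) v * a = evalXZ (genX d e P Q) (genZ d e P Q) p :=
  (denomSubalgebra_eq_top (d := d) (e := e) (P := P) (Q := Q) ▸ Algebra.mem_top :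
    a ∈ denomSubalgebra d e P Q)

end Denominators

section Generic

variable (k n) in
/-- The field `k(X₁, …, Xₙ)`. -/
abbrev Frac : Type u := FractionRing (Base k n)

variable (k n) in
/-- The images of the `Xᵢ` in `k(X)[Z]`. -/
def fracX (i : Fin n) : (Frac k n)[X] := C (algebraMap (Base k n) (Frac k n) (MvPolynomial.X i))

lemma aeval_fracX (b : Base k n) : MvPolynomial.aeval (fracX k n) b =
    C (algebraMap (Base k n) (Frac k n) b) := by
  have : MvPolynomial.aeval (fracX k n) = ((CAlgHom (R := k) (A := Frac k n)).comp
      (IsScalarTower.toAlgHom k (Base k n) (Frac k n))) :=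
    MvPolynomial.algHom_ext fun i => by simp [fracX]
  exact DFunLike.congr_fun this b

lemma evalXZ_fracX (p : (Base k n)[X]) :
    evalXZ (fracX k n) X p = p.map (algebraMap (Base k n) (Frac k n)) := by
  have : evalXZ (fracX k n) X = mapRingHom (algebraMap (Base k n) (Frac k n)) :=
    Polynomial.ringHom_ext (fun b => by simp [aeval_fracX]) (by simp)
  exact RingHom.congr_fun this p

lemma powProd_X_ne_zero (v : Fin n → ℕ) : (powProd MvPolynomial.X v : Base k n) ≠ 0 :=
  Finset.prod_ne_zero_iff.2 fun i _ => pow_ne_zero _ (MvPolynomial.X_ne_zero i)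

lemma powProd_fracX (v : Fin n → ℕ) : powProd (fracX k n) v =
    C (algebraMap (Base k n) (Frac k n) (powProd MvPolynomial.X v)) := by
  rw [← aeval_fracX, map_powProd]
  simp

lemma powProd_fracX_mul (v : Fin n → ℕ) (q : (Frac k n)[X]) : powProd (fracX k n) v *
    (C (algebraMap (Base k n) (Frac k n) (powProd MvPolynomial.X v))⁻¹ * q) = q := by
  rw [powProd_fracX, ← mul_assoc, ← C_mul, mul_inv_cancel₀, C_1, one_mul]
  exact (map_ne_zero_iff _ (IsFractionRing.injective _ _)).2 (powProd_X_ne_zero v)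

variable (d e P Q) in
/-- The embedding of `L d e P Q` in `k(X)[Z]`. -/
def toGeneric : L d e P Q →ₐ[k] (Frac k n)[X] :=
  lift (fracX k n) _ X _ (powProd_fracX_mul d _) (powProd_fracX_mul e _)

@[simp] lemma toGeneric_genX (i : Fin n) : toGeneric d e P Q (genX d e P Q i) = fracX k n i := by
  simp [toGeneric]

@[simp] lemma toGeneric_genZ : toGeneric d e P Q (genZ d e P Q) = X := by simp [toGeneric]

lemma toGeneric_evalXZ (p : (Base k n)[X]) :
    toGeneric d e P Q (evalXZ (genX d e P Q) (genZ d e P Q) p) =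
      p.map (algebraMap (Base k n) (Frac k n)) := by
  rw [map_evalXZ, toGeneric_genZ, ← evalXZ_fracX]
  simp only [toGeneric_genX]

lemma toGeneric_aeval (b : Base k n) : toGeneric d e P Q (MvPolynomial.aeval (genX d e P Q) b) =
    C (algebraMap (Base k n) (Frac k n) b) := by
  rw [← evalXZ_C (genX d e P Q) (genZ d e P Q), toGeneric_evalXZ, map_C]

variable (d e P Q) in
lemma aeval_genX_injective : Function.Injective
    (MvPolynomial.aeval (genX d e P Q) : Base k n →ₐ[k] L d e P Q) := by
  rw [injective_iff_map_eq_zero]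
  intro b hb
  have := toGeneric_aeval (d := d) (e := e) (P := P) (Q := Q) b
  rw [hb, map_zero, eq_comm, C_eq_zero, map_eq_zero_iff _ (IsFractionRing.injective _ _)] at this
  exact this

variable (d e P Q) in
lemma evalXZ_injective : Function.Injective (evalXZ (k := k) (genX d e P Q) (genZ d e P Q)) := by
  rw [injective_iff_map_eq_zero]
  intro p hp
  have := toGeneric_evalXZ (d := d) (e := e) (P := P) (Q := Q) p
  rw [hp, map_zero, eq_comm, Polynomial.map_eq_zero_iff (IsFractionRing.injective _ _)] at this
  exact this

lemma powProd_genX (v : Fin n → ℕ) : powProd (genX d e P Q) v =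
    MvPolynomial.aeval (genX d e P Q) (powProd MvPolynomial.X v : Base k n) := by
  rw [map_powProd]; simp

lemma powProd_genX_ne_zero (v : Fin n → ℕ) : powProd (genX d e P Q) v ≠ 0 := by
  rw [powProd_genX, Ne, map_eq_zero_iff _ (aeval_genX_injective d e P Q)]
  exact powProd_X_ne_zero v

lemma exists_aeval_eq_of_powProd_mul (h : Admissible d e P Q) [IsDomain (L d e P Q)]
    {a : L d e P Q} {v : Fin n → ℕ} {b : Base k n}
    (hab : powProd (genX d e P Q) v * a = MvPolynomial.aeval (genX d e P Q) b) :
    ∃ b : Base k n, a = MvPolynomial.aeval (genX d e P Q) b := by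
  obtain ⟨b', rfl⟩ := powProd_dvd h (u := 1) (by simp) v b a (by rw [hab, mul_one])
  refine ⟨b', mul_left_cancel₀ (powProd_genX_ne_zero v) ?_⟩
  rw [hab, map_mul, powProd_genX]

/-- The intersection of L with k(X) is k[X]: denominators are monomials in the Xᵢ, and they cancel
because k[X]/(Xᵢ) injects into the fibre. -/
lemma exists_aeval_eq_of_toGeneric (h : Admissible d e P Q) [IsDomain (L d e P Q)]
    {a : L d e P Q} {β : Frac k n} (ha : toGeneric d e P Q a = C β) :
    ∃ b : Base k n, a = MvPolynomial.aeval (genX d e P Q) b := by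
  obtain ⟨v, p, hp⟩ := exists_powProd_mul_eq d e P Q a
  have h1 := congrArg (toGeneric d e P Q) hp
  rw [map_mul, toGeneric_evalXZ, ha, powProd_genX, toGeneric_aeval, ← C_mul] at h1
  have h2 := congrArg natDegree h1
  rw [natDegree_C, natDegree_map_eq_of_injective (IsFractionRing.injective _ _), eq_comm] at h2
  rw [eq_C_of_natDegree_eq_zero h2, evalXZ_C] at hp
  exact exists_aeval_eq_of_powProd_mul h hp

end Generic

section StandardExp

lemma coeff_coeff_aeval_X_add_C {R : Type v} [CommRing R] (p : R[X]) (i j : ℕ) :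
    ((aeval (X + C X : R[X][X]) p).coeff j).coeff i = ((i + j).choose j : R) * p.coeff (i + j) := by
  induction p using Polynomial.induction_on' with
  | add p q hp hq => rw [map_add, coeff_add, coeff_add, hp, hq, coeff_add, mul_add]
  | monomial m a =>
    rw [aeval_monomial, coeff_monomial,
      show algebraMap R R[X][X] a = C (C a) from rfl, coeff_C_mul, coeff_X_add_C_pow,
      coeff_C_mul, ← C_eq_natCast, coeff_mul_C, coeff_X_pow]
    by_cases hij : m = i + j
    · subst hij; simp [mul_comm]
    · rw [if_neg hij]
      by_cases hj : j ≤ m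
      · rw [if_neg (by omega)]; simp
      · rw [Nat.choose_eq_zero_of_lt (by omega)]; simp

lemma C_evalXZ {R : Type v} [CommRing R] [Algebra k R] (x : Fin n → R) (z : R)
    (p : (Base k n)[X]) : (C (evalXZ x z p) : R[X]) = evalXZ (fun i => C (x i)) (C z) p :=
  map_evalXZ (CAlgHom (R := k) (A := R)) x z p

lemma C_evalXYZ {R : Type v} [CommRing R] [Algebra k R] (x : Fin n → R) (y z : R)
    (q : (Base k n)[X][X]) :
    (C (evalXYZ x y z q) : R[X]) = evalXYZ (fun i => C (x i)) (C y) (C z) q :=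
  map_evalXYZ (CAlgHom (R := k) (A := R)) x y z q

lemma C_aeval {R : Type v} [CommRing R] [Algebra k R] (x : Fin n → R) (b : Base k n) :
    (C (MvPolynomial.aeval x b) : R[X]) = MvPolynomial.aeval (fun i => C (x i)) b := by
  rw [← evalXZ_C x 0, C_evalXZ, evalXZ_C]

lemma C_powProd {R : Type v} [CommRing R] (x : Fin n → R) (a : Fin n → ℕ) :
    (C (powProd x a) : R[X]) = powProd (fun i => C (x i)) a :=
  map_powProd C x a

lemma exists_translate_C {R : Type v} [CommRing R] [Algebra k R] {x : Fin n → R} {y z t : R}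
    (hy : powProd x d * y = evalXZ x z P) (ht : powProd x e * t = evalXYZ x y z Q) :
    ∃ y' t' : R[X],
      powProd (fun i => C (x i)) d * y' =
        evalXZ (fun i => C (x i)) (C z + C (powProd x d * powProd x e) * X) P ∧
      powProd (fun i => C (x i)) e * t' =
        evalXYZ (fun i => C (x i)) y' (C z + C (powProd x d * powProd x e) * X) Q := by
  have hY := congrArg C hy
  have hT := congrArg C ht
  rw [C_mul, C_evalXZ, C_powProd] at hY
  rw [C_mul, C_evalXYZ, C_powProd] at hT
  obtain ⟨y', t', hy', ht', -⟩ :=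
    exists_translate P Q _ (q := 1) X hY hT (one_dvd _) (one_dvd _)
  rw [← C_powProd, ← C_powProd, ← C_mul] at hy' ht'
  rw [C_powProd] at hy' ht'
  exact ⟨y', t', hy', ht'⟩

lemma mapAlgHom_comp_translate {A : Type v} [CommRing A] [Algebra k A] {δ : A →ₐ[k] A[X]}
    {z g : A} (hz : δ z = C z + C g * X) (hg : δ g = C g) :
    mapAlgHom δ (δ z) = aeval (X + C X : A[X][X]) (δ z) := by
  rw [hz, map_add, map_add, map_mul, map_mul]
  simp [hz, hg]
  ring

lemma evalXZ_eq_comp {R : Type v} [CommRing R] [Algebra k R] (x : Fin n → R) (z : R[X])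
    (p : (Base k n)[X]) : evalXZ (fun i => C (x i)) z p =
      (p.map (MvPolynomial.aeval x : Base k n →ₐ[k] R).toRingHom).comp z := by
  have : evalXZ (fun i => C (x i)) z = (compRingHom z).comp
      (mapRingHom (MvPolynomial.aeval x : Base k n →ₐ[k] R).toRingHom) :=
    Polynomial.ringHom_ext (fun b => by simp only [evalXZ_C, ← C_aeval, RingHom.comp_apply, coe_compRingHom, coe_mapRingHom, map_C, C_comp]; rfl) (by simp)
  exact RingHom.congr_fun this p

variable (d e P Q) in
lemma exists_standardHom : ∃ δ : L d e P Q →ₐ[k] (L d e P Q)[X],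
    (∀ i, δ (genX d e P Q i) = C (genX d e P Q i)) ∧
    δ (genZ d e P Q) = C (genZ d e P Q) +
      C (powProd (genX d e P Q) d * powProd (genX d e P Q) e) * X := by
  obtain ⟨y, t, hy, ht⟩ := exists_translate_C (relation_genY d e P Q) (relation_genT d e P Q)
  exact ⟨lift _ y _ t hy ht, fun i => lift_genX _ _ _ _ _ _ i, lift_genZ _ _ _ _ _ _⟩

/-- The axioms are equalities of homomorphisms, and by `hext` these need checking only on the xᵢ and
on z. There they hold because the step g of the translation is itself invariant. -/
lemma exists_expMap_of_translate {A : Type v} [CommRing A] [IsDomain A] [Algebra k A]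
    {x : Fin n → A} {z g : A} (hx : ∀ i, x i ≠ 0)
    (hext : ∀ {R : Type v} [CommRing R] [Algebra k R] (f f' : A →ₐ[k] R),
      (∀ i, IsLeftRegular (f (x i))) → (∀ i, f (x i) = f' (x i)) → f z = f' z → f = f')
    (δ : A →ₐ[k] A[X]) (hX : ∀ i, δ (x i) = C (x i)) (hZ : δ z = C z + C g * X)
    (hg : δ g = C g) : ∃ δ' : ExpMap k A, δ'.hom = δ := by
  refine ⟨⟨δ, fun a => ?_, fun a i j => ?_⟩, rfl⟩
  · have : ((aeval (0 : A)).restrictScalars k).comp δ = AlgHom.id k _ := by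
      refine hext _ _ (fun i => ?_) (fun i => ?_) ?_
      · refine (IsRegular.of_ne_zero ?_).left
        simpa [hX] using hx i
      · simp [hX]
      · simp [hZ]
    have := DFunLike.congr_fun this a
    rw [coeff_zero_eq_aeval_zero]
    simpa using this
  · have : (mapAlgHom δ).comp δ =
        ((aeval (X + C X : A[X][X])).restrictScalars k).comp δ := by
      refine hext _ _ (fun i => ?_) (fun i => ?_) ?_
      · refine (IsRegular.of_ne_zero ?_).left
        simpa [hX] using hx i
      · simp [hX]
      · exact mapAlgHom_comp_translate hZ hg
    have := congrArg (fun q : A[X][X] => (q.coeff j).coeff i) (DFunLike.congr_fun this a)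
    simpa [coeff_coeff_aeval_X_add_C] using this

variable (d e P Q) in
/-- The standard exponential map, `Z ↦ Z + X^[d] X^[e] U`. -/
lemma exists_standardExp [IsDomain (L d e P Q)] : ∃ δ : ExpMap k (L d e P Q),
    (∀ i, δ.hom (genX d e P Q i) = C (genX d e P Q i)) ∧
    δ.hom (genZ d e P Q) = C (genZ d e P Q) +
      C (powProd (genX d e P Q) d * powProd (genX d e P Q) e) * X := by
  obtain ⟨δ, hX, hZ⟩ := exists_standardHom d e P Q
  have hx0 : ∀ i, genX d e P Q i ≠ 0 := fun i => by
    have := powProd_genX_ne_zero (d := d) (e := e) (P := P) (Q := Q) (Pi.single i 1)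
    intro h0
    apply this
    have h1 := dvd_powProd (genX d e P Q) (a := Pi.single i 1) (i := i) (by simp)
    rwa [h0, zero_dvd_iff] at h1
  have hC : ∀ v, δ (powProd (genX d e P Q) v) = C (powProd (genX d e P Q) v) := fun v => by
    rw [map_powProd, C_powProd]; simp only [hX]
  obtain ⟨δ', rfl⟩ := exists_expMap_of_translate hx0
    (fun f f' h₁ h₂ h₃ => algHom_ext_of_isLeftRegular h₁ h₂ h₃) δ hX hZ
    (by rw [map_mul, hC, hC, C_mul])
  exact ⟨δ', hX, hZ⟩

/-- The invariants of the standard exponential map are the polynomials in the `Xᵢ`. -/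
lemma exists_aeval_eq_of_invariant (h : Admissible d e P Q) [IsDomain (L d e P Q)]
    {δ : ExpMap k (L d e P Q)} (hX : ∀ i, δ.hom (genX d e P Q i) = C (genX d e P Q i))
    (hZ : δ.hom (genZ d e P Q) = C (genZ d e P Q) +
      C (powProd (genX d e P Q) d * powProd (genX d e P Q) e) * X)
    {a : L d e P Q} (ha : δ.hom a = C a) : ∃ b : Base k n, a = MvPolynomial.aeval (genX d e P Q) b := by
  obtain ⟨v, p, hp⟩ := exists_powProd_mul_eq d e P Q a
  have h1 := congrArg δ.hom hp
  rw [map_mul, map_powProd, map_evalXZ, ha] at h1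
  simp only [hX, hZ] at h1
  rw [← C_powProd, ← C_mul, hp] at h1
  set g := powProd (genX d e P Q) d * powProd (genX d e P Q) e with hg
  have hg0 : g ≠ 0 := mul_ne_zero (powProd_genX_ne_zero d) (powProd_genX_ne_zero e)
  rw [evalXZ_eq_comp] at h1
  have h3 := congrArg natDegree h1
  -- Substituting Z + gU with g ≠ 0 for Z preserves the degree of p, and the result is constant in
  -- U; so p does not involve Z.
  rw [natDegree_C, natDegree_comp, natDegree_C_add, natDegree_C_mul_X _ hg0, mul_one,
    natDegree_map_eq_of_injective (aeval_genX_injective d e P Q), eq_comm] at h3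
  rw [eq_C_of_natDegree_eq_zero (p := p) (by omega), evalXZ_C] at hp
  exact exists_aeval_eq_of_powProd_mul h hp

end StandardExp

end

/-! ### Isomorphisms and the comparison of exponents -/

section

section Transport

variable {k : Type u} [Field k] {A : Type v} {A' : Type w} [CommRing A] [CommRing A']
  [Algebra k A] [Algebra k A']

/-- The transport of an exponential map along an isomorphism. -/
def ExpMap.transport (δ : ExpMap k A) (φ : A ≃ₐ[k] A') : ExpMap k A' where
  hom := (mapAlgHom (φ : A →ₐ[k] A')).comp (δ.hom.comp (φ.symm : A' →ₐ[k] A))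
  coeff_zero a := by simp [δ.coeff_zero]
  coeff_coeff a i j := by simp [δ.coeff_coeff]

lemma ExpMap.transport_coeff (δ : ExpMap k A) (φ : A ≃ₐ[k] A') (a : A') (i : ℕ) :
    ((δ.transport φ).hom a).coeff i = φ ((δ.hom (φ.symm a)).coeff i) := by
  simp [transport]

lemma ExpMap.transport_eq_C_iff (δ : ExpMap k A) (φ : A ≃ₐ[k] A') (a : A') :
    (δ.transport φ).hom a = C a ↔ δ.hom (φ.symm a) = C (φ.symm a) := by
  simp only [Polynomial.ext_iff, transport_coeff, coeff_C]
  refine forall_congr' fun i => ?_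
  rw [← φ.injective.eq_iff (a := (δ.hom (φ.symm a)).coeff i)]
  split_ifs <;> simp

lemma coeff_one_mul (p q : A[X]) :
    (p * q).coeff 1 = p.coeff 0 * q.coeff 1 + p.coeff 1 * q.coeff 0 := by
  rw [coeff_mul, Finset.Nat.antidiagonal_succ]; simp

/-- The chain rule for the linear coefficient of an exponential map, modulo the derivatives of the
coefficients. -/
lemma ExpMap.exists_coeff_one_eval₂ {R : Type*} [CommRing R] (δ : ExpMap k A) (ψ : R →+* A) (z g : A)
    (h : ∀ r, g ∣ (δ.hom (ψ r)).coeff 1) (p : R[X]) :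
    ∃ w, (δ.hom (eval₂ ψ z p)).coeff 1 =
      eval₂ ψ z (derivative p) * (δ.hom z).coeff 1 + g * w := by
  induction p using Polynomial.induction_on with
  | C a =>
    obtain ⟨w, hw⟩ := h a
    exact ⟨w, by simp [hw]⟩
  | add p q hp hq =>
    obtain ⟨w, hw⟩ := hp
    obtain ⟨w', hw'⟩ := hq
    exact ⟨w + w', by simp only [eval₂_add, map_add, coeff_add, hw, hw']; ring⟩
  | monomial m a hm =>
    obtain ⟨w, hw⟩ := hm
    refine ⟨w * z, ?_⟩
    rw [pow_succ, ← mul_assoc]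
    generalize C a * X ^ m = q at hw ⊢
    rw [eval₂_mul, map_mul, coeff_one_mul, hw, δ.coeff_zero,
      eval₂_X, δ.coeff_zero, derivative_mul, eval₂_add, eval₂_mul, eval₂_mul, derivative_X,
      eval₂_one, eval₂_X]
    ring

lemma ExpMap.hom_aeval {δ : ExpMap k A} {n : ℕ} {x : Fin n → A}
    (hx : ∀ i, δ.hom (x i) = C (x i)) (b : Base k n) :
    δ.hom (MvPolynomial.aeval x b) = C (MvPolynomial.aeval x b) := by
  rw [C_aeval, MvPolynomial.comp_aeval_apply]
  simp only [hx]

lemma ExpMap.hom_powProd {δ : ExpMap k A} {n : ℕ} {x : Fin n → A}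
    (hx : ∀ i, δ.hom (x i) = C (x i)) (v : Fin n → ℕ) :
    δ.hom (powProd x v) = C (powProd x v) := by
  rw [C_powProd, map_powProd]
  simp only [hx]

/-- Differentiating the two relations. -/
lemma ExpMap.exists_powProd_mul_coeff_one {n : ℕ} {d e : Fin n → ℕ} {P : (Base k n)[X]}
    {Q : (Base k n)[X][X]} {δ : ExpMap k A} {x : Fin n → A}
    (hx : ∀ i, δ.hom (x i) = C (x i)) {y z t : A} (hy : powProd x d * y = evalXZ x z P)
    (ht : powProd x e * t = evalXYZ x y z Q) :
    ∃ w, powProd x (d + e) * (δ.hom t).coeff 1 = (δ.hom z).coeff 1 *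
      (evalXYZ x y z (derivative Q) * evalXZ x z (derivative P) + powProd x d * w) := by
  have hP : ∀ p : (Base k n)[X], (δ.hom (evalXZ x z p)).coeff 1 =
      evalXZ x z (derivative p) * (δ.hom z).coeff 1 := fun p => by
    -- The coefficients of P are invariant, so the chain rule holds with error term 0. Those of Q
    -- are polynomials in Z, whose linear coefficients are multiples of that of z; this gives the
    -- error term for Q below.
    obtain ⟨w, hw⟩ := δ.exists_coeff_one_eval₂
      (MvPolynomial.aeval x : Base k n →ₐ[k] A).toRingHom z 0
      (fun r => by
        change 0 ∣ (δ.hom (MvPolynomial.aeval x r)).coeff 1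
        rw [ExpMap.hom_aeval hx, coeff_C_of_ne_zero one_ne_zero]) p
    rwa [zero_mul, add_zero] at hw
  obtain ⟨w, hw⟩ := δ.exists_coeff_one_eval₂ (evalXZ x z) y ((δ.hom z).coeff 1)
    (fun r => by rw [hP]; exact dvd_mul_left _ _) Q
  change (δ.hom (evalXYZ x y z Q)).coeff 1 = evalXYZ x y z (derivative Q) * _ + _ at hw
  have h1 := congrArg (fun a => (δ.hom a).coeff 1) hy
  have h2 := congrArg (fun a => (δ.hom a).coeff 1) ht
  simp only [map_mul, ExpMap.hom_powProd hx, coeff_C_mul] at h1 h2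
  rw [hP] at h1
  rw [hw] at h2
  refine ⟨w, ?_⟩
  rw [powProd_add, mul_assoc, h2, mul_add, mul_left_comm, h1]
  ring

end Transport

variable {k : Type u} [Field k] {n : ℕ} {d e d' e' : Fin n → ℕ}
  {P P' : (Base k n)[X]} {Q Q' : (Base k n)[X][X]}

section Isomorphism

/-- An isomorphism maps the subalgebra generated by the `Xᵢ` to itself. -/
lemma exists_aeval_eq_symm_genX (h : Admissible d e P Q) (h' : Admissible d' e' P' Q')
    (φ : L d e P Q ≃ₐ[k] L d' e' P' Q') (i : Fin n) :
    ∃ b : Base k n, φ.symm (genX d' e' P' Q' i) = MvPolynomial.aeval (genX d e P Q) b := by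
  have := isDomain_of_admissible h i
  have := isDomain_of_admissible h' i
  obtain ⟨δ, hX, hZ⟩ := exists_standardExp d e P Q
  have hinv := genX_invariant h' (δ.transport φ) ⟨φ (genZ d e P Q), fun hc => ?_⟩
    (f := fun j => φ (genX d e P Q j)) ?_ (fun j => ?_) i
  · rw [ExpMap.transport_eq_C_iff] at hinv
    exact exists_aeval_eq_of_invariant h hX hZ hinv
  · rw [ExpMap.transport_eq_C_iff, φ.symm_apply_apply, hZ, add_eq_left] at hc
    have := congrArg (coeff · 1) hc
    simp only [coeff_mul_X, coeff_C_zero, coeff_zero] at this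
    exact mul_ne_zero (powProd_genX_ne_zero d) (powProd_genX_ne_zero e) this
  · have : AlgebraicIndependent k (genX d e P Q) := aeval_genX_injective d e P Q
    exact this.map' (f := (φ : L d e P Q →ₐ[k] L d' e' P' Q')) φ.injective
  · rw [ExpMap.transport_eq_C_iff, φ.symm_apply_apply, hX]

/-- The images of the Xᵢ under an isomorphism lie in k[X]: this is `exists_aeval_eq_symm_genX` for
the inverse isomorphism. -/
lemma exists_baseHom (h : Admissible d e P Q) (h' : Admissible d' e' P' Q')
    (φ : L d e P Q ≃ₐ[k] L d' e' P' Q') : ∃ σ : Base k n →ₐ[k] Base k n, ∀ b,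
      φ (MvPolynomial.aeval (genX d e P Q) b) = MvPolynomial.aeval (genX d' e' P' Q') (σ b) := by
  choose β hβ using exists_aeval_eq_symm_genX h' h φ.symm
  refine ⟨MvPolynomial.aeval β, fun b => ?_⟩
  have : (φ : L d e P Q →ₐ[k] L d' e' P' Q').comp (MvPolynomial.aeval (genX d e P Q)) =
      (MvPolynomial.aeval (genX d' e' P' Q')).comp (MvPolynomial.aeval β) :=
    MvPolynomial.algHom_ext fun i => by simpa using hβ i
  exact DFunLike.congr_fun this b

/-- The automorphism of `k[X₁, …, Xₙ]` induced by an isomorphism. -/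
lemma exists_baseEquiv (h : Admissible d e P Q) (h' : Admissible d' e' P' Q')
    (φ : L d e P Q ≃ₐ[k] L d' e' P' Q') : ∃ σ : Base k n ≃ₐ[k] Base k n, ∀ b,
      φ (MvPolynomial.aeval (genX d e P Q) b) = MvPolynomial.aeval (genX d' e' P' Q') (σ b) := by
  obtain ⟨σ, hσ⟩ := exists_baseHom h h' φ
  obtain ⟨τ, hτ⟩ := exists_baseHom h' h φ.symm
  refine ⟨AlgEquiv.ofAlgHom σ τ (AlgHom.ext fun b => ?_) (AlgHom.ext fun b => ?_), hσ⟩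
  · apply aeval_genX_injective d' e' P' Q'
    simp [← hσ, ← hτ]
  · apply aeval_genX_injective d e P Q
    simp [← hσ, ← hτ]

/-- The image of `Z` under an isomorphism is linear in `Z`. -/
lemma exists_linear_symm_genZ (h : Admissible d e P Q) [IsDomain (L d e P Q)]
    (φ : L d e P Q ≃ₐ[k] L d' e' P' Q') {σ : Base k n ≃ₐ[k] Base k n}
    (hσ : ∀ b, φ (MvPolynomial.aeval (genX d e P Q) b) =
      MvPolynomial.aeval (genX d' e' P' Q') (σ b)) :
    ∃ a b c : Base k n, a ≠ 0 ∧ c ≠ 0 ∧ IsRelPrime a c ∧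
      MvPolynomial.aeval (genX d e P Q) c * φ.symm (genZ d' e' P' Q') =
        MvPolynomial.aeval (genX d e P Q) a * genZ d e P Q +
          MvPolynomial.aeval (genX d e P Q) b := by
  have hσ' : ∀ b, φ.symm (MvPolynomial.aeval (genX d' e' P' Q') b) =
      MvPolynomial.aeval (genX d e P Q) (σ.symm b) := fun b => by
    rw [AlgEquiv.symm_apply_eq, hσ, σ.apply_symm_apply]
  have hιK : Function.Injective (algebraMap (Base k n) (Frac k n)) := IsFractionRing.injective _ _
  set ζ := φ.symm (genZ d' e' P' Q') with hζ
  obtain ⟨v, q, hq⟩ := exists_powProd_mul_eq d e P Q ζ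
  obtain ⟨v', p, hp⟩ := exists_powProd_mul_eq d' e' P' Q' (φ (genZ d e P Q))
  set r := toGeneric d e P Q ζ with hr
  have hq' : C (algebraMap (Base k n) (Frac k n) (powProd MvPolynomial.X v)) * r =
      q.map (algebraMap (Base k n) (Frac k n)) := by
    have := congrArg (toGeneric d e P Q) hq
    rwa [map_mul, toGeneric_evalXZ, powProd_genX, toGeneric_aeval] at this
  set β : Base k n := σ.symm (powProd MvPolynomial.X v') with hβ
  have hβ0 : β ≠ 0 := by
    rw [hβ, Ne, map_eq_zero_iff _ σ.symm.injective]; exact powProd_X_ne_zero v'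
  -- Up to a denominator β, Z is a polynomial p in ζ over k[X]. Degrees multiply under composition,
  -- so ζ has degree 1 in Z.
  have hdeg : r.natDegree = 1 := by
    have h1 := congrArg (fun a => toGeneric d e P Q (φ.symm a)) hp
    simp only [powProd_genX, map_mul, hσ', φ.symm_apply_apply, toGeneric_aeval,
      toGeneric_genZ] at h1
    have h2 : toGeneric d e P Q (φ.symm (evalXZ (genX d' e' P' Q') (genZ d' e' P' Q') p)) =
        evalXZ (fun i => C (algebraMap (Base k n) (Frac k n) (σ.symm (MvPolynomial.X i)))) r p := by
      have := map_evalXZ ((toGeneric d e P Q).comp (φ.symm : L d' e' P' Q' →ₐ[k] L d e P Q))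
        (genX d' e' P' Q') (genZ d' e' P' Q') p
      refine this.trans ?_
      congr 2
      funext i
      have h3 := hσ' (MvPolynomial.X i)
      rw [MvPolynomial.aeval_X] at h3
      simp [h3, toGeneric_aeval]
    rw [h2, evalXZ_eq_comp] at h1
    have h3 := congrArg natDegree h1
    rw [natDegree_C_mul_X _ ((map_ne_zero_iff _ hιK).2 hβ0), natDegree_comp] at h3
    exact Nat.eq_one_of_mul_eq_one_left h3.symm
  have hqdeg : q.natDegree = 1 := by
    rw [← natDegree_map_eq_of_injective hιK, ← hq', natDegree_C_mul, hdeg]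
    exact (map_ne_zero_iff _ hιK).2 (powProd_X_ne_zero v)
  obtain ⟨a, c, g, hac, hga, hgc⟩ := UniqueFactorizationMonoid.exists_reduced_factors'
    (q.coeff 1) (powProd MvPolynomial.X v : Base k n) (powProd_X_ne_zero v)
  have hgc0 : g ≠ 0 ∧ c ≠ 0 := by
    rw [← mul_ne_zero_iff, hgc]; exact powProd_X_ne_zero v
  have ha0 : a ≠ 0 := by
    rintro rfl
    rw [mul_zero, ← hqdeg, eq_comm, coeff_natDegree, leadingCoeff_eq_zero] at hga
    simp [hga] at hqdeg
  have hgL : MvPolynomial.aeval (genX d e P Q) g ≠ 0 :=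
    (map_ne_zero_iff _ (aeval_genX_injective d e P Q)).2 hgc0.1
  rw [eq_X_add_C_of_natDegree_le_one hqdeg.le, map_add, map_mul, evalXZ_C, evalXZ_C, evalXZ_X,
    powProd_genX, ← hga, ← hgc, map_mul, map_mul] at hq
  -- After the fraction of the leading coefficient is reduced to a / c, the remainder cζ - aZ lies
  -- in L and in k(X), hence in k[X].
  have hconst : toGeneric d e P Q (MvPolynomial.aeval (genX d e P Q) c * ζ -
      MvPolynomial.aeval (genX d e P Q) a * genZ d e P Q) =
      C (algebraMap _ _ (q.coeff 0) / algebraMap _ _ g) := by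
    have h1 : MvPolynomial.aeval (genX d e P Q) g * (MvPolynomial.aeval (genX d e P Q) c * ζ -
      MvPolynomial.aeval (genX d e P Q) a * genZ d e P Q) =
        MvPolynomial.aeval (genX d e P Q) (q.coeff 0) := by
      linear_combination hq
    have h2 := congrArg (toGeneric d e P Q) h1
    rw [map_mul, toGeneric_aeval, toGeneric_aeval] at h2
    have hg0 : algebraMap (Base k n) (Frac k n) g ≠ 0 := (map_ne_zero_iff _ hιK).2 hgc0.1
    apply mul_left_cancel₀ (C_ne_zero.2 hg0)
    rw [h2, ← C_mul, mul_div_cancel₀ _ hg0]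
  obtain ⟨b, hb⟩ := exists_aeval_eq_of_toGeneric h hconst
  exact ⟨a, b, c, ha0, hgc0.2, hac, by rw [← hb]; ring⟩

/-- The linear coefficient of an exponential map which fixes the `Xᵢ` maps `Z` to a multiple of
`X^[d] X^[e]`. -/
lemma powProd_dvd_of_coeff_one (h : Admissible d e P Q) (hT : Transversal P Q)
    {δ : ExpMap k (L d e P Q)} (hX : ∀ i, δ.hom (genX d e P Q i) = C (genX d e P Q i))
    {f : Base k n} (hf : (δ.hom (genZ d e P Q)).coeff 1 = MvPolynomial.aeval (genX d e P Q) f) :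
    powProd MvPolynomial.X (d + e) ∣ f := by
  obtain ⟨w, hw⟩ := ExpMap.exists_powProd_mul_coeff_one hX (relation_genY d e P Q)
    (relation_genT d e P Q)
  rw [hf] at hw
  refine powProd_dvd h (fun i => ?_) _ f _ hw
  rw [map_add, map_mul _ (powProd _ _), map_powProd]
  have h1 : (fun j => toFibre h i (genX d e P Q j)) = fibreX P Q i :=
    funext fun j => toFibre_genX h i j
  rw [h1, powProd_fibreX (h.one_le_d i), zero_mul, add_zero]
  exact isUnit_toFibre h hT i

/-- A prime has total degree at least 1, while each variable has total degree 1. -/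
lemma sum_le_of_powProd_dvd {w : Fin n → Base k n} (hw : ∀ i, Prime (w i)) {v v' : Fin n → ℕ}
    (hdvd : powProd w v ∣ powProd MvPolynomial.X v') : ∑ i, v i ≤ ∑ i, v' i := by
  have h1 := MvPolynomial.totalDegree_le_of_dvd_of_isDomain hdvd (powProd_X_ne_zero v')
  have h2 : (powProd MvPolynomial.X v' : Base k n).totalDegree ≤ ∑ i, v' i := by
    refine (MvPolynomial.totalDegree_finsetProd _ _).trans (Finset.sum_le_sum fun i _ => ?_)
    refine (MvPolynomial.totalDegree_pow _ _).trans ?_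
    simp
  have hw1 : ∀ i, 1 ≤ (w i).totalDegree := fun i => by
    by_contra hlt
    have h0 : (w i).totalDegree = 0 := by omega
    rw [MvPolynomial.totalDegree_eq_zero_iff_eq_C] at h0
    refine (hw i).not_isUnit ?_
    rw [h0]
    refine (IsUnit.mk0 _ fun hc => (hw i).ne_zero ?_).map MvPolynomial.C
    rw [h0, hc, map_zero]
  have hpow : ∀ (p : Base k n) (m : ℕ), p ≠ 0 → (p ^ m).totalDegree = m * p.totalDegree := by
    intro p m hp
    induction m with
    | zero => simp
    | succ m ih =>
      rw [pow_succ, MvPolynomial.totalDegree_mul_of_isDomain (pow_ne_zero _ hp) hp, ih]; ring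
  have hprod : ∀ s : Finset (Fin n), ∑ i ∈ s, v i ≤ (∏ i ∈ s, w i ^ v i).totalDegree := by
    intro s
    induction s using Finset.induction_on with
    | empty => simp
    | insert i s his ih =>
      rw [Finset.sum_insert his, Finset.prod_insert his,
        MvPolynomial.totalDegree_mul_of_isDomain (pow_ne_zero _ (hw i).ne_zero)
          (Finset.prod_ne_zero_iff.2 fun j _ => pow_ne_zero _ (hw j).ne_zero),
        hpow _ _ (hw i).ne_zero]
      exact add_le_add (Nat.le_mul_of_pos_right _ (hw1 i)) ih
  exact (hprod Finset.univ).trans (h1.trans h2)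

/-- An isomorphism does not increase the exponents. -/
lemma sum_le_of_algEquiv (h : Admissible d e P Q) (h' : Admissible d e' P Q)
    (hT : Transversal P Q) [IsDomain (L d e P Q)] [IsDomain (L d e' P Q)]
    (φ : L d e P Q ≃ₐ[k] L d e' P Q) : ∑ i, e' i ≤ ∑ i, e i := by
  obtain ⟨σ, hσ⟩ := exists_baseEquiv h h' φ
  obtain ⟨a, b, c, ha0, hc0, hac, hlin⟩ := exists_linear_symm_genZ h φ hσ
  obtain ⟨δ, hX, hZ⟩ := exists_standardExp d e P Q
  set A := (MvPolynomial.aeval (genX d e P Q) : Base k n →ₐ[k] L d e P Q) with hA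
  have hδA : ∀ b, δ.hom (A b) = C (A b) := fun b => ExpMap.hom_aeval hX b
  have hcL : A c ≠ 0 := (map_ne_zero_iff _ (aeval_genX_injective d e P Q)).2 hc0
  have h1 : A c * (δ.hom (φ.symm (genZ d e' P Q))).coeff 1 =
      A (a * powProd MvPolynomial.X (d + e)) := by
    have := congrArg (fun a => (δ.hom a).coeff 1) hlin
    simp only [map_mul, map_add, hδA, hZ, coeff_C_mul, coeff_add, coeff_C_succ, coeff_mul_X,
      coeff_C_zero, zero_add, add_zero] at this
    rw [this, map_mul, ← powProd_genX, powProd_add]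
  obtain ⟨f, hf⟩ : ∃ f, (δ.hom (φ.symm (genZ d e' P Q))).coeff 1 = A f := by
    refine exists_aeval_eq_of_toGeneric h
      (β := algebraMap _ _ (a * powProd MvPolynomial.X (d + e)) / algebraMap _ _ c) ?_
    have h2 := congrArg (toGeneric d e P Q) h1
    rw [map_mul, toGeneric_aeval, toGeneric_aeval] at h2
    have hc1 : algebraMap (Base k n) (Frac k n) c ≠ 0 :=
      (map_ne_zero_iff _ (IsFractionRing.injective _ _)).2 hc0
    apply mul_left_cancel₀ (C_ne_zero.2 hc1)
    rw [h2, ← C_mul, mul_div_cancel₀ _ hc1]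
  have h2 : c * f = a * powProd MvPolynomial.X (d + e) := by
    apply aeval_genX_injective d e P Q
    rw [map_mul, ← hA, ← hf, h1]
  -- The transported exponential map fixes the Xᵢ of the target, and its linear coefficient at Z is
  -- σf.
  have h3 : powProd MvPolynomial.X (d + e') ∣ σ f := by
    refine powProd_dvd_of_coeff_one h' hT (δ := δ.transport φ) (fun i => ?_) ?_
    · rw [ExpMap.transport_eq_C_iff]
      have h4 : φ.symm (genX d e' P Q i) = A (σ.symm (MvPolynomial.X i)) := by
        rw [AlgEquiv.symm_apply_eq, hσ, σ.apply_symm_apply, MvPolynomial.aeval_X]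
      rw [h4, hδA]
    · rw [ExpMap.transport_coeff, hf, hσ]
  set w : Fin n → Base k n := fun i => σ.symm (MvPolynomial.X i) with hw
  have hwp : ∀ i, Prime (w i) := fun i =>
    (MulEquiv.prime_iff σ.symm.toMulEquiv).2 MvPolynomial.X_prime
  have h4 : powProd w (d + e') ∣ f := by
    have := map_dvd σ.symm h3
    rwa [σ.symm_apply_apply, map_powProd] at this
  -- If w j divided a, the linear relation read in the target would be σ(c) Z ≡ σ(b) modulo Xⱼ. This
  -- forces Xⱼ ∣ σ(c), so w j would be a common factor of a and c.
  have hwa : ∀ j, ¬ w j ∣ a := by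
    rintro j ⟨a', rfl⟩
    refine (hwp j).not_isUnit (hac (dvd_mul_right _ _) ?_)
    have h5 : MvPolynomial.X j ∣ σ c := by
      refine X_dvd_of_genX_dvd_sub h' j (b := σ b) ⟨φ (A a' * genZ d e P Q), ?_⟩
      have h6 := congrArg φ hlin
      rw [map_mul, map_add, map_mul, φ.apply_symm_apply, hσ, hσ, hσ, map_mul, hw,
        σ.apply_symm_apply, map_mul, MvPolynomial.aeval_X] at h6
      rw [h6, map_mul, hσ]
      ring
    have := map_dvd σ.symm h5
    rwa [σ.symm_apply_apply] at this
  have h5 : powProd w (d + e') ∣ powProd MvPolynomial.X (d + e) := by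
    refine IsRelPrime.dvd_of_dvd_mul_left (y := a) ?_ (h2 ▸ h4.mul_left c)
    exact IsRelPrime.prod_left fun i _ =>
      ((hwp i).irreducible.isRelPrime_iff_not_dvd.2 (hwa i)).pow_left
  have h6 := sum_le_of_powProd_dvd hwp h5
  simp only [Pi.add_apply, Finset.sum_add_distrib] at h6
  omega

end Isomorphism

end

/-! ### Stable isomorphism -/

section

variable {k : Type u} [Field k] {n : ℕ} {d e e' : Fin n → ℕ}
  {P : (Base k n)[X]} {Q : (Base k n)[X][X]}

section Bezout

lemma setZero_surjective (i : Fin n) : Function.Surjective (setZero k i) := fun b =>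
  ⟨MvPolynomial.rename Subtype.val b, by
    have : (setZero k i).comp (MvPolynomial.rename Subtype.val) = AlgHom.id k _ :=
      MvPolynomial.algHom_ext fun j => by simp [setZero, j.2]
    exact DFunLike.congr_fun this b⟩

lemma sup_eq_top_of_map_eq_top {R : Type v} {R' : Type w} [CommRing R] [CommRing R'] {π : R →+* R'}
    (hπ : Function.Surjective π) {I J : Ideal R} (hJ : RingHom.ker π ≤ J) (hI : I.map π = ⊤) :
    I ⊔ J = ⊤ := by
  refine top_unique (le_trans ?_ (sup_le_sup_left hJ _))
  rw [RingHom.ker, ← Ideal.comap_map_of_surjective π hπ, hI, Ideal.comap_top]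

/-- p' is a unit modulo p, so multiplying q' by it does not change the ideal. -/
lemma span_mul_eq_top {R : Type v} [CommRing R] {p p' q q' : R}
    (h₁ : ∃ a b, a * p + b * p' = 1) (h₂ : Ideal.span {p, q, q'} = ⊤) :
    Ideal.span {p, q, q' * p'} = ⊤ := by
  obtain ⟨a, b, hab⟩ := h₁
  rw [Ideal.eq_top_iff_one, Ideal.mem_span_insert] at h₂ ⊢
  obtain ⟨α, s, hs, h₂⟩ := h₂
  obtain ⟨β, γ, rfl⟩ := Ideal.mem_span_pair.1 hs
  refine ⟨α + γ * q' * a, _, Ideal.mem_span_pair.2 ⟨β, γ * b, rfl⟩, ?_⟩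
  linear_combination h₂ - γ * q' * hab

lemma C_C_dvd_of_map_eq_zero {B : Type v} {B' : Type w} [CommRing B] [CommRing B'] {π : B →+* B'}
    {x : B} (hx : ∀ b, π b = 0 → x ∣ b) {q : B[X][X]} (hq : q.map (mapRingHom π) = 0) :
    C (C x) ∣ q := by
  rw [C_dvd_iff_dvd_coeff]
  intro l
  rw [C_dvd_iff_dvd_coeff]
  intro m
  apply hx
  have := congrArg (fun q => (q.coeff l).coeff m) hq
  simpa using this

/-- The kernel of reduction modulo x is generated by x, so a unit ideal downstairs lifts to one
upstairs after x is added. -/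
lemma span_sup_eq_top {B : Type v} {B' : Type w} [CommRing B] [CommRing B'] {π : B →+* B'}
    (hπ : Function.Surjective π) {x : B} (hx : ∀ b, π b = 0 → x ∣ b) {p : B[X]} {q : B[X][X]}
    (h₁ : Ideal.span {p.map π, (derivative p).map π} = ⊤)
    (h₂ : Ideal.span {C (p.map π), q.map (mapRingHom π), (derivative q).map (mapRingHom π)} = ⊤) :
    Ideal.span {C p, q, derivative q * C (derivative p)} ⊔ Ideal.span {C (C x)} = ⊤ := by
  refine sup_eq_top_of_map_eq_top (π := mapRingHom (mapRingHom π))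
    (map_surjective _ (map_surjective _ hπ))
    (fun q hq => Ideal.mem_span_singleton.2 (C_C_dvd_of_map_eq_zero hx hq)) ?_
  obtain ⟨a, b, hab⟩ := Ideal.mem_span_pair.1 ((Ideal.eq_top_iff_one _).1 h₁)
  have h₃ := span_mul_eq_top ⟨C a, C b, by rw [← C_mul, ← C_mul, ← C_add, hab, C_1]⟩ h₂
  rw [Ideal.map_span, ← h₃]
  congr 1
  simp only [Set.image_insert_eq, Set.image_singleton, coe_mapRingHom, Polynomial.map_mul, map_C]

/-- An ideal comaximal with each x i is comaximal with their product. -/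
lemma exists_bezout_of_sup_eq_top {R : Type v} {ι : Type*} [CommRing R] {p q r : R} {x : ι → R}
    (S : Finset ι) (h : ∀ i, Ideal.span {p, q, r} ⊔ Ideal.span {x i} = ⊤) :
    ∃ c α β γ : R, c * r + α * p + β * q + γ * (∏ i ∈ S, x i) = 1 := by
  have h1 := Ideal.sup_prod_eq_top (s := S) fun i _ => h i
  rw [Ideal.prod_span_singleton, Ideal.eq_top_iff_one, Submodule.mem_sup] at h1
  obtain ⟨a, ha, b, hb, hab⟩ := h1
  rw [Ideal.mem_span_insert] at ha
  obtain ⟨α, s, hs, rfl⟩ := ha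
  obtain ⟨β, c, rfl⟩ := Ideal.mem_span_pair.1 hs
  obtain ⟨γ, rfl⟩ := Ideal.mem_span_singleton'.1 hb
  refine ⟨c, α, β, γ, ?_⟩
  rw [← hab]
  ring

lemma exists_bezout_of_map_span_eq_top {B : Type v} {ι : Type*} {B' : ι → Type w} [CommRing B]
    [∀ i, CommRing (B' i)] {π : ∀ i, B →+* B' i} (hπ : ∀ i, Function.Surjective (π i)) {x : ι → B}
    (hx : ∀ i b, π i b = 0 → x i ∣ b) {p : B[X]} {q : B[X][X]}
    (h₁ : ∀ i, Ideal.span {p.map (π i), (derivative p).map (π i)} = ⊤)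
    (h₂ : ∀ i, Ideal.span {C (p.map (π i)), q.map (mapRingHom (π i)),
      (derivative q).map (mapRingHom (π i))} = ⊤) (S : Finset ι) :
    ∃ c α β γ : B[X][X], c * (derivative q * C (derivative p)) + α * C p + β * q +
      γ * C (C (∏ i ∈ S, x i)) = 1 := by
  have h := exists_bezout_of_sup_eq_top (x := fun i => C (C (x i))) S fun i =>
    span_sup_eq_top (hπ i) (hx i) (h₁ i) (h₂ i)
  simpa only [map_prod] using h

lemma exists_bezout (hT : Transversal P Q) (S : Finset (Fin n)) :
    ∃ c α β γ : (Base k n)[X][X], c * (derivative Q * C (derivative P)) + α * C P + β * Q +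
      γ * C (C (∏ i ∈ S, MvPolynomial.X i)) = 1 :=
  exists_bezout_of_map_span_eq_top (π := fun i => (setZero k i).toRingHom) setZero_surjective
    (fun i _ => X_dvd_of_setZero_eq_zero i) (fun i => (hT i).1) (fun i => (hT i).2) S

end Bezout

section Solutions

variable {R : Type v} [CommRing R] [Algebra k R] {S : Finset (Fin n)}

lemma prod_dvd_powProd (x : Fin n → R) {a : Fin n → ℕ} (ha : ∀ i, 1 ≤ a i)
    (S : Finset (Fin n)) : ∏ i ∈ S, x i ∣ powProd x a :=
  (Finset.prod_dvd_prod_of_subset S _ _ S.subset_univ).trans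
    (Finset.prod_dvd_prod_of_dvd _ _ fun i _ => dvd_pow_self _ (by have := ha i; omega))

lemma powProd_eq_mul_prod (x : Fin n → R) (he : ∀ i, e' i = if i ∈ S then e i + 1 else e i) :
    powProd x e' = powProd x e * ∏ i ∈ S, x i := by
  have h1 : ∏ i ∈ S, x i = ∏ i, if i ∈ S then x i else 1 := by simp
  rw [powProd, powProd, h1, ← Finset.prod_mul_distrib]
  refine Finset.prod_congr rfl fun i _ => ?_
  rw [he]
  split_ifs <;> simp [pow_succ]

/-- The coefficient `c` inverts the Jacobian modulo `∏ Xᵢ`. -/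
def IsInverse (P : (Base k n)[X]) (Q : (Base k n)[X][X]) (S : Finset (Fin n))
    (c : (Base k n)[X][X]) : Prop :=
  ∃ α β γ : (Base k n)[X][X], c * (derivative Q * C (derivative P)) + α * C P + β * Q +
    γ * C (C (∏ i ∈ S, MvPolynomial.X i)) = 1

lemma IsInverse.dvd_one_sub {c : (Base k n)[X][X]} (hc : IsInverse P Q S c) (x : Fin n → R)
    {y z : R} (hP : ∏ i ∈ S, x i ∣ evalXZ x z P) (hQ : ∏ i ∈ S, x i ∣ evalXYZ x y z Q) :
    ∏ i ∈ S, x i ∣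
      1 - evalXYZ x y z c * (evalXYZ x y z (derivative Q) * evalXZ x z (derivative P)) := by
  obtain ⟨α, β, γ, h⟩ := hc
  have h1 := congrArg (evalXYZ x y z) h
  simp only [map_add, map_mul, map_one, evalXYZ_C, evalXZ_C, map_prod, MvPolynomial.aeval_X] at h1
  obtain ⟨p, hp⟩ := hP
  obtain ⟨q, hq⟩ := hQ
  rw [hp, hq] at h1
  exact ⟨evalXYZ x y z α * p + evalXYZ x y z β * q + evalXYZ x y z γ, by
    linear_combination -h1⟩

/-- Let q be the product over S and w = -(ct - qv). Modulo q the translated t is t(1 - cJ), which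
vanishes as cJ ≡ 1; dividing it by q yields a solution for e'. -/
lemma exists_solution_succ (hd : ∀ i, 1 ≤ d i) (he : ∀ i, 1 ≤ e i)
    (he' : ∀ i, e' i = if i ∈ S then e i + 1 else e i) {c : (Base k n)[X][X]}
    (hc : IsInverse P Q S c) (x : Fin n → R) {y z t : R} (v : R)
    (hy : powProd x d * y = evalXZ x z P) (ht : powProd x e * t = evalXYZ x y z Q) :
    ∃ y' t' : R, powProd x d * y' = evalXZ x (z - powProd x d * powProd x e *
        (evalXYZ x y z c * t - (∏ i ∈ S, x i) * v)) P ∧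
      powProd x e' * t' = evalXYZ x y' (z - powProd x d * powProd x e *
        (evalXYZ x y z c * t - (∏ i ∈ S, x i) * v)) Q := by
  have hD := prod_dvd_powProd x hd S
  have hE := prod_dvd_powProd x he S
  obtain ⟨r, hr⟩ := hc.dvd_one_sub x (hy ▸ hD.mul_right y) (ht ▸ hE.mul_right t)
  obtain ⟨y', t', hy', ht', -, ⟨s, hs⟩⟩ := exists_translate P Q x
    (-(evalXYZ x y z c * t - (∏ i ∈ S, x i) * v)) hy ht hD hE
  rw [mul_neg, ← sub_eq_add_neg] at hy' ht'
  refine ⟨y', s + t * r + v * (evalXYZ x y z (derivative Q) * evalXZ x z (derivative P)), hy', ?_⟩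
  rw [powProd_eq_mul_prod x he', ← ht', mul_assoc]
  congr 1
  linear_combination -hs - t * hr

/-- A solution t for e' gives the solution qt for e. Translation by w makes it t' ≡ wJ modulo q, so
ct' ≡ w, and v is the quotient of ct' - w by q. The coefficient c may be evaluated at the new point,
as y and z change by multiples of q only. -/
lemma exists_solution_pred (hd : ∀ i, 1 ≤ d i) (he : ∀ i, 1 ≤ e i)
    (he' : ∀ i, e' i = if i ∈ S then e i + 1 else e i) {c : (Base k n)[X][X]}
    (hc : IsInverse P Q S c) (x : Fin n → R) {y z t : R} (w : R)
    (hy : powProd x d * y = evalXZ x z P) (ht : powProd x e' * t = evalXYZ x y z Q) :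
    ∃ y' t' v : R, powProd x d * y' = evalXZ x (z + powProd x d * powProd x e * w) P ∧
      powProd x e * t' = evalXYZ x y' (z + powProd x d * powProd x e * w) Q ∧
      (∏ i ∈ S, x i) * v = evalXYZ x y' (z + powProd x d * powProd x e * w) c * t' - w := by
  have hD := prod_dvd_powProd x hd S
  have hE := prod_dvd_powProd x he S
  rw [powProd_eq_mul_prod x he', mul_assoc] at ht
  obtain ⟨r, hr⟩ := hc.dvd_one_sub x (hy ▸ hD.mul_right y) (ht ▸ hE.mul_right _)
  obtain ⟨y', t', hy', ht', hyd, ⟨s, hs⟩⟩ := exists_translate P Q x w hy ht hD hE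
  have hz : ∏ i ∈ S, x i ∣ z + powProd x d * powProd x e * w - z := by
    rw [add_sub_cancel_left, mul_assoc]; exact hD.mul_right _
  obtain ⟨l, hl⟩ := dvd_evalXYZ_sub x hyd hz c
  refine ⟨y', t', l * t' + evalXYZ x y z c * (s + t) - w * r, hy', ht', ?_⟩
  linear_combination -(t' * hl) - evalXYZ x y z c * hs + w * hr

end Solutions

section Extend

variable {A : Type v} {A' : Type w} [CommRing A] [CommRing A'] [Algebra k A] [Algebra k A']

/-- The extension of a homomorphism to polynomials. -/
def extend (f : A →ₐ[k] A') (r : A') : A[X] →ₐ[k] A' :=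
  eval₂AlgHom f r fun _ => mul_comm _ _

@[simp] lemma extend_C (f : A →ₐ[k] A') (r : A') (a : A) : extend f r (C a) = f a :=
  eval₂_C _ _

@[simp] lemma extend_X (f : A →ₐ[k] A') (r : A') : extend f r X = r :=
  eval₂_X _ _

lemma nonempty_algEquiv_of_inverse (f : A[X] →ₐ[k] A'[X]) (g : A'[X] →ₐ[k] A[X])
    (h₁ : (g.comp f).comp CAlgHom = CAlgHom) (h₂ : g (f X) = X)
    (h₃ : (f.comp g).comp CAlgHom = CAlgHom) (h₄ : f (g X) = X) :
    Nonempty (A[X] ≃ₐ[k] A'[X]) :=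
  ⟨AlgEquiv.ofAlgHom f g
    (AlgHom.coe_ringHom_injective (Polynomial.ringHom_ext (DFunLike.congr_fun h₃) h₄))
    (AlgHom.coe_ringHom_injective (Polynomial.ringHom_ext (DFunLike.congr_fun h₁) h₂))⟩

/-- Two substitutions, each translating the variable `Z` by a multiple of the other polynomial
variable, define inverse isomorphisms. -/
lemma nonempty_algEquiv_of_translate [IsDomain A] [IsDomain A'] {x : Fin n → A} {x' : Fin n → A'}
    {z g s a : A} {z' g' s' : A'} {f : A →ₐ[k] A'[X]} {f' : A' →ₐ[k] A[X]} {v : A'[X]}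
    (hx : ∀ i, x i ≠ 0) (hx' : ∀ i, x' i ≠ 0)
    (hext : ∀ f₁ f₂ : A →ₐ[k] A[X],
      (∀ i, IsLeftRegular (f₁ (x i))) → (∀ i, f₁ (x i) = f₂ (x i)) → f₁ z = f₂ z → f₁ = f₂)
    (hext' : ∀ f₁ f₂ : A' →ₐ[k] A'[X],
      (∀ i, IsLeftRegular (f₁ (x' i))) → (∀ i, f₁ (x' i) = f₂ (x' i)) → f₁ z' = f₂ z' → f₁ = f₂)
    (hfx : ∀ i, f (x i) = C (x' i)) (hfx' : ∀ i, f' (x' i) = C (x i)) (hg : f g = C g')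
    (hg' : f' g' = C g) (hs : f s = C s') (hs' : f' s' = C s) (hs0 : s ≠ 0)
    (hz : f z = C z' + C g' * X) (hz' : f' z' = C z - C g * (C a - C s * X))
    (hv : C s' * v = f a - X) : Nonempty (A[X] ≃ₐ[k] A'[X]) := by
  have h₁ : ((extend f' (C a - C s * X)).comp (extend f v)).comp CAlgHom = CAlgHom := by
    refine hext _ _ (fun i => ?_) (fun i => ?_) ?_
    · simpa [hfx, hfx'] using (IsRegular.of_ne_zero (C_ne_zero.2 (hx i))).left
    · simp [hfx, hfx']
    · simp [hz, hz', hg']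
  have h₂ : extend f v (C a - C s * X) = X := by
    rw [map_sub, map_mul, extend_C, extend_C, extend_X, hs, hv, sub_sub_cancel]
  refine nonempty_algEquiv_of_inverse (extend f v) (extend f' (C a - C s * X)) h₁ ?_ ?_ ?_
  · rw [extend_X]
    -- Applying the second substitution to s'v = f(a) - X gives s times the image of v equal to a -
    -- (a - sX) = sX; then s is cancelled.
    have h₃ := congrArg (extend f' (C a - C s * X)) hv
    have h₄ : extend f' (C a - C s * X) (f a) = C a := by
      simpa using DFunLike.congr_fun h₁ a
    rw [map_mul, map_sub, extend_C, extend_X, h₄, hs', sub_sub_cancel] at h₃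
    exact mul_left_cancel₀ (C_ne_zero.2 hs0) h₃
  · refine hext' _ _ (fun i => ?_) (fun i => ?_) ?_
    · simpa [hfx, hfx'] using (IsRegular.of_ne_zero (C_ne_zero.2 (hx' i))).left
    · simp [hfx, hfx']
    · simp only [AlgHom.comp_apply, CAlgHom_apply, extend_C, hz', map_sub, map_mul] at h₂ ⊢
      rw [h₂, hz, hg, add_sub_cancel_right]
  · rw [extend_X, h₂]

end Extend

section StableIsomorphism

/-- The algebras become isomorphic after adjoining a polynomial variable. -/
theorem nonempty_polynomial_algEquiv (h : Admissible d e P Q) (h' : Admissible d e' P Q)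
    (hT : Transversal P Q) {S : Finset (Fin n)}
    (he' : ∀ i, e' i = if i ∈ S then e i + 1 else e i)
    [IsDomain (L d e P Q)] [IsDomain (L d e' P Q)] :
    Nonempty ((L d e P Q)[X] ≃ₐ[k] (L d e' P Q)[X]) := by
  obtain ⟨c, hc⟩ : ∃ c, IsInverse P Q S c := exists_bezout hT S
  have hY := congrArg C (relation_genY d e P Q)
  have hT := congrArg C (relation_genT d e P Q)
  rw [C_mul, C_evalXZ, C_powProd] at hY
  rw [C_mul, C_evalXYZ, C_powProd] at hT
  have hY' := congrArg C (relation_genY d e' P Q)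
  have hT' := congrArg C (relation_genT d e' P Q)
  rw [C_mul, C_evalXZ, C_powProd] at hY'
  rw [C_mul, C_evalXYZ, C_powProd] at hT'
  obtain ⟨y₁, t₁, hy₁, ht₁⟩ := exists_solution_succ h.one_le_d h.one_le_e he' hc _ X hY hT
  obtain ⟨y₂, t₂, v, hy₂, ht₂, hv⟩ := exists_solution_pred h.one_le_d h.one_le_e he' hc _ X hY' hT'
  have hcg : ∀ a, lift _ y₂ _ t₂ hy₂ ht₂ (powProd (genX d e P Q) a) =
      C (powProd (genX d e' P Q) a) := fun a => by
    rw [map_powProd, C_powProd]; simp only [lift_genX]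
  have hcg' : ∀ a, lift _ y₁ _ t₁ hy₁ ht₁ (powProd (genX d e' P Q) a) =
      C (powProd (genX d e P Q) a) := fun a => by
    rw [map_powProd, C_powProd]; simp only [lift_genX]
  refine nonempty_algEquiv_of_translate (x := genX d e P Q) (x' := genX d e' P Q)
    (z := genZ d e P Q) (z' := genZ d e' P Q)
    (g := powProd (genX d e P Q) d * powProd (genX d e P Q) e)
    (g' := powProd (genX d e' P Q) d * powProd (genX d e' P Q) e)
    (s := ∏ i ∈ S, genX d e P Q i) (s' := ∏ i ∈ S, genX d e' P Q i)
    (a := evalXYZ (genX d e P Q) (genY d e P Q) (genZ d e P Q) c * genT d e P Q)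
    (f := lift _ y₂ _ t₂ hy₂ ht₂) (f' := lift _ y₁ _ t₁ hy₁ ht₁) (v := v)
    (genX_ne_zero h) (genX_ne_zero h') (fun f₁ f₂ h₁ h₂ h₃ => algHom_ext_of_isLeftRegular h₁ h₂ h₃)
    (fun f₁ f₂ h₁ h₂ h₃ => algHom_ext_of_isLeftRegular h₁ h₂ h₃)
    (fun i => lift_genX _ _ _ _ _ _ i) (fun i => lift_genX _ _ _ _ _ _ i)
    ?_ ?_ ?_ ?_ ?_ ?_ ?_ ?_
  · rw [map_mul, hcg, hcg, C_mul]
  · rw [map_mul, hcg', hcg', C_mul]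
  · rw [map_prod, map_prod]; simp only [lift_genX]
  · rw [map_prod, map_prod]; simp only [lift_genX]
  · exact Finset.prod_ne_zero_iff.2 fun i _ => genX_ne_zero h i
  · rw [lift_genZ, C_mul, C_powProd, C_powProd]
  · rw [lift_genZ, C_mul, C_mul, C_powProd, C_powProd, C_evalXYZ, map_prod]
  · rw [map_mul, lift_genT, map_evalXYZ, map_prod, hv, lift_genY, lift_genZ]
    simp only [lift_genX]

end StableIsomorphism

end

/-! ### Krull dimension and an example -/

section

section Dimension

/-- Incomparability bounds the dimension of A from above; lying over and going up lift chains of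
primes from R. -/
lemma ringKrullDim_eq_of_isIntegral (R : Type u) (A : Type v) [CommRing R] [CommRing A] [Algebra R A]
    [FaithfulSMul R A] [Algebra.IsIntegral R A] : ringKrullDim A = ringKrullDim R := by
  refine le_antisymm ?_ ?_
  · refine Order.krullDim_le_of_strictMono (PrimeSpectrum.comap (algebraMap R A)) ?_
    intro I J hIJ
    exact Ideal.IsIntegral.comap_lt_comap (R := R) (show I.asIdeal < J.asIdeal from hIJ)
  · refine iSup_le fun l => ?_
    obtain ⟨p, hp, hl⟩ := (Ideal.nonempty_primesOver (S := A) l.head.asIdeal).some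
    obtain ⟨m, hm, -, -⟩ := Ideal.exists_ltSeries_of_hasGoingUp l p
    rw [← hm]
    exact Order.LTSeries.length_le_krullDim m

lemma trdeg_eq_of_isAlgebraic (k : Type u) (B A : Type u) [Field k] [CommRing B] [CommRing A]
    [IsDomain A] [Algebra k B] [Algebra k A] [Algebra B A] [IsScalarTower k B A] [FaithfulSMul B A]
    [Algebra.IsAlgebraic B A] [Nontrivial B] : Algebra.trdeg k A = Algebra.trdeg k B := by
  rw [← trdeg_add_eq k B (A := A), trdeg_eq_zero (R := B), add_zero]

/-- By Noether normalization A is integral over a polynomial ring, which has the same transcendence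
degree and the same dimension. -/
lemma ringKrullDim_eq_of_trdeg_eq {k A : Type u} [Field k] [CommRing A] [IsDomain A] [Algebra k A]
    [Algebra.FiniteType k A] {N : ℕ} (h : Algebra.trdeg k A = N) : ringKrullDim A = N := by
  obtain ⟨s, g, hg, hint⟩ := exists_integral_inj_algHom_of_fg k A
  let _ : Algebra (MvPolynomial (Fin s) k) A := g.toRingHom.toAlgebra
  have : IsScalarTower k (MvPolynomial (Fin s) k) A :=
    IsScalarTower.of_algebraMap_eq fun r => (g.commutes r).symm
  have : FaithfulSMul (MvPolynomial (Fin s) k) A :=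
    (faithfulSMul_iff_algebraMap_injective _ _).2 hg
  have : Algebra.IsIntegral (MvPolynomial (Fin s) k) A := ⟨hint⟩
  rw [trdeg_eq_of_isAlgebraic k (MvPolynomial (Fin s) k) A, MvPolynomial.trdeg_of_isDomain] at h
  have hs : s = N := by simpa using h
  rw [ringKrullDim_eq_of_isIntegral (MvPolynomial (Fin s) k) A,
    MvPolynomial.ringKrullDim_of_isNoetherianRing, ringKrullDim_eq_zero_of_field, hs]
  simp

/-- Each element of A is a root of a linear polynomial bX - c over B with b ≠ 0, so A is algebraic
over B. -/
lemma ringKrullDim_eq_of_exists_mul_eq {k B A : Type u} [Field k] [CommRing A] [IsDomain A]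
    [CommRing B] [IsDomain B] [Algebra k A] [Algebra.FiniteType k A] [Algebra k B] {N : ℕ}
    (h : Algebra.trdeg k B = N) (f : B →+* A) (hf : Function.Injective f)
    (hk : ∀ r, f (algebraMap k B r) = algebraMap k A r)
    (hA : ∀ a, ∃ b c, b ≠ 0 ∧ f b * a = f c) : ringKrullDim A = N := by
  let _ : Algebra B A := f.toAlgebra
  have : IsScalarTower k B A := IsScalarTower.of_algebraMap_eq fun r => (hk r).symm
  have : FaithfulSMul B A := (faithfulSMul_iff_algebraMap_injective _ _).2 hf
  have : Algebra.IsAlgebraic B A := ⟨fun a => by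
    obtain ⟨b, c, hb, hbc⟩ := hA a
    refine ⟨C b * X - C c, fun h0 => hb ?_, ?_⟩
    · simpa [coeff_C] using congrArg (coeff · 1) h0
    · simpa [sub_eq_zero, RingHom.algebraMap_toAlgebra] using hbc⟩
  exact ringKrullDim_eq_of_trdeg_eq ((trdeg_eq_of_isAlgebraic k B A).trans h)

variable {k : Type u} [Field k] {n : ℕ} {d e : Fin n → ℕ}
  {P : (Base k n)[X]} {Q : (Base k n)[X][X]}

variable (k n) in
lemma trdeg_base_polynomial : Algebra.trdeg k (Base k n)[X] = (n + 1 : ℕ) := by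
  rw [← trdeg_add_eq k (Base k n) (A := (Base k n)[X]), Polynomial.trdeg_of_isDomain,
    MvPolynomial.trdeg_of_isDomain]
  simp

variable (d e P Q) in
/-- The Krull dimension of `L d e P Q` is `n + 1`. -/
theorem ringKrullDim_eq [IsDomain (L d e P Q)] [Algebra.FiniteType k (L d e P Q)] :
    ringKrullDim (L d e P Q) = (n + 1 : ℕ) := by
  refine ringKrullDim_eq_of_exists_mul_eq (trdeg_base_polynomial k n)
    (evalXZ (genX d e P Q) (genZ d e P Q)) (evalXZ_injective d e P Q) (fun r => ?_) fun a => ?_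
  · exact (evalXZ_C _ _ _).trans (AlgHom.commutes _ r)
  · obtain ⟨v, p, h⟩ := exists_powProd_mul_eq d e P Q a
    refine ⟨C (powProd MvPolynomial.X v), p, C_ne_zero.2 (powProd_X_ne_zero v), ?_⟩
    rw [evalXZ_C, ← powProd_genX, h]

end Dimension

section Examples

variable {k : Type u} [Field k] {n : ℕ} {d e : Fin n → ℕ}

variable (d e) in
instance finiteType (P : (Base k n)[X]) (Q : (Base k n)[X][X]) :
    Algebra.FiniteType k (L d e P Q) :=
  Algebra.FiniteType.of_surjective (Ideal.Quotient.mkₐ k (relations d e P Q))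
    (Ideal.Quotient.mkₐ_surjective k _)

lemma natDegree_X_sq_sub_X {R : Type v} [CommRing R] [Nontrivial R] :
    (X ^ 2 - X : R[X]).natDegree = 2 := by
  compute_degree!

lemma monic_X_sq_sub_X {R : Type v} [CommRing R] : (X ^ 2 - X : R[X]).Monic := by
  nontriviality R
  rw [Monic, leadingCoeff, natDegree_X_sq_sub_X]
  simp [coeff_X]

/-- The identity (2Z - 1)² - 4(Z² - Z) = 1 holds in every characteristic, so both ideals contain 1.
-/
lemma transversal_X_sq_sub_X : Transversal (k := k) (n := n) (X ^ 2 - X) (X ^ 2 - X) := by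
  intro i
  constructor
  · rw [Ideal.eq_top_iff_one, Ideal.mem_span_pair]
    refine ⟨-4, setZeroZ i (derivative (X ^ 2 - X)), ?_⟩
    simp [setZeroZ]
    ring
  · rw [Ideal.eq_top_iff_one, Ideal.mem_span_insert]
    refine ⟨0, _, Ideal.mem_span_pair.2 ⟨-4, setZeroYZ i (derivative (X ^ 2 - X)), rfl⟩, ?_⟩
    simp [setZeroYZ]
    ring

end Examples

end

/-! ### Conclusion -/

section

section Main

variable {k : Type u} [Field k] {n : ℕ} {d e e' : Fin n → ℕ}
  {P : (Base k n)[X]} {Q : (Base k n)[X][X]}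

/-- Raising some of the exponents `e` changes the isomorphism class. -/
theorem not_nonempty_algEquiv (h : Admissible d e P Q) (h' : Admissible d e' P Q)
    (hT : Transversal P Q) {S : Finset (Fin n)} (hS : S.Nonempty)
    (he' : ∀ i, e' i = if i ∈ S then e i + 1 else e i)
    [IsDomain (L d e P Q)] [IsDomain (L d e' P Q)] :
    ¬ Nonempty (L d e P Q ≃ₐ[k] L d e' P Q) := by
  rintro ⟨φ⟩
  refine (sum_le_of_algEquiv h h' hT φ).not_gt (Finset.sum_lt_sum (fun i _ => ?_) ?_)
  · rw [he']; split_ifs <;> omega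
  · obtain ⟨i, hi⟩ := hS
    exact ⟨i, Finset.mem_univ i, by rw [he', if_pos hi]; omega⟩

/-- Raising some of the exponents `e` yields stably isomorphic, nonisomorphic algebras. -/
theorem stably_isomorphic_not_isomorphic (h : Admissible d e P Q) (hT : Transversal P Q)
    {S : Finset (Fin n)} (hS : S.Nonempty) (he' : ∀ i, e' i = if i ∈ S then e i + 1 else e i) :
    (IsDomain (L d e P Q) ∧ Algebra.FiniteType k (L d e P Q) ∧
      ringKrullDim (L d e P Q) = (n + 1 : ℕ)) ∧
    (IsDomain (L d e' P Q) ∧ Algebra.FiniteType k (L d e' P Q) ∧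
      ringKrullDim (L d e' P Q) = (n + 1 : ℕ)) ∧
    ¬ Nonempty (L d e P Q ≃ₐ[k] L d e' P Q) ∧
    Nonempty ((L d e P Q)[X] ≃ₐ[k] (L d e' P Q)[X]) := by
  have h' : Admissible d e' P Q := ⟨h.one_le_d, fun i => by
    rw [he']; have := h.one_le_e i; split_ifs <;> omega, h.monic_P, h.two_le_P, h.monic_Q,
    h.two_le_Q⟩
  obtain ⟨i, -⟩ := id hS
  have := isDomain_of_admissible h i
  have := isDomain_of_admissible h' i
  exact ⟨⟨‹_›, inferInstance, ringKrullDim_eq d e P Q⟩,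
    ⟨‹_›, inferInstance, ringKrullDim_eq d e' P Q⟩, not_nonempty_algEquiv h h' hT hS he',
    nonempty_polynomial_algEquiv h h' hT he'⟩

/-- The Cancellation Problem has a negative answer in every dimension at least `2`. -/
theorem not_cancellationHolds (k : Type u) [Field k] {m : ℕ} (hm : 2 ≤ m) :
    ¬ CancellationHolds k m := by
  intro hc
  -- With n + 1 variables Xᵢ, at least one, the algebras have dimension n + 2.
  obtain ⟨n, rfl⟩ : ∃ n, m = n + 2 := ⟨m - 2, by omega⟩
  have h : Admissible (k := k) (fun _ : Fin (n + 1) => 1) (fun _ => 1) (X ^ 2 - X) (X ^ 2 - X) :=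
    ⟨fun _ => le_rfl, fun _ => le_rfl, monic_X_sq_sub_X, natDegree_X_sq_sub_X.ge,
      monic_X_sq_sub_X, natDegree_X_sq_sub_X.ge⟩
  obtain ⟨⟨_, _, h₁⟩, ⟨_, _, h₂⟩, h₃, h₄⟩ := stably_isomorphic_not_isomorphic h
    transversal_X_sq_sub_X (S := Finset.univ) Finset.univ_nonempty (e' := fun _ => 2) (by simp)
  exact h₃ (hc _ _ h₁ h₂ h₄)

end Main

end

end DoubleDanielewski

end

theorem corollary3p4 (k : Type u) [Field k] :
    (∀ (n : ℕ) (d e : Fin n → ℕ)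
        (P : (DoubleDanielewski.Base k n)[X]) (Q : (DoubleDanielewski.Base k n)[X][X]),
      (∀ i, 1 ≤ d i) → (∀ i, 1 ≤ e i) →
      P.Monic → 2 ≤ P.natDegree → Q.Monic → 2 ≤ Q.natDegree →
      (∀ i : Fin n,
        Ideal.span {DoubleDanielewski.setZeroZ i P,
          DoubleDanielewski.setZeroZ i (derivative P)} = ⊤ ∧
        Ideal.span {C (DoubleDanielewski.setZeroZ i P),
          DoubleDanielewski.setZeroYZ i Q,
          DoubleDanielewski.setZeroYZ i (derivative Q)} = ⊤) →
      ∀ (S : Finset (Fin n)) (e' : Fin n → ℕ), S.Nonempty →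
        (∀ i, e' i = if i ∈ S then e i + 1 else e i) →
        (IsDomain (DoubleDanielewski.L d e P Q) ∧
          Algebra.FiniteType k (DoubleDanielewski.L d e P Q) ∧
          ringKrullDim (DoubleDanielewski.L d e P Q) = (n + 1 : ℕ)) ∧
        (IsDomain (DoubleDanielewski.L d e' P Q) ∧
          Algebra.FiniteType k (DoubleDanielewski.L d e' P Q) ∧
          ringKrullDim (DoubleDanielewski.L d e' P Q) = (n + 1 : ℕ)) ∧
        ¬ Nonempty (DoubleDanielewski.L d e P Q ≃ₐ[k] DoubleDanielewski.L d e' P Q) ∧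
        Nonempty ((DoubleDanielewski.L d e P Q)[X] ≃ₐ[k] (DoubleDanielewski.L d e' P Q)[X])) ∧
    (∀ m : ℕ, 2 ≤ m → ¬ DoubleDanielewski.CancellationHolds k m) :=
  ⟨fun _ _ _ _ _ hd he hP hP₂ hQ hQ₂ hT _ _ hS he' =>
    DoubleDanielewski.stably_isomorphic_not_isomorphic ⟨hd, he, hP, hP₂, hQ, hQ₂⟩ hT hS he',
    fun _ hm => DoubleDanielewski.not_cancellationHolds k hm⟩
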